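/- A $7$-stage tableau with real entries consists of a matrix $A=(a_{ij})$, weights $b$, nodes $c$ and a vector $d$. It is an embedded $(4,5)$ pair of explicit methods with the FSAL property if $a_{ij}=0$ for $i\le j$, $\sum_j a_{ij}=c_i$, $c_7=1$, $a_{7j}=b_j$, the order conditions $b^T\Phi(t)=1/t!$ hold for all rooted trees $t$ with at most $5$ vertices, $d^T\Phi(t)=0$ holds for all rooted trees with at most $4$ vertices, and $d\ne 0$ (so $b+d$ are the weights of the fourth order method). Write $c'=Ac$, let $*$ be the componentwise product, and call a tableau satisfying all these requirements, with the possible exception of the order condition $b^T(c'*c')=\frac1{20}$, an almost-pair. A tableau is non-exceptional if $a_{32},a_{43},a_{54},a_{65}$ are non-zero and $c_4,c_5,c_6$ are pairwise distinct and different from $0,c_2,c_3$ (the coincidences $c_3=0$ and $c_3=c_2$ are allowed). There is a polynomial $F\in\mathbb Q[c_2,c_3,c_4,c_5,c'_3]$ of degrees $8,17,3,2,8$ in $c_2,c_3,c_4,c_5,c'_3$, respectively, such that the following holds. 1. Every non-exceptional almost-pair, in particular every non-exceptional pair, satisfies $$c_4=\frac{c'_3c_2\bigl(2c'_3-c_3(c_3-c_2)\bigr)}{\bigl(2c'_3(1-2c_2)-c_3(c_3-c_2)\bigr)^2+4c_3'^2c_2^2}\qquad(\ast)$$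 or $c_6=1$. 2. If a non-exceptional almost-pair satisfies $(\ast)$, then $d_7=0$ (it is effectively a $6$-stage pair), and the last condition $b^T(c'*c')=\frac1{20}$ holds if and only if at least one of the following does: type A: $c'_3=c_3^2/2$; type B: $2(3-12c_2+10c_2^2)\,c'_3=3(c_3-c_2)(c_2+c_3-4c_2c_3)$; type C: $$\begin{aligned}&\bigl[3Z(12,15,20)-3(c_2+c_3)Z(33,40,50)+2c_2c_3Z(138,165,200)\bigr]c_3^2(c_3-c_2)^2\\&-\bigl[(12+50c_2^2)\bigl(Z(12,15,20)-c_3Z(33,40,50)\bigr)-3c_2Z(207,260,350)+2c_2c_3Z(852,1035,1300)\bigr]c'_3c_3(c_3-c_2)\\&+\bigl[(2+10c_2c_3)Z(12,15,20)-15c_2Z(3,4,6)-2c_3Z(33,40,50)\bigr]\cdot2(3-12c_2+10c_2^2)c_3'^2=0,\end{aligned}$$ where $Z(\alpha_0,\alpha_1,\alpha_2)=\alpha_0-\alpha_1(c_5+c_6)+\alpha_2c_5c_6$. 3. If a non-exceptional almost-pair satisfies $c_6=1$, then the last condition holds if and only if $c'_3=c_3^2/2$ (type A$'$) or $F(c_2,c_3,c_4,c_5,c'_3)=0$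 (type B$'$). 4. A non-exceptional almost-pair satisfies the simplifying assumption $c'_i=c_i^2/2$ for all $i\ne2$ if and only if $c'_3=c_3^2/2$; so among the non-exceptional pairs exactly those of types A and A$'$ satisfy it. 5. A non-exceptional pair is determined by $A$ (whose last row is $b$) up to rescaling $d$ by a non-zero factor. The set of matrices $A$ of all non-exceptional pairs is the union of the five families given by the types A, B, C (with $(\ast)$) and A$'$, B$'$ (with $c_6=1$). Each of the five families has Hausdorff dimension $4$, and so has the part of it that lies in none of the other four. -/

import Mathlib

open scoped Matrix

/-- The coefficients of an embedded pair of `7`-stage Runge-Kutta methods. Stage `i` of the usual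
numbering `1, …, 7` has index `i - 1` in `Fin 7`. The higher order method has weights `b`, the lower
order one has weights `b + d`. -/
structure Tableau where
  a : Matrix (Fin 7) (Fin 7) ℝ
  b : Fin 7 → ℝ
  c : Fin 7 → ℝ
  d : Fin 7 → ℝ

namespace Tableau

/-- The methods are explicit. -/
def IsExplicit (M : Tableau) : Prop := ∀ i j, i ≤ j → M.a i j = 0

/-- The row sum condition `∑ j, a i j = c i`. -/
def RowSum (M : Tableau) : Prop := M.a *ᵥ 1 = M.c

/-- First Same As Last. -/
def IsFSAL (M : Tableau) : Prop := M.c 6 = 1 ∧ ∀ j, M.a 6 j = M.b j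

/-- `c' = A c`. -/
def c' (M : Tableau) : Fin 7 → ℝ := M.a *ᵥ M.c

/-- `c'' = A c'`. -/
def c'' (M : Tableau) : Fin 7 → ℝ := M.a *ᵥ M.c'

/-- `c''' = A c''`. -/
def c''' (M : Tableau) : Fin 7 → ℝ := M.a *ᵥ M.c''

/-- The pairs `(Φ(t), t!)` for the eight rooted trees `t` with at most `4` vertices; the product of
vectors is componentwise. -/
def treesUpToFour (M : Tableau) : List ((Fin 7 → ℝ) × ℝ) :=
  [(1, 1),
   (M.c, 2),
   (M.c * M.c, 3), (M.c', 6),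
   (M.c * M.c * M.c, 4), (M.c' * M.c, 8), (M.a *ᵥ (M.c * M.c), 12), (M.c'', 24)]

/-- The pairs `(Φ(t), t!)` for eight of the nine rooted trees `t` with `5` vertices, all except the
tree with `Φ(t) = c' * c'` and `t! = 20`. -/
def treesFive (M : Tableau) : List ((Fin 7 → ℝ) × ℝ) :=
  [(M.c * M.c * M.c * M.c, 5), (M.c' * M.c * M.c, 10), ((M.a *ᵥ (M.c * M.c)) * M.c, 15),
   (M.c'' * M.c, 30), (M.a *ᵥ (M.c * M.c * M.c), 20), (M.a *ᵥ (M.c' * M.c), 40),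
   (M.a *ᵥ (M.a *ᵥ (M.c * M.c)), 60), (M.c''', 120)]

/-- The order condition `bᵀ (c' * c') = 1 / 20` of the remaining tree with `5` vertices. -/
def LastCondition (M : Tableau) : Prop := M.b ⬝ᵥ (M.c' * M.c') = 1 / 20

/-- All the requirements on an embedded `(4, 5)` pair of explicit `7`-stage methods with the FSAL
property, the order condition `bᵀ (c' * c') = 1 / 20` excepted. -/
structure IsPairExceptLast (M : Tableau) : Prop where
  explicit : M.IsExplicit
  rowSum : M.RowSum
  fsal : M.IsFSAL
  order_b : ∀ t ∈ M.treesUpToFour ++ M.treesFive, M.b ⬝ᵥ t.1 = 1 / t.2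
  order_d : ∀ t ∈ M.treesUpToFour, M.d ⬝ᵥ t.1 = 0
  d_ne_zero : M.d ≠ 0

/-- `M` is an embedded `(4, 5)` pair of explicit `7`-stage methods with the FSAL property: `b`
satisfies the order conditions of all rooted trees with at most `5` vertices, `b + d` those of all
rooted trees with at most `4` vertices, and the two methods are distinct. -/
def IsPair (M : Tableau) : Prop := M.IsPairExceptLast ∧ M.LastCondition

/-- The elements of `A` right below the diagonal, in rows `3, …, 6`, do not vanish:
`a₃₂, a₄₃, a₅₄, a₆₅ ≠ 0`. -/
def SubdiagonalNeZero (M : Tableau) : Prop :=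
  M.a 2 1 ≠ 0 ∧ M.a 3 2 ≠ 0 ∧ M.a 4 3 ≠ 0 ∧ M.a 5 4 ≠ 0

/-- The nodes `c₄, c₅, c₆` are pairwise distinct and differ from `0, c₂, c₃`. -/
def NodesGeneric (M : Tableau) : Prop :=
  (∀ i : Fin 7, i = 3 ∨ i = 4 ∨ i = 5 → M.c i ≠ 0 ∧ M.c i ≠ M.c 1 ∧ M.c i ≠ M.c 2) ∧
    M.c 3 ≠ M.c 4 ∧ M.c 3 ≠ M.c 5 ∧ M.c 4 ≠ M.c 5

/-- The pairs that are not exceptional. -/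
def NonExceptional (M : Tableau) : Prop := M.SubdiagonalNeZero ∧ M.NodesGeneric

/-- The simplifying assumption `c'ᵢ = cᵢ² / 2` for `i ≠ 2`. -/
def Simplifying (M : Tableau) : Prop := ∀ i : Fin 7, i ≠ 1 → M.c' i = M.c i ^ 2 / 2

/-- The equation that expresses `c₄` through `x = c₂`, `y = c₃` and `u = c'₃`. -/
def C4Equation (M : Tableau) : Prop :=
  let x := M.c 1
  let y := M.c 2
  let u := M.c' 2
  M.c 3 = u * x * (2 * u - y * (y - x)) /
    ((2 * u * (1 - 2 * x) - y * (y - x)) ^ 2 + 4 * u ^ 2 * x ^ 2)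

/-- The equation of types A and A′. -/
def EqA (M : Tableau) : Prop := M.c' 2 = M.c 2 ^ 2 / 2

/-- The equation of type B, with the denominator cleared. -/
def EqB (M : Tableau) : Prop :=
  let x := M.c 1
  let y := M.c 2
  M.c' 2 * (2 * (3 - 12 * x + 10 * x ^ 2)) = 3 * (y - x) * (x + y - 4 * x * y)

/-- The equation of type C. -/
def EqC (M : Tableau) : Prop :=
  let x := M.c 1
  let y := M.c 2
  let u := M.c' 2
  let Z : ℝ → ℝ → ℝ → ℝ := fun α₀ α₁ α₂ =>
    α₀ - α₁ * (M.c 4 + M.c 5) + α₂ * (M.c 4 * M.c 5)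
  (3 * Z 12 15 20 - 3 * (x + y) * Z 33 40 50 + 2 * x * y * Z 138 165 200) *
        (y ^ 2 * (y - x) ^ 2)
    - ((12 + 50 * x ^ 2) * (Z 12 15 20 - y * Z 33 40 50) - 3 * x * Z 207 260 350
        + 2 * x * y * Z 852 1035 1300) * (u * y * (y - x))
    + ((2 + 10 * x * y) * Z 12 15 20 - 15 * x * Z 3 4 6 - 2 * y * Z 33 40 50) *
        (2 * (3 - 12 * x + 10 * x ^ 2) * u ^ 2) = 0

/-- The equation `F(c₂, c₃, c₄, c₅, c'₃) = 0`. -/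
def EqB' (F : MvPolynomial (Fin 5) ℚ) (M : Tableau) : Prop :=
  MvPolynomial.aeval ![M.c 1, M.c 2, M.c 3, M.c 4, M.c' 2] F = 0

end Tableau

/-- The five types of embedded pairs: A, B, C, A′, B′. -/
inductive PairType
  | A
  | B
  | C
  | A'
  | B'

/-- The equations that define each of the types; `F` is the polynomial of type B′. -/
def Tableau.HasType (F : MvPolynomial (Fin 5) ℚ) (M : Tableau) : PairType → Prop
  | .A => M.C4Equation ∧ M.EqA
  | .B => M.C4Equation ∧ M.EqB
  | .C => M.C4Equation ∧ M.EqC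
  | .A' => M.c 5 = 1 ∧ M.EqA
  | .B' => M.c 5 = 1 ∧ M.EqB' F

/-- The matrices `A` (with the weights `b` as the last row) of all non-exceptional pairs. -/
def allPairs : Set (Fin 7 → Fin 7 → ℝ) :=
  {a | ∃ M : Tableau, M.a = Matrix.of a ∧ M.IsPair ∧ M.NonExceptional}

/-- The matrices `A` (with the weights `b` as the last row) of all non-exceptional pairs of a given
type. -/
def family (F : MvPolynomial (Fin 5) ℚ) (k : PairType) : Set (Fin 7 → Fin 7 → ℝ) :=
  {a | ∃ M : Tableau, M.a = Matrix.of a ∧ M.IsPair ∧ M.NonExceptional ∧ M.HasType F k}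

/-!
Let `x = c₂`, `y = c₃`, `u = c'₃`, `Y = y (y - x)`, `T = Y - 2 u` and `z = x u`. The vector
`v = Y c' - u c (c - x)` vanishes at the first three stages, and so do `v * c`, `A v`,
`q = c' (c - y)` and `c''`. Their order conditions only involve the coefficients at the stages
`4, …, 7`, which form a `Chain`, and together with the conditions for `1`, `c` and `c'` they are
equivalent to all order conditions but the last. Indices in `Fin 7` are one less than the stage;
names such as `v4`, `f5`, `k6` carry the number of the stage itself.

*The dichotomy.* The rows `b A`, `b` and the unit row at stage `7` span `d` at the stages `5, 6, 7`.
The pairings of `d` with `A v` and `v * c - c₄ v`, which vanish at stage `4`, fix the coefficients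
of this combination up to a factor: they are the components of a cross product
(`Chain.Backbone.proportional`), whose last one is proportional to `d₇` and vanishes if and only if
the equation for `c₄` holds. This makes `d` unique. The row `b (1 - c) - b A` satisfies the same
equations as `d`, but has entry `0` at stage `7` and `b₆ (1 - c₆)` at stage `6`; hence the equation
for `c₄` holds or `c₆ = 1` (`Chain.Backbone.star_eq_zero`).

*The last condition.* The same relations determine the ratio of `v` and `q` at each of the stages
`4, 5, 6` (`Chain.StageForm`), thus `c'` itself, and the weights. The last order condition becomes a
sum of three rational functions. With denominators cleared it factors, into `u - y ^ 2 / 2` and the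
polynomials of types B and C if the equation for `c₄` holds (`Chain.sum_starP`), and into
`u - y ^ 2 / 2` and `F` if `c₆ = 1` (`Chain.sum_stageP`). These identities are obtained after
multiplication by a polynomial in `y` that is not identically zero, which continuity removes. The
degrees of `F` are found without expanding it, from the coefficient of the formally leading power of
each variable at an integer point (`PolyTerm.degreeOf_eq`).

*The dimension.* On a family, the entries of `A` are locally Lipschitz functions of five parameters,
`c₂, c₃, c'₃` and two nodes, which satisfy a polynomial equation (`Tableau.controlled_entries`); the
zero set of a non-zero polynomial in `n + 1` variables has dimension at most `n`
(`MvPolynomial.dimH_zeroSet_le`). Conversely, the equations of the chain can be solved for all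
parameters outside a proper closed set (`Chain.exists_of_star`, `Chain.exists_of_c6`). Near a
suitable rational point the equation of a type can be solved for one of the parameters, while those
of the other types fail there, so that the other four parameters, smooth functions of the matrix,
fill an open set.
-/

/-! ### The equations at the stages `4, …, 7` -/

/-- The coefficients of a tableau that act on vectors that vanish at the stages `1, 2, 3`. The
fields are numbered by the stages `1, …, 7`; the weight `b₇` is `0` and the node `c₇` is `1`. -/
structure Chain where
  c4 : ℝ
  c5 : ℝ
  c6 : ℝ
  b4 : ℝ
  b5 : ℝ
  b6 : ℝ
  a54 : ℝ
  a64 : ℝ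
  a65 : ℝ
  d4 : ℝ
  d5 : ℝ
  d6 : ℝ
  d7 : ℝ

namespace Chain

variable (C : Chain)

/-- The entry of the row `b A` at stage `4`. -/
def f4 : ℝ := C.b6 * C.a64 + C.b5 * C.a54

/-- The entry of the row `b A` at stage `5`; its entries at the stages `6` and `7` are `0`. -/
def f5 : ℝ := C.b6 * C.a65

/-- The vector `w` with entries `0, 0, 0, w4, w5, w6, w7` satisfies `b A w = mf`, `b w = mb`,
`b (w * c) = b w - b A w` and `d w = 0`. -/
structure Moment (w4 w5 w6 w7 mf mb : ℝ) : Prop where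
  f : C.f4 * w4 + C.f5 * w5 = mf
  b : C.b4 * w4 + C.b5 * w5 + C.b6 * w6 = mb
  bc : C.b4 * C.c4 * w4 + C.b5 * C.c5 * w5 + C.b6 * C.c6 * w6 = mb - mf
  d : C.d4 * w4 + C.d5 * w5 + C.d6 * w6 + C.d7 * w7 = 0

/-- The vector `v` with entries `0, 0, 0, v4, v5, v6, (T + 2 z) / 2`, and with it `v * c` and `A v`,
has the moments which the order conditions prescribe. -/
structure Backbone (T z v4 v5 v6 : ℝ) : Prop where
  v : C.Moment v4 v5 v6 ((T + 2 * z) / 2) ((T + 4 * z) / 24) ((T + 3 * z) / 6)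
  cv : C.Moment (C.c4 * v4) (C.c5 * v5) (C.c6 * v6) ((T + 2 * z) / 2) ((3 * T + 10 * z) / 120)
    ((3 * T + 8 * z) / 24)
  r : C.Moment 0 (C.a54 * v4) (C.a65 * v5 + C.a64 * v4) ((T + 3 * z) / 6) ((T + 5 * z) / 120)
    ((T + 4 * z) / 24)
  ne45 : C.c4 ≠ C.c5
  ne46 : C.c4 ≠ C.c6
  ne56 : C.c5 ≠ C.c6
  c4_ne : C.c4 ≠ 0
  a54_ne : C.a54 ≠ 0
  a65_ne : C.a65 ≠ 0

variable {C} {T z v4 v5 v6 : ℝ}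

/-- The row `b (1 - c) - b A` is orthogonal to `w`, as the row `d` is. -/
theorem Moment.e {w4 w5 w6 w7 mf mb : ℝ} (h : C.Moment w4 w5 w6 w7 mf mb) :
    (C.b4 * (1 - C.c4) - C.f4) * w4 + (C.b5 * (1 - C.c5) - C.f5) * w5
      + C.b6 * (1 - C.c6) * w6 = 0 := by
  linear_combination h.b - h.bc - h.f

namespace Backbone

/-- If `T + 5 z` were `0`, the moment of `A v` would force `f₅` or `v₄` to vanish; either
contradicts the moments of `v` and `v * c`. -/
theorem G_ne_zero (h : C.Backbone T z v4 v5 v6) (hz : z ≠ 0) : T + 5 * z ≠ 0 := by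
  intro hG
  obtain rfl : T = -5 * z := by linear_combination hG
  have hF := h.v.f
  have hF1 := h.cv.f
  have hr := h.r.f
  have er := h.r.e
  have ev := h.v.e
  have hr' : C.f5 * (C.a54 * v4) = 0 := by linear_combination hr
  rcases mul_eq_zero.1 hr' with h5 | h5
  · have hb6 : C.b6 = 0 := (mul_eq_zero.1 h5).resolve_right h.a65_ne
    have h4 : C.f4 * v4 = -z / 24 := by linear_combination hF - v5 * h5
    have h4' : C.f4 * v4 ≠ 0 := by rw [h4]; exact div_ne_zero (neg_ne_zero.2 hz) (by norm_num)
    have hc4 : C.c4 = 1 := by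
      have : C.f4 * v4 * (C.c4 - 1) = 0 := by linear_combination hF1 - hF + (v5 - C.c5 * v5) * h5
      linear_combination (mul_eq_zero.1 this).resolve_left h4'
    have hv4 : v4 ≠ 0 := right_ne_zero_of_mul h4'
    have e5 : C.b5 * (1 - C.c5) - C.f5 = 0 := by
      have : (C.b5 * (1 - C.c5) - C.f5) * (C.a54 * v4) = 0 := by
        rw [hb6] at er; linear_combination er
      exact (mul_eq_zero.1 this).resolve_right (mul_ne_zero h.a54_ne hv4)
    apply h4'
    rw [hb6, e5, hc4] at ev
    linear_combination -ev
  · have hv4 : v4 = 0 := (mul_eq_zero.1 h5).resolve_left h.a54_ne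
    rw [hv4] at hF hF1 er
    have h5' : C.f5 * v5 ≠ 0 := by
      have : C.f5 * v5 = -z / 24 := by linear_combination hF
      rw [this]; exact div_ne_zero (neg_ne_zero.2 hz) (by norm_num)
    have hc5 : C.c5 = 1 := by
      have : C.f5 * v5 * (C.c5 - 1) = 0 := by linear_combination hF1 - hF
      linear_combination (mul_eq_zero.1 this).resolve_left h5'
    have : C.f5 * v5 * (1 - C.c6) = 0 := by
      rw [f5]; linear_combination er
    have := (mul_eq_zero.1 this).resolve_left h5'
    exact h.ne56 (by linear_combination hc5 + this)

theorem prod_ne (h : C.Backbone T z v4 v5 v6) (hG : T + 5 * z ≠ 0) :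
    C.f5 * C.a54 * v4 ≠ 0 := by
  have : C.f5 * C.a54 * v4 = (T + 5 * z) / 120 := by linear_combination h.r.f
  rw [this]; exact div_ne_zero hG (by norm_num)

theorem f5_ne (h : C.Backbone T z v4 v5 v6) (hG : T + 5 * z ≠ 0) : C.f5 ≠ 0 :=
  left_ne_zero_of_mul (left_ne_zero_of_mul (h.prod_ne hG))

theorem b6_ne (h : C.Backbone T z v4 v5 v6) (hG : T + 5 * z ≠ 0) : C.b6 ≠ 0 :=
  left_ne_zero_of_mul (h.f5_ne hG)

theorem v4_ne (h : C.Backbone T z v4 v5 v6) (hG : T + 5 * z ≠ 0) : v4 ≠ 0 :=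
  right_ne_zero_of_mul (h.prod_ne hG)

/-- If `c₆ = 1`, the row `b (1 - c) - b A` vanishes. -/
theorem e_eq_zero (h : C.Backbone T z v4 v5 v6) (hG : T + 5 * z ≠ 0) (h6 : C.c6 = 1)
    {p4 p5 p6 p7 mf mb : ℝ} (hp : C.Moment p4 p5 p6 p7 mf mb) (hp5 : p5 ≠ 0) :
    C.f4 = C.b4 * (1 - C.c4) ∧ C.f5 = C.b5 * (1 - C.c5) := by
  have e1 := h.v.e
  have e2 := h.cv.e
  have e3 := hp.e
  rw [h6] at e1 e2 e3
  have h4 : C.b4 * (1 - C.c4) - C.f4 = 0 := by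
    have : (C.b4 * (1 - C.c4) - C.f4) * ((C.c4 - C.c5) * v4) = 0 := by
      linear_combination e2 - C.c5 * e1
    exact (mul_eq_zero.1 this).resolve_right
      (mul_ne_zero (sub_ne_zero.2 h.ne45) (h.v4_ne hG))
  rw [h4] at e3
  have h5 : (C.b5 * (1 - C.c5) - C.f5) * p5 = 0 := by linear_combination e3
  have h5 := (mul_eq_zero.1 h5).resolve_right hp5
  exact ⟨by linear_combination -h4, by linear_combination -h5⟩

end Backbone

/-- The coefficient of `b` in the combination `D f + δ b + d₇ e₇` of the rows `f = b A`, `b` and the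
unit row `e₇` that agrees with `d` at the stages `5, 6, 7`. -/
noncomputable def δ (C : Chain) : ℝ := C.d6 / C.b6

/-- The coefficient of `f = b A` in the combination described at `Chain.δ`. -/
noncomputable def D (C : Chain) : ℝ := (C.d5 - C.δ * C.b5) / C.f5

/-- The entry at stage `4` of the row `D f + δ b + d₇ e₇ - d`, whose entries at the later stages
are `0`. -/
noncomputable def ρ (C : Chain) : ℝ := C.D * C.f4 + C.δ * C.b4 - C.d4

theorem d6_eq (hb : C.b6 ≠ 0) : C.d6 = C.δ * C.b6 := by
  rw [δ]; field_simp

theorem d5_eq (hf : C.f5 ≠ 0) : C.d5 = C.D * C.f5 + C.δ * C.b5 := by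
  rw [D]; field_simp; ring

theorem d4_eq : C.d4 = C.D * C.f4 + C.δ * C.b4 - C.ρ := by
  rw [ρ]; ring

/-- The pairing of `w` with `D f + δ b + d₇ e₇ - d` has a single term, so the entry `w4` is
known up to the factor `ρ`. -/
theorem Moment.ρ_mul {w4 w5 w6 w7 mf mb : ℝ} (h : C.Moment w4 w5 w6 w7 mf mb)
    (hf : C.f5 ≠ 0) (hb : C.b6 ≠ 0) :
    C.ρ * w4 = C.D * mf + C.δ * mb + C.d7 * w7 := by
  have hd := h.d
  rw [d4_eq, d5_eq hf, d6_eq hb] at hd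
  linear_combination C.D * h.f + C.δ * h.b - hd

/-- The last component of the cross product in `Backbone.proportional`. It vanishes if and only if
`a = c₄` satisfies the equation for `c₄`. -/
def star (T z a : ℝ) : ℝ := a * (T ^ 2 + 8 * z * T + 20 * z ^ 2) + T * z

namespace Backbone

theorem orth_r (h : C.Backbone T z v4 v5 v6) (hG : T + 5 * z ≠ 0) :
    C.D * (T + 5 * z) / 120 + C.δ * (T + 4 * z) / 24 + C.d7 * (T + 3 * z) / 6 = 0 := by
  linear_combination -(h.r.ρ_mul (h.f5_ne hG) (h.b6_ne hG))

theorem ρ_mul_v (h : C.Backbone T z v4 v5 v6) (hG : T + 5 * z ≠ 0) :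
    C.ρ * v4 = C.D * (T + 4 * z) / 24 + C.δ * (T + 3 * z) / 6 + C.d7 * (T + 2 * z) / 2 := by
  linear_combination (h.v.ρ_mul (h.f5_ne hG) (h.b6_ne hG))

theorem ρ_mul_cv (h : C.Backbone T z v4 v5 v6) (hG : T + 5 * z ≠ 0) :
    C.ρ * v4 * C.c4 = C.D * (3 * T + 10 * z) / 120 + C.δ * (3 * T + 8 * z) / 24
      + C.d7 * (T + 2 * z) / 2 := by
  linear_combination (h.cv.ρ_mul (h.f5_ne hG) (h.b6_ne hG))

/-- The pairings with `A v` and with `v * c - c₄ v`, both of which vanish at stage `4`, make the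
triple `(D, δ, d₇)` orthogonal to two explicit vectors. It is proportional to their cross product,
here multiplied by `2880`. -/
theorem proportional (h : C.Backbone T z v4 v5 v6) (hG : T + 5 * z ≠ 0)
    (hTz : T ≠ 0 ∨ z ≠ 0) :
    ∃ t : ℝ, C.D = t * (20 * (C.c4 * (T ^ 2 + 6 * T * z + 12 * z ^ 2) + T * z)) ∧
      C.δ = t * (-8 * (C.c4 * (T ^ 2 + 7 * T * z + 15 * z ^ 2) + T * z)) ∧
      C.d7 = t * star T z C.c4 := by
  have h1 := h.orth_r hG
  have h2 := h.ρ_mul_cv hG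
  rw [h.ρ_mul_v hG] at h2
  set A2 := -8 * (C.c4 * (T ^ 2 + 7 * T * z + 15 * z ^ 2) + T * z) with hA2
  set A1 := 20 * (C.c4 * (T ^ 2 + 6 * T * z + 12 * z ^ 2) + T * z) with hA1
  have h12 : C.D * A2 = C.δ * A1 := by
    rw [hA1, hA2]
    linear_combination -2880 * ((T + 3 * z) / 6 * h2 + (T + 2 * z) / 2 * (1 - C.c4) * h1)
  have h13 : C.D * star T z C.c4 = C.d7 * A1 := by
    rw [hA1, star]
    linear_combination 2880 * ((T + 4 * z) / 24 * h2 +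
      ((3 * T + 8 * z) / 24 - C.c4 * (T + 3 * z) / 6) * h1)
  have h23 : C.δ * star T z C.c4 = C.d7 * A2 := by
    rw [hA2, star]
    linear_combination -2880 * ((T + 5 * z) / 120 * h2 +
      ((3 * T + 10 * z) / 120 - C.c4 * (T + 4 * z) / 24) * h1)
  by_cases h0 : A2 = 0
  · have h3 : star T z C.c4 ≠ 0 := by
      intro h3
      rw [star] at h3
      have hz : C.c4 * z * (T + 5 * z) = 0 := by linear_combination h3 + h0 / 8
      have hz : z = 0 :=
        (mul_eq_zero.1 ((mul_eq_zero.1 hz).resolve_right hG)).resolve_left h.c4_ne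
      rw [hz] at h3
      have hT : T ≠ 0 := hTz.resolve_right (not_not.2 hz)
      exact mul_ne_zero h.c4_ne (pow_ne_zero 2 hT) (by linear_combination h3)
    refine ⟨C.d7 / star T z C.c4, ?_, ?_, ?_⟩ <;> field_simp <;> linarith
  · refine ⟨C.δ / A2, ?_, ?_, ?_⟩ <;> field_simp <;> linarith

/-- `d` vanishes at the stages `4, …, 7` if `D`, `δ` and `d₇` do. -/
theorem d_eq_zero (h : C.Backbone T z v4 v5 v6) (hG : T + 5 * z ≠ 0)
    {p4 p5 p6 p7 mf mb : ℝ} (hp : C.Moment p4 p5 p6 p7 mf mb) (hp4 : p4 ≠ 0)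
    (hD : C.D = 0) (hδ : C.δ = 0) (h7 : C.d7 = 0) :
    C.d4 = 0 ∧ C.d5 = 0 ∧ C.d6 = 0 ∧ C.d7 = 0 := by
  have h5 := d5_eq (h.f5_ne hG)
  have h6 := d6_eq (h.b6_ne hG)
  have h4 := hp.ρ_mul (h.f5_ne hG) (h.b6_ne hG)
  have hρ := C.d4_eq
  rw [hD, hδ, h7] at h4
  have : C.ρ = 0 := (mul_eq_zero.1 (show C.ρ * p4 = 0 by linear_combination h4)).resolve_right hp4
  rw [hD, hδ, this] at hρ
  rw [hD, hδ] at h5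
  rw [hδ] at h6
  exact ⟨by linear_combination hρ, by linear_combination h5, by linear_combination h6, h7⟩

/-- If `ρ` vanished, the pairings with `A v` and `c''` would make `(D, δ, d₇)` a multiple of
`(20, -8, 1)`, which is not orthogonal to `v`. -/
theorem ρ_ne_zero (h : C.Backbone T z v4 v5 v6) (hz : z ≠ 0)
    {s4 s5 s6 : ℝ} (hs : C.Moment s4 s5 s6 (1 / 6) (1 / 120) (1 / 24))
    {p4 p5 p6 p7 mf mb : ℝ} (hp : C.Moment p4 p5 p6 p7 mf mb) (hp4 : p4 ≠ 0)
    (hd : ¬ (C.d4 = 0 ∧ C.d5 = 0 ∧ C.d6 = 0 ∧ C.d7 = 0)) : C.ρ ≠ 0 := by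
  intro hρ
  have hG := h.G_ne_zero hz
  have h1 := h.orth_r hG
  have h2 := hs.ρ_mul (h.f5_ne hG) (h.b6_ne hG)
  have h3 := h.ρ_mul_v hG
  have h4 := h.ρ_mul_cv hG
  rw [hρ] at h2 h3 h4
  have h5 : C.D * 5 / 120 + C.δ * 4 / 24 + C.d7 * 3 / 6 = 0 := by
    have : z * (C.D * 5 / 120 + C.δ * 4 / 24 + C.d7 * 3 / 6) = 0 := by
      linear_combination h1 + T * h2
    exact (mul_eq_zero.1 this).resolve_left hz
  have hδ : C.δ = -8 * C.d7 := by linear_combination -24 * h5 - 120 * h2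
  have hD : C.D = 20 * C.d7 := by linear_combination -120 * h2 - 5 * hδ
  have h7 : C.d7 = 0 := by
    have : z * C.d7 = 0 := by
      rw [hδ, hD] at h3 h4
      linear_combination -3 * h3
    exact (mul_eq_zero.1 this).resolve_left hz
  rw [h7] at hδ hD
  exact hd (h.d_eq_zero hG hp hp4 (by linear_combination hD) (by linear_combination hδ) h7)

/-- The chain whose row `d` is `b (1 - c) - b A`. That row satisfies the equations required of `d`,
so whatever holds for `d` holds for it. -/
def _root_.Chain.selfPaired (C : Chain) : Chain :=
  { C with
    d4 := C.b4 * (1 - C.c4) - C.f4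
    d5 := C.b5 * (1 - C.c5) - C.f5
    d6 := C.b6 * (1 - C.c6)
    d7 := 0 }

theorem _root_.Chain.Moment.selfPaired {w4 w5 w6 w7 mf mb : ℝ}
    (h : C.Moment w4 w5 w6 w7 mf mb) : C.selfPaired.Moment w4 w5 w6 w7 mf mb :=
  ⟨h.f, h.b, h.bc, by
    have := h.e
    simp only [Chain.selfPaired]
    linear_combination this⟩

theorem selfPaired (h : C.Backbone T z v4 v5 v6) : C.selfPaired.Backbone T z v4 v5 v6 :=
  ⟨h.v.selfPaired, h.cv.selfPaired, h.r.selfPaired, h.ne45, h.ne46, h.ne56, h.c4_ne, h.a54_ne,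
    h.a65_ne⟩

/-- The row `b (1 - c) - b A` has entry `0` at stage `7`, and `b₆ (1 - c₆)` at stage `6`. If
`c₆ ≠ 1` it is not zero, and the component `star` of the cross product has to vanish. -/
theorem star_eq_zero (h : C.Backbone T z v4 v5 v6) (hG : T + 5 * z ≠ 0)
    (hTz : T ≠ 0 ∨ z ≠ 0) (h6 : C.c6 ≠ 1) : star T z C.c4 = 0 := by
  obtain ⟨t, -, hδ, h7⟩ := h.selfPaired.proportional hG hTz
  have h60 : C.selfPaired.d6 ≠ 0 := mul_ne_zero (h.b6_ne hG) (sub_ne_zero.2 h6.symm)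
  have ht : t ≠ 0 := by
    rintro rfl
    exact h60 (by rw [d6_eq (h.selfPaired.b6_ne hG), hδ]; ring)
  exact (mul_eq_zero.1 h7.symm).resolve_left ht

/-- The row `d` is determined up to a scalar factor. -/
theorem d_unique {C' : Chain} (h : C.Backbone T z v4 v5 v6) (h' : C'.Backbone T z v4 v5 v6)
    (hG : T + 5 * z ≠ 0) (hTz : T ≠ 0 ∨ z ≠ 0)
    (hC : C' = { C with d4 := C'.d4, d5 := C'.d5, d6 := C'.d6, d7 := C'.d7 })
    {p4 p5 p6 p7 mf mb : ℝ} (hp : C.Moment p4 p5 p6 p7 mf mb)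
    (hp' : C'.Moment p4 p5 p6 p7 mf mb) (hp4 : p4 ≠ 0)
    (hd : ¬ (C.d4 = 0 ∧ C.d5 = 0 ∧ C.d6 = 0 ∧ C.d7 = 0))
    (hd' : ¬ (C'.d4 = 0 ∧ C'.d5 = 0 ∧ C'.d6 = 0 ∧ C'.d7 = 0)) :
    ∃ r : ℝ, r ≠ 0 ∧ C'.d4 = r * C.d4 ∧ C'.d5 = r * C.d5 ∧ C'.d6 = r * C.d6 ∧
      C'.d7 = r * C.d7 := by
  obtain ⟨t, hD, hδ, h7⟩ := h.proportional hG hTz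
  obtain ⟨t', hD', hδ', h7'⟩ := h'.proportional hG hTz
  have ht : t ≠ 0 := by
    rintro rfl
    exact hd (h.d_eq_zero hG hp hp4 (by rw [hD]; ring) (by rw [hδ]; ring) (by rw [h7]; ring))
  have ht' : t' ≠ 0 := by
    rintro rfl
    exact hd' (h'.d_eq_zero hG hp' hp4 (by rw [hD']; ring) (by rw [hδ']; ring) (by rw [h7']; ring))
  have e4 : C'.c4 = C.c4 := by rw [hC]
  have eb5 : C'.b5 = C.b5 := by rw [hC]
  have eb6 : C'.b6 = C.b6 := by rw [hC]
  have ef : C'.f5 = C.f5 := by rw [hC]; rfl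
  rw [e4] at hD' hδ' h7'
  have r5 : C'.d5 = t' / t * C.d5 := by
    rw [d5_eq (h.f5_ne hG), d5_eq (h'.f5_ne hG), hD, hδ, hD', hδ', ef, eb5]
    field_simp
  have r6 : C'.d6 = t' / t * C.d6 := by
    rw [d6_eq (h.b6_ne hG), d6_eq (h'.b6_ne hG), hδ, hδ', eb6]
    field_simp
  have r7 : C'.d7 = t' / t * C.d7 := by
    rw [h7, h7']
    field_simp
  refine ⟨t' / t, div_ne_zero ht' ht, ?_, r5, r6, r7⟩
  have q := hp.d
  have q' := hp'.d
  rw [r5, r6, r7] at q'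
  refine mul_right_cancel₀ hp4 ?_
  linear_combination q' - t' / t * q

end Backbone

end Chain

/-! ### The chain of a tableau -/

namespace Tableau

/-- The coefficients at the stages `4, …, 7`. -/
@[simps]
def chain (M : Tableau) : Chain where
  c4 := M.c 3
  c5 := M.c 4
  c6 := M.c 5
  b4 := M.b 3
  b5 := M.b 4
  b6 := M.b 5
  a54 := M.a 4 3
  a64 := M.a 5 3
  a65 := M.a 5 4
  d4 := M.d 3
  d5 := M.d 4
  d6 := M.d 5
  d7 := M.d 6

/-- The vector `w` satisfies `b A w = mf`, `b w = mb`, `b (w * c) = b w - b A w` and `d w = 0`. For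
the vectors below, these equations are linear combinations of order conditions. -/
structure VMoment (M : Tableau) (w : Fin 7 → ℝ) (mf mb : ℝ) : Prop where
  f : M.b ⬝ᵥ (M.a *ᵥ w) = mf
  b : M.b ⬝ᵥ w = mb
  bc : M.b ⬝ᵥ (w * M.c) = mb - mf
  d : M.d ⬝ᵥ w = 0

namespace VMoment

variable {M : Tableau} {w w' : Fin 7 → ℝ} {mf mb mf' mb' : ℝ}

theorem add (h : M.VMoment w mf mb) (h' : M.VMoment w' mf' mb') :
    M.VMoment (w + w') (mf + mf') (mb + mb') where
  f := by rw [Matrix.mulVec_add, dotProduct_add, h.f, h'.f]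
  b := by rw [dotProduct_add, h.b, h'.b]
  bc := by rw [add_mul, dotProduct_add, h.bc, h'.bc]; ring
  d := by rw [dotProduct_add, h.d, h'.d, add_zero]

theorem smul (r : ℝ) (h : M.VMoment w mf mb) : M.VMoment (r • w) (r * mf) (r * mb) where
  f := by rw [Matrix.mulVec_smul, dotProduct_smul, h.f, smul_eq_mul]
  b := by rw [dotProduct_smul, h.b, smul_eq_mul]
  bc := by rw [smul_mul_assoc, dotProduct_smul, h.bc, smul_eq_mul]; ring
  d := by rw [dotProduct_smul, h.d, smul_zero]

theorem congr (h : M.VMoment w mf mb) (hw : w' = w) (hf : mf' = mf) (hb : mb' = mb) :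
    M.VMoment w' mf' mb' := by
  rw [hw, hf, hb]; exact h

end VMoment

namespace IsExplicit

variable {M : Tableau}

theorem mulVec_zero (h : M.IsExplicit) (w : Fin 7 → ℝ) :
    (M.a *ᵥ w) 0 = 0 := by
  have e : ∀ i j : Fin 7, i ≤ j → M.a i j = 0 := h
  simp (disch := decide) [Matrix.mulVec, dotProduct, Fin.sum_univ_seven, e]

theorem mulVec_one (h : M.IsExplicit) (w : Fin 7 → ℝ) :
    (M.a *ᵥ w) 1 = M.a 1 0 * w 0 := by
  have e : ∀ i j : Fin 7, i ≤ j → M.a i j = 0 := h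
  simp (disch := decide) [Matrix.mulVec, dotProduct, Fin.sum_univ_seven, e]

theorem mulVec_two (h : M.IsExplicit) (w : Fin 7 → ℝ) :
    (M.a *ᵥ w) 2 = M.a 2 0 * w 0 + M.a 2 1 * w 1 := by
  have e : ∀ i j : Fin 7, i ≤ j → M.a i j = 0 := h
  simp (disch := decide) [Matrix.mulVec, dotProduct, Fin.sum_univ_seven, e]

theorem mulVec_three (h : M.IsExplicit) (w : Fin 7 → ℝ) :
    (M.a *ᵥ w) 3 = M.a 3 0 * w 0 + M.a 3 1 * w 1 + M.a 3 2 * w 2 := by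
  have e : ∀ i j : Fin 7, i ≤ j → M.a i j = 0 := h
  simp (disch := decide) [Matrix.mulVec, dotProduct, Fin.sum_univ_seven, e]

theorem mulVec_four (h : M.IsExplicit) (w : Fin 7 → ℝ) :
    (M.a *ᵥ w) 4 = M.a 4 0 * w 0 + M.a 4 1 * w 1 + M.a 4 2 * w 2 + M.a 4 3 * w 3 := by
  have e : ∀ i j : Fin 7, i ≤ j → M.a i j = 0 := h
  simp (disch := decide) [Matrix.mulVec, dotProduct, Fin.sum_univ_seven, e]

theorem mulVec_five (h : M.IsExplicit) (w : Fin 7 → ℝ) :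
    (M.a *ᵥ w) 5 = M.a 5 0 * w 0 + M.a 5 1 * w 1 + M.a 5 2 * w 2 + M.a 5 3 * w 3 +
      M.a 5 4 * w 4 := by
  have e : ∀ i j : Fin 7, i ≤ j → M.a i j = 0 := h
  simp (disch := decide) [Matrix.mulVec, dotProduct, Fin.sum_univ_seven, e]

end IsExplicit

namespace IsPairExceptLast

variable {M : Tableau}

theorem b_six (h : M.IsPairExceptLast) : M.b 6 = 0 := by
  rw [← h.fsal.2]; exact h.explicit _ _ le_rfl

theorem mulVec_zero (h : M.IsPairExceptLast) (w : Fin 7 → ℝ) :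
    (M.a *ᵥ w) 0 = 0 :=
  h.explicit.mulVec_zero w

theorem mulVec_one (h : M.IsPairExceptLast) (w : Fin 7 → ℝ) :
    (M.a *ᵥ w) 1 = M.a 1 0 * w 0 :=
  h.explicit.mulVec_one w

theorem mulVec_two (h : M.IsPairExceptLast) (w : Fin 7 → ℝ) :
    (M.a *ᵥ w) 2 = M.a 2 0 * w 0 + M.a 2 1 * w 1 :=
  h.explicit.mulVec_two w

theorem mulVec_three (h : M.IsPairExceptLast) (w : Fin 7 → ℝ) :
    (M.a *ᵥ w) 3 = M.a 3 0 * w 0 + M.a 3 1 * w 1 + M.a 3 2 * w 2 :=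
  h.explicit.mulVec_three w

theorem mulVec_four (h : M.IsPairExceptLast) (w : Fin 7 → ℝ) :
    (M.a *ᵥ w) 4 = M.a 4 0 * w 0 + M.a 4 1 * w 1 + M.a 4 2 * w 2 + M.a 4 3 * w 3 :=
  h.explicit.mulVec_four w

theorem mulVec_five (h : M.IsPairExceptLast) (w : Fin 7 → ℝ) :
    (M.a *ᵥ w) 5 = M.a 5 0 * w 0 + M.a 5 1 * w 1 + M.a 5 2 * w 2 + M.a 5 3 * w 3 +
      M.a 5 4 * w 4 :=
  h.explicit.mulVec_five w

theorem mulVec_six (h : M.IsPairExceptLast) (w : Fin 7 → ℝ) : (M.a *ᵥ w) 6 = M.b ⬝ᵥ w := by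
  simp [Matrix.mulVec, dotProduct, Fin.sum_univ_seven, h.fsal.2]

theorem c_eq (h : M.IsPairExceptLast) : M.c = M.a *ᵥ 1 := h.rowSum.symm

theorem c_zero (h : M.IsPairExceptLast) : M.c 0 = 0 := by
  rw [h.c_eq]; exact h.mulVec_zero _

theorem c'_zero (h : M.IsPairExceptLast) : M.c' 0 = 0 := h.mulVec_zero _

theorem c'_one (h : M.IsPairExceptLast) : M.c' 1 = 0 := by
  rw [c', h.mulVec_one, h.c_zero, mul_zero]

theorem c'_two (h : M.IsPairExceptLast) : M.c' 2 = M.a 2 1 * M.c 1 := by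
  rw [c', h.mulVec_two, h.c_zero, mul_zero, zero_add]

/-- A vector that vanishes at the stages `1, 2, 3` only sees the chain. -/
theorem moment (h : M.IsPairExceptLast) {w : Fin 7 → ℝ} {mf mb : ℝ} (hw : M.VMoment w mf mb)
    (h0 : w 0 = 0) (h1 : w 1 = 0) (h2 : w 2 = 0) :
    M.chain.Moment (w 3) (w 4) (w 5) (w 6) mf mb where
  f := by
    rw [← hw.f, dotProduct, Fin.sum_univ_seven, h.mulVec_zero, h.mulVec_one, h.mulVec_two,
      h.mulVec_three, h.mulVec_four, h.mulVec_five, h.b_six, h0, h1, h2]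
    simp only [Chain.f4, Chain.f5, chain]
    ring
  b := by
    rw [← hw.b, dotProduct, Fin.sum_univ_seven, h.b_six, h0, h1, h2]
    simp only [chain]
    ring
  bc := by
    rw [← hw.bc, dotProduct, Fin.sum_univ_seven, h.b_six]
    simp only [chain, Pi.mul_apply, h0, h1, h2]
    ring
  d := by
    rw [← hw.d, dotProduct, Fin.sum_univ_seven, h0, h1, h2]
    simp only [chain]
    ring

theorem b_sum (h : M.IsPairExceptLast) : M.b ⬝ᵥ 1 = 1 := by
  have := h.order_b (1, 1) (by simp [treesUpToFour])
  simpa using this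

theorem d_sum (h : M.IsPairExceptLast) : M.d ⬝ᵥ 1 = 0 :=
  h.order_d (1, 1) (by simp [treesUpToFour])

theorem b_dot_c (h : M.IsPairExceptLast) : M.b ⬝ᵥ M.c = 1 / 2 :=
  h.order_b (M.c, 2) (by simp [treesUpToFour])

theorem vmoment_c (h : M.IsPairExceptLast) :
    M.VMoment M.c (1 / 6) (1 / 2) where
  f := h.order_b (M.c', 6) (by simp [treesUpToFour])
  b := h.order_b (M.c, 2) (by simp [treesUpToFour])
  bc := by
    rw [h.order_b (M.c * M.c, 3) (by simp [treesUpToFour])]; norm_num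
  d := h.order_d (M.c, 2) (by simp [treesUpToFour])

theorem vmoment_c' (h : M.IsPairExceptLast) :
    M.VMoment M.c' (1 / 24) (1 / 6) where
  f := h.order_b (M.c'', 24) (by simp [treesUpToFour])
  b := h.order_b (M.c', 6) (by simp [treesUpToFour])
  bc := by
    rw [h.order_b (M.c' * M.c, 8) (by simp [treesUpToFour])]; norm_num
  d := h.order_d (M.c', 6) (by simp [treesUpToFour])

theorem vmoment_sq (h : M.IsPairExceptLast) :
    M.VMoment (M.c * M.c) (1 / 12) (1 / 3) where
  f := h.order_b (M.a *ᵥ (M.c * M.c), 12) (by simp [treesUpToFour])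
  b := h.order_b (M.c * M.c, 3) (by simp [treesUpToFour])
  bc := by
    rw [h.order_b (M.c * M.c * M.c, 4) (by simp [treesUpToFour])]; norm_num
  d := h.order_d (M.c * M.c, 3) (by simp [treesUpToFour])

theorem vmoment_cube (h : M.IsPairExceptLast) :
    M.VMoment (M.c * M.c * M.c) (1 / 20) (1 / 4) where
  f := h.order_b (M.a *ᵥ (M.c * M.c * M.c), 20) (by simp [treesFive])
  b := h.order_b (M.c * M.c * M.c, 4) (by simp [treesUpToFour])
  bc := by
    rw [h.order_b (M.c * M.c * M.c * M.c, 5) (by simp [treesFive])]; norm_num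
  d := h.order_d (M.c * M.c * M.c, 4) (by simp [treesUpToFour])

theorem vmoment_c'_mul_c (h : M.IsPairExceptLast) :
    M.VMoment (M.c' * M.c) (1 / 40) (1 / 8) where
  f := h.order_b (M.a *ᵥ (M.c' * M.c), 40) (by simp [treesFive])
  b := h.order_b (M.c' * M.c, 8) (by simp [treesUpToFour])
  bc := by
    rw [h.order_b (M.c' * M.c * M.c, 10) (by simp [treesFive])]; norm_num
  d := h.order_d (M.c' * M.c, 8) (by simp [treesUpToFour])

theorem vmoment_mulVec_sq (h : M.IsPairExceptLast) :
    M.VMoment (M.a *ᵥ (M.c * M.c)) (1 / 60) (1 / 12) where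
  f := h.order_b (M.a *ᵥ (M.a *ᵥ (M.c * M.c)), 60) (by simp [treesFive])
  b := h.order_b (M.a *ᵥ (M.c * M.c), 12) (by simp [treesUpToFour])
  bc := by
    rw [h.order_b ((M.a *ᵥ (M.c * M.c)) * M.c, 15) (by simp [treesFive])]; norm_num
  d := h.order_d (M.a *ᵥ (M.c * M.c), 12) (by simp [treesUpToFour])

theorem vmoment_c'' (h : M.IsPairExceptLast) :
    M.VMoment M.c'' (1 / 120) (1 / 24) where
  f := h.order_b (M.c''', 120) (by simp [treesFive])
  b := h.order_b (M.c'', 24) (by simp [treesUpToFour])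
  bc := by
    rw [h.order_b (M.c'' * M.c, 30) (by simp [treesFive])]; norm_num
  d := h.order_d (M.c'', 24) (by simp [treesUpToFour])

theorem c'_six (h : M.IsPairExceptLast) : M.c' 6 = 1 / 2 := by
  rw [c', h.mulVec_six, h.b_dot_c]

theorem c''_six (h : M.IsPairExceptLast) : M.c'' 6 = 1 / 6 := by
  rw [c'', h.mulVec_six, h.vmoment_c'.b]

end IsPairExceptLast
end Tableau

/-! ### Vectors that vanish at the first three stages -/

namespace Tableau

/-- `Y = c₃ (c₃ - c₂)`. -/
def Y (M : Tableau) : ℝ := M.c 2 * (M.c 2 - M.c 1)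

/-- `T = Y - 2 c'₃`. -/
def T (M : Tableau) : ℝ := M.Y - 2 * M.c' 2

/-- `z = c₂ c'₃`. -/
def z (M : Tableau) : ℝ := M.c 1 * M.c' 2

/-- The combination `Y c' - c'₃ c (c - c₂)`. Its first three entries vanish, and with them those of
`v * c` and `A v`. -/
def v (M : Tableau) : Fin 7 → ℝ :=
  M.Y • M.c' + (-M.c' 2) • (M.c * M.c) + M.z • M.c

/-- The vector `c' (c - c₃)`; its first three entries vanish. -/
def q (M : Tableau) : Fin 7 → ℝ := M.c' * M.c + (-M.c 2) • M.c'

/-- The vector `c (c - c₂) (c - c₃)`; its first three entries vanish. -/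
def p (M : Tableau) : Fin 7 → ℝ :=
  M.c * M.c * M.c + (-(M.c 1 + M.c 2)) • (M.c * M.c) + (M.c 1 * M.c 2) • M.c

theorem v_apply (M : Tableau) (i : Fin 7) :
    M.v i = M.Y * M.c' i - M.c' 2 * (M.c i * (M.c i - M.c 1)) := by
  simp only [v, z, Pi.add_apply, Pi.smul_apply, Pi.mul_apply, smul_eq_mul]; ring

theorem q_apply (M : Tableau) (i : Fin 7) : M.q i = M.c' i * (M.c i - M.c 2) := by
  simp only [q, Pi.add_apply, Pi.smul_apply, Pi.mul_apply, smul_eq_mul]; ring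

theorem p_apply (M : Tableau) (i : Fin 7) :
    M.p i = M.c i * (M.c i - M.c 1) * (M.c i - M.c 2) := by
  simp only [p, Pi.add_apply, Pi.smul_apply, Pi.mul_apply, smul_eq_mul]; ring

namespace NonExceptional

variable {M : Tableau}

theorem p_ne (hn : M.NonExceptional) {i : Fin 7} (hi : i = 3 ∨ i = 4 ∨ i = 5) : M.p i ≠ 0 := by
  obtain ⟨h0, h1, h2⟩ := hn.2.1 i hi
  rw [p_apply]
  exact mul_ne_zero (mul_ne_zero h0 (sub_ne_zero.2 h1)) (sub_ne_zero.2 h2)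

end NonExceptional

namespace IsPairExceptLast

variable {M : Tableau}

theorem vmoment_v (h : M.IsPairExceptLast) :
    M.VMoment M.v ((M.T + 4 * M.z) / 24) ((M.T + 3 * M.z) / 6) :=
  (((h.vmoment_c'.smul M.Y).add (h.vmoment_sq.smul (-M.c' 2))).add (h.vmoment_c.smul M.z)).congr
    rfl (by rw [T]; ring) (by rw [T]; ring)

theorem v_six (h : M.IsPairExceptLast) : M.v 6 = (M.T + 2 * M.z) / 2 := by
  rw [v_apply, h.c'_six, h.fsal.1, T, z]; ring

theorem mulVec_v (M : Tableau) : M.a *ᵥ M.v =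
    M.Y • M.c'' + (-M.c' 2) • (M.a *ᵥ (M.c * M.c)) + M.z • M.c' := by
  rw [v, Matrix.mulVec_add, Matrix.mulVec_add, Matrix.mulVec_smul, Matrix.mulVec_smul,
    Matrix.mulVec_smul]
  rfl

theorem vmoment_mulVec_v (h : M.IsPairExceptLast) :
    M.VMoment (M.a *ᵥ M.v) ((M.T + 5 * M.z) / 120) ((M.T + 4 * M.z) / 24) :=
  (((h.vmoment_c''.smul M.Y).add (h.vmoment_mulVec_sq.smul (-M.c' 2))).add
    (h.vmoment_c'.smul M.z)).congr (mulVec_v M) (by rw [T]; ring) (by rw [T]; ring)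

theorem vmoment_v_mul_c (h : M.IsPairExceptLast) :
    M.VMoment (M.v * M.c) ((3 * M.T + 10 * M.z) / 120) ((3 * M.T + 8 * M.z) / 24) :=
  (((h.vmoment_c'_mul_c.smul M.Y).add (h.vmoment_cube.smul (-M.c' 2))).add
    (h.vmoment_sq.smul M.z)).congr (by
      simp only [v, add_mul, smul_mul_assoc]) (by rw [T]; ring) (by rw [T]; ring)

theorem vmoment_q (h : M.IsPairExceptLast) :
    M.VMoment M.q (1 / 40 - M.c 2 / 24) (1 / 8 - M.c 2 / 6) :=
  (h.vmoment_c'_mul_c.add (h.vmoment_c'.smul (-M.c 2))).congr rfl (by ring) (by ring)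

theorem vmoment_p (h : M.IsPairExceptLast) :
    M.VMoment M.p (1 / 20 - (M.c 1 + M.c 2) / 12 + M.c 1 * M.c 2 / 6)
      (1 / 4 - (M.c 1 + M.c 2) / 3 + M.c 1 * M.c 2 / 2) :=
  ((h.vmoment_cube.add (h.vmoment_sq.smul _)).add (h.vmoment_c.smul _)).congr rfl
    (by ring) (by ring)

theorem v_zero (h : M.IsPairExceptLast) : M.v 0 = 0 := by
  rw [v_apply, h.c_zero, h.c'_zero]; ring

theorem v_one (h : M.IsPairExceptLast) : M.v 1 = 0 := by
  rw [v_apply, h.c'_one]; ring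

theorem v_two (M : Tableau) : M.v 2 = 0 := by
  rw [v_apply, Y]; ring

theorem moment_v (h : M.IsPairExceptLast) :
    M.chain.Moment (M.v 3) (M.v 4) (M.v 5) ((M.T + 2 * M.z) / 2) ((M.T + 4 * M.z) / 24)
      ((M.T + 3 * M.z) / 6) := by
  have := h.moment h.vmoment_v h.v_zero h.v_one (v_two M)
  rwa [h.v_six] at this

theorem moment_q (h : M.IsPairExceptLast) :
    M.chain.Moment (M.q 3) (M.q 4) (M.q 5) (1 / 2 - M.c 2 / 2) (1 / 40 - M.c 2 / 24)
      (1 / 8 - M.c 2 / 6) := by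
  have := h.moment h.vmoment_q (by rw [q_apply, h.c'_zero]; ring)
    (by rw [q_apply, h.c'_one]; ring) (by rw [q_apply]; ring)
  rwa [show M.q 6 = 1 / 2 - M.c 2 / 2 by rw [q_apply, h.c'_six, h.fsal.1]; ring] at this

theorem moment_p (h : M.IsPairExceptLast) :
    M.chain.Moment (M.p 3) (M.p 4) (M.p 5) (M.p 6)
      (1 / 20 - (M.c 1 + M.c 2) / 12 + M.c 1 * M.c 2 / 6)
      (1 / 4 - (M.c 1 + M.c 2) / 3 + M.c 1 * M.c 2 / 2) :=
  h.moment h.vmoment_p (by rw [p_apply, h.c_zero]; ring) (by rw [p_apply]; ring)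
    (by rw [p_apply]; ring)

theorem c''_zero (h : M.IsPairExceptLast) : M.c'' 0 = 0 := h.mulVec_zero _

theorem c''_one (h : M.IsPairExceptLast) : M.c'' 1 = 0 := by
  rw [c'', h.mulVec_one, h.c'_zero, mul_zero]

theorem c''_two (h : M.IsPairExceptLast) : M.c'' 2 = 0 := by
  rw [c'', h.mulVec_two, h.c'_zero, h.c'_one]; ring

theorem c''_three (h : M.IsPairExceptLast) : M.c'' 3 = M.a 3 2 * M.c' 2 := by
  rw [c'', h.mulVec_three, h.c'_zero, h.c'_one]; ring

theorem c''_four (h : M.IsPairExceptLast) :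
    M.c'' 4 = M.a 4 2 * M.c' 2 + M.a 4 3 * M.c' 3 := by
  rw [c'', h.mulVec_four, h.c'_zero, h.c'_one]; ring

theorem c''_five (h : M.IsPairExceptLast) :
    M.c'' 5 = M.a 5 2 * M.c' 2 + M.a 5 3 * M.c' 3 + M.a 5 4 * M.c' 4 := by
  rw [c'', h.mulVec_five, h.c'_zero, h.c'_one]; ring

theorem moment_c'' (h : M.IsPairExceptLast) :
    M.chain.Moment (M.c'' 3) (M.c'' 4) (M.c'' 5) (1 / 6) (1 / 120) (1 / 24) := by
  have := h.moment h.vmoment_c'' h.c''_zero h.c''_one h.c''_two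
  rwa [h.c''_six] at this

/-- The vector `v` supplies the `Backbone` of the chain. -/
theorem backbone (h : M.IsPairExceptLast) (hn : M.NonExceptional) :
    M.chain.Backbone M.T M.z (M.v 3) (M.v 4) (M.v 5) where
  v := h.moment_v
  cv := by
    have := h.moment h.vmoment_v_mul_c (by simp [h.v_zero]) (by simp [h.v_one])
      (by simp [v_two])
    simp only [Pi.mul_apply, h.fsal.1, h.v_six, mul_one] at this
    simp only [chain, mul_comm (M.c _)]
    exact this
  r := by
    have := h.moment h.vmoment_mulVec_v (h.mulVec_zero _)
      (by rw [h.mulVec_one, h.v_zero, mul_zero])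
      (by rw [h.mulVec_two, h.v_zero, h.v_one]; ring)
    rw [h.mulVec_three, h.mulVec_four, h.mulVec_five, h.mulVec_six, h.vmoment_v.b, h.v_zero,
      h.v_one, v_two] at this
    simp only [mul_zero, zero_add] at this
    rw [add_comm (M.a 5 3 * M.v 3)] at this
    exact this
  ne45 := hn.2.2.1
  ne46 := hn.2.2.2.1
  ne56 := hn.2.2.2.2
  c4_ne := (hn.2.1 3 (Or.inl rfl)).1
  a54_ne := hn.1.2.2.1
  a65_ne := hn.1.2.2.2

/-- A row orthogonal to `1`, `c` and `c'` vanishes if its entries at the stages `4, …, 7` do. -/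
theorem eq_zero_of_orthogonal (h : M.IsPairExceptLast) (hx : M.c 1 ≠ 0) (hu : M.c' 2 ≠ 0)
    {d : Fin 7 → ℝ} (e1 : d ⬝ᵥ 1 = 0) (e2 : d ⬝ᵥ M.c = 0) (e3 : d ⬝ᵥ M.c' = 0)
    (h3 : d 3 = 0) (h4 : d 4 = 0) (h5 : d 5 = 0) (h6 : d 6 = 0) : d = 0 := by
  rw [dotProduct, Fin.sum_univ_seven] at e1 e2 e3
  rw [h3, h4, h5, h6] at e1 e2 e3
  rw [h.c'_zero, h.c'_one] at e3
  have h2 : d 2 = 0 :=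
    (mul_eq_zero.1 (show d 2 * M.c' 2 = 0 by linear_combination e3)).resolve_right hu
  rw [h.c_zero, h2] at e2
  have h1 : d 1 = 0 :=
    (mul_eq_zero.1 (show d 1 * M.c 1 = 0 by linear_combination e2)).resolve_right hx
  rw [h2, h1] at e1
  simp only [Pi.one_apply] at e1
  have h0 : d 0 = 0 := by linear_combination e1
  refine funext fun i => ?_
  fin_cases i <;> assumption

theorem d_ne (h : M.IsPairExceptLast) (hx : M.c 1 ≠ 0) (hu : M.c' 2 ≠ 0) :
    ¬ (M.d 3 = 0 ∧ M.d 4 = 0 ∧ M.d 5 = 0 ∧ M.d 6 = 0) := fun ⟨h3, h4, h5, h6⟩ =>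
  h.d_ne_zero (h.eq_zero_of_orthogonal hx hu h.d_sum h.vmoment_c.d h.vmoment_c'.d h3 h4 h5 h6)

/-- `c₂` does not vanish: otherwise `c'` itself vanishes at the first three stages, and the vectors
`c (c - c₃)` and `A (c (c - c₃))` lead to `c₅ = 1`, so `c₆ ≠ 1` and `star` forces `c₄ = 0`. -/
theorem c_one_ne (h : M.IsPairExceptLast) (hn : M.NonExceptional) : M.c 1 ≠ 0 := by
  intro hx
  have hu : M.c' 2 = 0 := by rw [h.c'_two, hx, mul_zero]
  have hc'3 : M.c' 3 = M.a 3 2 * M.c 2 := by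
    rw [c', h.mulVec_three, h.c_zero, hx]; ring
  -- with `c₂ = 0` the vector `c'` vanishes at the first three stages
  have hB : M.chain.Backbone 1 0 (M.c' 3) (M.c' 4) (M.c' 5) := by
    refine ⟨?_, ?_, ?_, hn.2.2.1, hn.2.2.2.1, hn.2.2.2.2, (hn.2.1 3 (Or.inl rfl)).1,
      hn.1.2.2.1, hn.1.2.2.2⟩
    · have := h.moment h.vmoment_c' h.c'_zero h.c'_one hu
      rw [h.c'_six] at this
      convert this using 1 <;> norm_num
    · have := h.moment h.vmoment_c'_mul_c (by simp [h.c'_zero]) (by simp [h.c'_one]) (by simp [hu])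
      simp only [Pi.mul_apply, h.fsal.1, h.c'_six, mul_one] at this
      simp only [chain, mul_comm (M.c _)]
      convert this using 1 <;> norm_num [chain]
    · have := h.moment_c''
      rw [h.c''_three, h.c''_four, h.c''_five, hu] at this
      simp only [mul_zero, zero_add] at this
      rw [add_comm (M.a 5 3 * _)] at this
      convert this using 1 <;> norm_num [chain]
  have hG : (1 : ℝ) + 5 * 0 ≠ 0 := by norm_num
  have hy : M.c 2 ≠ 0 := by
    have := hB.v4_ne hG
    rw [hc'3] at this
    exact right_ne_zero_of_mul this
  -- the vector `c (c - c₃)` and its images under `A` and under multiplication by `c`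
  have hw := h.vmoment_sq.add (h.vmoment_c.smul (-M.c 2))
  have hwm := (h.moment hw (by simp [h.c_zero]) (by simp [hx]) (by simp)).f
  have hcw := h.vmoment_cube.add (h.vmoment_sq.smul (-M.c 2))
  have hcwm := (h.moment hcw (by simp [h.c_zero]) (by simp [hx]) (by simp; ring)).f
  have hr := h.vmoment_mulVec_sq.add (h.vmoment_c'.smul (-M.c 2))
  have hrm := (h.moment hr (by simp [h.mulVec_zero, h.c'_zero])
    (by simp [h.mulVec_one, h.c'_one, h.c_zero]) (by simp [h.mulVec_two, hu, h.c_zero, hx])).f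
  have k1 := hB.v.f
  have k2 := hB.cv.f
  have k3 := hB.r.f
  simp only [Pi.add_apply, Pi.smul_apply, Pi.mul_apply, smul_eq_mul, h.mulVec_three,
    h.mulVec_four, h.c_zero, hx, hc'3] at hwm hcwm hrm k1 k2 k3
  have hc'4 : M.c' 4 = M.a 4 2 * M.c 2 + M.a 4 3 * M.c 3 := by
    rw [c', h.mulVec_four, h.c_zero, hx]; ring
  have hfa : M.chain.f5 * M.chain.a54 ≠ 0 := left_ne_zero_of_mul (hB.prod_ne hG)
  have e4 : M.c 3 * (M.c 3 - M.c 2) = (2 - 5 * M.c 2) * (M.a 3 2 * M.c 2) := by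
    refine mul_left_cancel₀ hfa ?_
    simp only [chain_a54] at k3 ⊢
    rw [hc'4] at hrm
    linear_combination hrm - (2 - 5 * M.c 2) * k3
  have hc5 : M.c 4 = 1 := by
    have : M.c 2 * (M.c 4 - 1) = 0 := by
      simp only [chain_c4, chain_c5] at hwm hcwm k1 k2
      linear_combination 24 * (hcwm - M.c 4 * hwm) - 24 * (2 - 5 * M.c 2) * (k2 - M.c 4 * k1) -
        24 * (M.c 3 - M.c 4) * M.chain.f4 * e4
    linear_combination (mul_eq_zero.1 this).resolve_left hy
  have h6 : M.chain.c6 ≠ 1 := fun h6 => hn.2.2.2.2 (hc5.trans h6.symm)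
  have := hB.star_eq_zero hG (Or.inl one_ne_zero) h6
  refine hB.c4_ne ?_
  rw [Chain.star] at this
  linear_combination this

theorem c'_two_ne (h : M.IsPairExceptLast) (hn : M.NonExceptional) : M.c' 2 ≠ 0 := by
  rw [h.c'_two]; exact mul_ne_zero hn.1.1 (h.c_one_ne hn)

theorem z_ne (h : M.IsPairExceptLast) (hn : M.NonExceptional) : M.z ≠ 0 :=
  mul_ne_zero (h.c_one_ne hn) (h.c'_two_ne hn)

end IsPairExceptLast
end Tableau

/-! ### Closed forms of the stages -/

namespace Chain

/-- The value of `q` at a stage with node `c`, up to a factor; `V` and `E` are the parameters of the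
stage. -/
def stageN (T z y c V E : ℝ) : ℝ := c * z * V + (y * T + 2 * z) * E

/-- The quotient of `u c (c - x) (c - y)` by the factor `τ` of `StageForm`. It is the denominator
of the value of `c'` at the stage. -/
def stageD (T z Y y c V E : ℝ) : ℝ := Y * stageN T z y c V E - (c - y) * (z * T * V)

/-- At a stage with node `c`, the product of `c' - c ^ 2 / 2` and `stageD` is `c * stageX` times
`(u - y ^ 2 / 2) (y - x)`, which vanishes for type A. -/
def stageX (T z c V E : ℝ) : ℝ := T * E * c + c * z * V + 2 * z * E

/-- At a stage with node `c` at which `c'` has the value `k`, the values of `v` and `q` are `τ`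
times `z T V` and `stageN`, where `x = c₂`, `y = c₃` and `u = c'₃`. The two equations determine `k`
and `τ`. -/
structure StageForm (x y u T z c V E k τ : ℝ) : Prop where
  v : y * (y - x) * k - u * (c * (c - x)) = τ * (z * T * V)
  q : k * (c - y) = τ * stageN T z y c V E

namespace StageForm

variable {x y u T z c V E k τ : ℝ}

theorem mul_stageD (h : StageForm x y u T z c V E k τ) :
    τ * stageD T z (y * (y - x)) y c V E = u * (c * (c - x) * (c - y)) := by
  rw [stageD]
  linear_combination (c - y) * h.v - y * (y - x) * h.q

theorem stageD_ne (h : StageForm x y u T z c V E k τ) (hu : u ≠ 0)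
    (hp : c * (c - x) * (c - y) ≠ 0) : stageD T z (y * (y - x)) y c V E ≠ 0 :=
  right_ne_zero_of_mul (h.mul_stageD.symm ▸ mul_ne_zero hu hp)

theorem τ_ne (h : StageForm x y u T z c V E k τ) (hu : u ≠ 0)
    (hp : c * (c - x) * (c - y) ≠ 0) : τ ≠ 0 :=
  left_ne_zero_of_mul (h.mul_stageD.symm ▸ mul_ne_zero hu hp)

theorem k_mul (h : StageForm x y u T z c V E k τ) (hu : u ≠ 0)
    (hp : c * (c - x) * (c - y) ≠ 0) :
    k * stageD T z (y * (y - x)) y c V E = u * (c * (c - x)) * stageN T z y c V E := by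
  have hy : c - y ≠ 0 := right_ne_zero_of_mul hp
  refine mul_left_cancel₀ (mul_ne_zero (h.τ_ne hu hp) hy) ?_
  linear_combination k * (c - y) * h.mul_stageD + u * (c * (c - x) * (c - y)) * h.q

end StageForm

variable {C : Chain} {T z v4 v5 v6 : ℝ}

/-- The parameter `V` of stage `5`, where `a = c₄`. At stage `4` it is `1`. -/
def V5 (T z a : ℝ) : ℝ := 5 * T * a - 3 * T + 20 * z * a - 10 * z

/-- The parameter `E` of stage `5`, where `a = c₄`, `b = c₅`. At stage `4` it is `c₄`. -/
def E5 (T z a b : ℝ) : ℝ := b * (5 * T * a + 20 * z * a + 5 * z) - 3 * T * a - 15 * z * a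

/-- The parameter `V` of stage `6` if `c₆ = 1`, where `a = c₄`, `b = c₅`. -/
def V6 (T z a b : ℝ) : ℝ :=
  20 * T * a * b - 15 * T * (a + b) + 12 * T + 60 * z * a * b - 40 * z * (a + b) + 30 * z

/-- The parameter `E` of stage `6` if `c₆ = 1`, where `a = c₄`, `b = c₅`. -/
def E6 (T z a b : ℝ) : ℝ :=
  5 * T * a * b - 3 * T * a + 5 * z * a + 20 * z * b - 15 * z

/-- The stages `4` and `5` of `v` and `q`. The ratio of the entries at stage `4` follows from
`Moment.ρ_mul`, the entries at stage `5` from the row `b A`. -/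
theorem Backbone.forms (h : C.Backbone T z v4 v5 v6) (hz : z ≠ 0) (hρ : C.ρ ≠ 0)
    {y q4 q5 q6 : ℝ} (hq : C.Moment q4 q5 q6 (1 / 2 - y / 2) (1 / 40 - y / 24) (1 / 8 - y / 6)) :
    T ≠ 0 ∧ ∃ τ4 τ5 : ℝ,
      (v4 = τ4 * (z * T * 1) ∧ q4 = τ4 * stageN T z y C.c4 1 C.c4 ∧
        C.f4 * τ4 = (3 * T + 10 * z - C.c5 * (5 * T + 20 * z)) /
          (120 * (C.c4 - C.c5) * (z * T))) ∧
      (v5 = τ5 * (z * T * V5 T z C.c4) ∧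
        q5 = τ5 * stageN T z y C.c5 (V5 T z C.c4) (E5 T z C.c4 C.c5) ∧
        C.f5 * τ5 = 1 / (120 * (C.c4 - C.c5) * (z * T))) := by
  have hG := h.G_ne_zero hz
  have hf := h.f5_ne hG
  have hb := h.b6_ne hG
  obtain ⟨t, hD, hδ, h7⟩ := h.proportional hG (Or.inr hz)
  have r1 : C.ρ * v4 = t * (z ^ 2 * T) / 3 := by
    rw [h.ρ_mul_v hG, hD, hδ, h7, star]; ring
  have r2 : C.ρ * q4 = t * (z * C.c4 * (y * T + 3 * z)) / 3 := by
    rw [hq.ρ_mul hf hb, hD, hδ, h7, star]; ring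
  have hT : T ≠ 0 := by
    rintro rfl
    exact mul_ne_zero hρ (h.v4_ne hG) (by rw [r1]; ring)
  have ha : C.c4 - C.c5 ≠ 0 := sub_ne_zero.2 h.ne45
  have q4e : q4 = v4 / (z * T) * stageN T z y C.c4 1 C.c4 := by
    refine mul_left_cancel₀ hρ ?_
    rw [r2, stageN]
    field_simp
    linear_combination -3 * C.c4 * (y * T + 3 * z) * r1
  -- the values at stage `5` follow from the row `f`
  have g4 : C.f4 * v4 = (3 * T + 10 * z - C.c5 * (5 * T + 20 * z)) / (120 * (C.c4 - C.c5)) := by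
    field_simp
    linear_combination 120 * (h.cv.f - C.c5 * h.v.f)
  have g5 : C.f5 * v5 = V5 T z C.c4 / (120 * (C.c4 - C.c5)) := by
    rw [V5]
    field_simp
    linear_combination -120 * (h.cv.f - C.c4 * h.v.f)
  have g5q : C.f5 * q5 = stageN T z y C.c5 (V5 T z C.c4) (E5 T z C.c4 C.c5)
      / (120 * (C.c4 - C.c5) * (z * T)) := by
    have : C.f4 * q4 = C.f4 * v4 / (z * T) * stageN T z y C.c4 1 C.c4 := by rw [q4e]; ring
    rw [g4] at this
    rw [← sub_eq_of_eq_add' hq.f.symm, this, stageN, stageN, V5, E5]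
    field_simp
    ring
  refine ⟨hT, v4 / (z * T), 1 / (120 * (C.c4 - C.c5) * (z * T) * C.f5),
    ⟨?_, q4e, ?_⟩, ?_, ?_, ?_⟩
  · field_simp
  · rw [← mul_div_assoc, g4]; field_simp
  · refine mul_left_cancel₀ hf ?_
    rw [g5]; field_simp
  · refine mul_left_cancel₀ hf ?_
    rw [g5q]; field_simp
  · field_simp

/-- Stage `6` of `v` and `q` if `c₆ = 1`: the weights `b₄` and `b₅` are known from
`b (1 - c) = b A`, and the entries at stage `6` follow from the row `b`. -/
theorem Backbone.form_six_of_c6 (h : C.Backbone T z v4 v5 v6) (hz : z ≠ 0) (hT : T ≠ 0)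
    (h6 : C.c6 = 1) (he4 : C.f4 = C.b4 * (1 - C.c4)) (he5 : C.f5 = C.b5 * (1 - C.c5))
    {y q4 q5 q6 τ4 τ5 : ℝ}
    (hq : C.Moment q4 q5 q6 (1 / 2 - y / 2) (1 / 40 - y / 24) (1 / 8 - y / 6))
    (hv4 : v4 = τ4 * (z * T * 1)) (hq4 : q4 = τ4 * stageN T z y C.c4 1 C.c4)
    (hτ4 : C.f4 * τ4 = (3 * T + 10 * z - C.c5 * (5 * T + 20 * z)) /
      (120 * (C.c4 - C.c5) * (z * T)))
    (hv5 : v5 = τ5 * (z * T * V5 T z C.c4))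
    (hq5 : q5 = τ5 * stageN T z y C.c5 (V5 T z C.c4) (E5 T z C.c4 C.c5))
    (hτ5 : C.f5 * τ5 = 1 / (120 * (C.c4 - C.c5) * (z * T))) :
    C.b4 * τ4 = (3 * T + 10 * z - C.c5 * (5 * T + 20 * z)) /
      (120 * (C.c4 - C.c5) * (1 - C.c4) * (z * T)) ∧
    C.b5 * τ5 = 1 / (120 * (C.c4 - C.c5) * (1 - C.c5) * (z * T)) ∧
    ∃ τ6 : ℝ, v6 = τ6 * (z * T * V6 T z C.c4 C.c5) ∧
      q6 = τ6 * stageN T z y 1 (V6 T z C.c4 C.c5) (E6 T z C.c4 C.c5) ∧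
      C.b6 * τ6 = 1 / (120 * (1 - C.c4) * (1 - C.c5) * (z * T)) := by
  have hb := h.b6_ne (h.G_ne_zero hz)
  have ha : C.c4 - C.c5 ≠ 0 := sub_ne_zero.2 h.ne45
  have ha1 : 1 - C.c4 ≠ 0 := sub_ne_zero.2 (h6 ▸ h.ne46.symm)
  have hb1 : 1 - C.c5 ≠ 0 := sub_ne_zero.2 (h6 ▸ h.ne56.symm)
  have b4e : C.b4 * τ4 = (3 * T + 10 * z - C.c5 * (5 * T + 20 * z)) /
      (120 * (C.c4 - C.c5) * (1 - C.c4) * (z * T)) := by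
    rw [show C.b4 = C.f4 / (1 - C.c4) by rw [he4]; field_simp, div_mul_eq_mul_div, hτ4]
    field_simp
  have b5e : C.b5 * τ5 = 1 / (120 * (C.c4 - C.c5) * (1 - C.c5) * (z * T)) := by
    rw [show C.b5 = C.f5 / (1 - C.c5) by rw [he5]; field_simp, div_mul_eq_mul_div, hτ5]
    field_simp
  have g6 : C.b6 * v6 = V6 T z C.c4 C.c5 / (120 * (1 - C.c4) * (1 - C.c5)) := by
    rw [← sub_eq_of_eq_add' h.v.b.symm, hv4, hv5, ← mul_assoc C.b4 τ4,
      ← mul_assoc C.b5 τ5, b4e, b5e, V5, V6]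
    field_simp
    ring
  have g6q : C.b6 * q6 = stageN T z y 1 (V6 T z C.c4 C.c5) (E6 T z C.c4 C.c5)
      / (120 * (1 - C.c4) * (1 - C.c5) * (z * T)) := by
    rw [← sub_eq_of_eq_add' hq.b.symm, hq4, hq5, ← mul_assoc C.b4 τ4,
      ← mul_assoc C.b5 τ5, b4e, b5e, stageN,
      stageN, stageN, V5, V6, E5, E6]
    field_simp
    ring
  refine ⟨b4e, b5e, 1 / (120 * (1 - C.c4) * (1 - C.c5) * (z * T) * C.b6), ?_, ?_, ?_⟩
  · refine mul_left_cancel₀ hb ?_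
    rw [g6]; field_simp
  · refine mul_left_cancel₀ hb ?_
    rw [g6q]; field_simp
  · field_simp

/-- Up to a factor, the value of `-V5` if the equation for `c₄` holds. -/
def W (T z : ℝ) : ℝ := 3 * T ^ 2 + 24 * z * T + 40 * z ^ 2

/-- The denominator in the equation for `c₄`, which reads `c₄ = -T z / Δ`. -/
def Δ (T z : ℝ) : ℝ := T ^ 2 + 8 * z * T + 20 * z ^ 2

theorem Δ_pos (hz : z ≠ 0) : 0 < Δ T z := by
  have : 0 < z ^ 2 := by positivity
  rw [Δ]
  nlinarith [sq_nonneg (T + 4 * z)]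

theorem eq_of_star (hz : z ≠ 0) {a : ℝ} (h : star T z a = 0) : a = -(T * z) / Δ T z := by
  rw [eq_div_iff (Δ_pos hz).ne', Δ]
  rw [star] at h
  linear_combination h

theorem V5_of_star (hz : z ≠ 0) {a : ℝ} (h : star T z a = 0) :
    V5 T z a = (T + 5 * z) / Δ T z * -W T z := by
  have := (Δ_pos (T := T) hz).ne'
  rw [eq_of_star hz h, V5, W]
  field_simp
  rw [Δ]; ring

theorem E5_of_star (hz : z ≠ 0) {a b : ℝ} (h : star T z a = 0) :
    E5 T z a b = (T + 5 * z) / Δ T z * (z * (20 * z * b + 3 * T)) := by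
  have := (Δ_pos (T := T) hz).ne'
  rw [eq_of_star hz h, E5]
  field_simp
  rw [Δ]; ring

/-- The weights `b₄ v₄`, `b₅ v₅`, `b₆ v₆` are determined by three moments. -/
theorem Backbone.weights (h : C.Backbone T z v4 v5 v6) :
    C.b4 * v4 * ((C.c4 - C.c5) * (C.c4 - C.c6)) =
      (2 * T + 5 * z) / 20 - (C.c5 + C.c6) * ((3 * T + 8 * z) / 24)
        + C.c5 * C.c6 * ((T + 3 * z) / 6) ∧
    C.b5 * v5 * ((C.c5 - C.c4) * (C.c5 - C.c6)) =
      (2 * T + 5 * z) / 20 - (C.c4 + C.c6) * ((3 * T + 8 * z) / 24)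
        + C.c4 * C.c6 * ((T + 3 * z) / 6) ∧
    C.b6 * v6 * ((C.c6 - C.c4) * (C.c6 - C.c5)) =
      (2 * T + 5 * z) / 20 - (C.c4 + C.c5) * ((3 * T + 8 * z) / 24)
        + C.c4 * C.c5 * ((T + 3 * z) / 6) := by
  have h0 := h.v.b
  have h1 := h.cv.b
  have h2 := h.cv.bc
  refine ⟨?_, ?_, ?_⟩
  · linear_combination h2 - (C.c5 + C.c6) * h1 + C.c5 * C.c6 * h0
  · linear_combination h2 - (C.c4 + C.c6) * h1 + C.c4 * C.c6 * h0
  · linear_combination h2 - (C.c4 + C.c5) * h1 + C.c4 * C.c5 * h0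

end Chain

/-! ### The polynomial of type B′ -/

/-- Polynomial expressions in five variables with integer coefficients. The polynomial `F` is too
large for its degrees to be found by normalization; they are read off from such an expression. -/
inductive PolyTerm
  | const : ℤ → PolyTerm
  | X : Fin 5 → PolyTerm
  | add : PolyTerm → PolyTerm → PolyTerm
  | mul : PolyTerm → PolyTerm → PolyTerm
  | pow : PolyTerm → ℕ → PolyTerm

namespace PolyTerm

instance : Add PolyTerm := ⟨add⟩
instance : Mul PolyTerm := ⟨mul⟩
instance : Pow PolyTerm ℕ := ⟨pow⟩
instance : Neg PolyTerm := ⟨fun p => mul (const (-1)) p⟩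
instance : Sub PolyTerm := ⟨fun p q => add p (mul (const (-1)) q)⟩
instance (n : ℕ) : OfNat PolyTerm n := ⟨const n⟩

section Eval

variable {R S : Type*} [CommRing R] [CommRing S]

/-- The value of an expression at a point of a commutative ring. -/
def eval (v : Fin 5 → R) : PolyTerm → R
  | const n => n
  | X i => v i
  | add p q => p.eval v + q.eval v
  | mul p q => p.eval v * q.eval v
  | pow p n => p.eval v ^ n

variable (v : Fin 5 → R) (p q : PolyTerm)

@[simp] theorem eval_X (i : Fin 5) : (X i).eval v = v i := rfl
@[simp] theorem eval_add : (p + q).eval v = p.eval v + q.eval v := rfl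
@[simp] theorem eval_mul : (p * q).eval v = p.eval v * q.eval v := rfl
@[simp] theorem eval_pow (n : ℕ) : (p ^ n).eval v = p.eval v ^ n := rfl
@[simp] theorem eval_neg : (-p).eval v = -p.eval v := by
  change ((-1 : ℤ) : R) * p.eval v = _
  simp
@[simp] theorem eval_sub : (p - q).eval v = p.eval v - q.eval v := by
  change p.eval v + ((-1 : ℤ) : R) * q.eval v = _
  simp [sub_eq_add_neg]
@[simp] theorem eval_ofNat (n : ℕ) [n.AtLeastTwo] :
    (ofNat(n) : PolyTerm).eval v = ofNat(n) := by
  change (((OfNat.ofNat n : ℕ) : ℤ) : R) = _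
  simp
@[simp] theorem eval_one : (1 : PolyTerm).eval v = 1 := by
  change (((1 : ℕ) : ℤ) : R) = _
  simp

theorem map_eval (φ : R →+* S) : φ (p.eval v) = p.eval (φ ∘ v) := by
  induction p <;> simp_all [eval]

end Eval

/-- The degree of an expression in the variable `i`, if no cancellation occurs. -/
def formalDegree (i : Fin 5) : PolyTerm → ℕ
  | const _ => 0
  | X j => if j = i then 1 else 0
  | add p q => max (p.formalDegree i) (q.formalDegree i)
  | mul p q => p.formalDegree i + q.formalDegree i
  | pow p n => n * p.formalDegree i

/-- The coefficient of an expression at its formal degree in the variable `i`, the other variables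
having integer values. -/
def formalTop (i : Fin 5) (v : Fin 5 → ℤ) : PolyTerm → ℤ
  | const n => n
  | X j => if j = i then 1 else v j
  | add p q =>
      (if q.formalDegree i ≤ p.formalDegree i then p.formalTop i v else 0) +
        (if p.formalDegree i ≤ q.formalDegree i then q.formalTop i v else 0)
  | mul p q => p.formalTop i v * q.formalTop i v
  | pow p n => p.formalTop i v ^ n

/-- The polynomial of an expression. -/
noncomputable def toMvPolynomial (p : PolyTerm) : MvPolynomial (Fin 5) ℚ :=
  p.eval MvPolynomial.X

theorem aeval_toMvPolynomial (p : PolyTerm) (v : Fin 5 → ℝ) :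
    MvPolynomial.aeval v p.toMvPolynomial = p.eval v := by
  rw [toMvPolynomial, ← AlgHom.coe_toRingHom, map_eval]
  congr 1
  ext i
  simp

theorem degreeOf_le (i : Fin 5) (p : PolyTerm) :
    p.toMvPolynomial.degreeOf i ≤ p.formalDegree i := by
  induction p with
  | const n =>
    have : (const n).toMvPolynomial = MvPolynomial.C (n : ℚ) := by simp [toMvPolynomial, eval]
    rw [this, MvPolynomial.degreeOf_C]
    exact Nat.zero_le _
  | X j =>
    rw [formalDegree, toMvPolynomial, eval, MvPolynomial.degreeOf_X]
    simp only [eq_comm, le_refl]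
  | add p q hp hq => exact (MvPolynomial.degreeOf_add_le _ _ _).trans (max_le_max hp hq)
  | mul p q hp hq => exact (MvPolynomial.degreeOf_mul_le _ _ _).trans (add_le_add hp hq)
  | pow p n hp =>
    exact (MvPolynomial.degreeOf_pow_le _ _ _).trans (Nat.mul_le_mul_left n hp)

open Polynomial in
/-- The line through an integer point in the direction of the variable `i`. -/
noncomputable def line (i : Fin 5) (v : Fin 5 → ℤ) (j : Fin 5) : ℚ[X] :=
  if j = i then Polynomial.X else Polynomial.C (v j : ℚ)

open Polynomial in
theorem natDegree_eval_line_le (i : Fin 5) (v : Fin 5 → ℤ) (p : PolyTerm) :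
    (p.eval (line i v)).natDegree ≤ p.formalDegree i := by
  induction p with
  | const n => simp [eval, formalDegree]
  | X j =>
    simp only [eval, formalDegree, line]
    split_ifs <;> simp
  | add p q hp hq => exact (natDegree_add_le _ _).trans (max_le_max hp hq)
  | mul p q hp hq => exact natDegree_mul_le.trans (add_le_add hp hq)
  | pow p n hp => exact natDegree_pow_le.trans (Nat.mul_le_mul_left n hp)

open Polynomial in
theorem coeff_eval_line (i : Fin 5) (v : Fin 5 → ℤ) (p : PolyTerm) :
    (p.eval (line i v)).coeff (p.formalDegree i) = p.formalTop i v := by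
  induction p with
  | const n =>
    rw [eval, ← C_eq_intCast]
    exact coeff_C_zero
  | X j =>
    simp only [eval, formalDegree, line, formalTop]
    split_ifs <;> simp
  | add p q hp hq =>
    have hp' := natDegree_eval_line_le i v p
    have hq' := natDegree_eval_line_le i v q
    simp only [eval, formalDegree, formalTop, coeff_add]
    push_cast
    congr 1
    · split_ifs with h
      · rw [max_eq_left h, hp]
      · exact coeff_eq_zero_of_natDegree_lt (hp'.trans_lt (lt_max_of_lt_right (not_le.1 h)))
    · split_ifs with h
      · rw [max_eq_right h, hq]
      · exact coeff_eq_zero_of_natDegree_lt (hq'.trans_lt (lt_max_of_lt_left (not_le.1 h)))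
  | mul p q hp hq =>
    simp only [eval, formalDegree, formalTop]
    rw [coeff_mul_add_eq_of_natDegree_le (natDegree_eval_line_le i v p)
      (natDegree_eval_line_le i v q), hp, hq]
    push_cast; rfl
  | pow p n hp =>
    simp only [eval, formalDegree, formalTop]
    rw [coeff_pow_of_natDegree_le (natDegree_eval_line_le i v p), hp]
    push_cast; rfl

open Polynomial in
theorem natDegree_aeval_line_le (i : Fin 5) (v : Fin 5 → ℤ) (f : MvPolynomial (Fin 5) ℚ) :
    (MvPolynomial.aeval (line i v) f).natDegree ≤ f.degreeOf i := by
  rw [MvPolynomial.aeval_def, MvPolynomial.eval₂_eq']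
  refine natDegree_sum_le_of_forall_le _ _ fun m hm => ?_
  have h1 : (algebraMap ℚ ℚ[X] (f.coeff m)).natDegree = 0 := natDegree_C _
  refine (natDegree_mul_le.trans (add_le_add h1.le (natDegree_prod_le _ _))).trans ?_
  rw [zero_add]
  refine le_trans (Finset.sum_le_sum (g := fun j => if j = i then m j else 0) fun j _ => ?_) ?_
  · refine natDegree_pow_le.trans ?_
    rw [line]
    split_ifs <;> simp
  · simpa using MvPolynomial.monomial_le_degreeOf i hm

/-- If the formal leading coefficient is non-zero at one integer point, the degree is the formal
one. -/
theorem degreeOf_eq (i : Fin 5) (v : Fin 5 → ℤ) (p : PolyTerm) (h : p.formalTop i v ≠ 0) :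
    p.toMvPolynomial.degreeOf i = p.formalDegree i := by
  refine le_antisymm (degreeOf_le i p) ?_
  refine le_trans ?_ (natDegree_aeval_line_le i v _)
  refine Polynomial.le_natDegree_of_ne_zero ?_
  have : MvPolynomial.aeval (line i v) p.toMvPolynomial = p.eval (line i v) := by
    rw [toMvPolynomial, ← AlgHom.coe_toRingHom, map_eval]
    congr 1
    ext1 j
    simp
  rw [this, coeff_eval_line]
  exact_mod_cast h

/-- The cofactor of `(z T) ^ 2` in `F`. -/
def coef0 (T z y a b : PolyTerm) : PolyTerm :=
  T ^ 4 * (y * (a ^ 3 * (500 * b ^ 2 - 675 * b + 225) + a ^ 2 * (-675 * b ^ 2 + 930 * b - 315) +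
  a * (225 * b ^ 2 - 315 * b + 108))) + T ^ 3 * z * (y * (a ^ 3 * (5500 * b ^ 2 - 7100 * b +
  2250) + a ^ 2 * (-6600 * b ^ 2 + 8715 * b - 2805) + a * (1575 * b ^ 2 - 2100 * b + 675) + 225
  * b ^ 2 - 315 * b + 108) + a ^ 3 * (1000 * b ^ 2 - 1350 * b + 450) + a ^ 2 * (-1350 * b ^ 2 +
  1860 * b - 630) + a * (450 * b ^ 2 - 630 * b + 216)) + T ^ 2 * z ^ 2 * (y * (a ^ 3 * (20000 *
  b ^ 2 - 24600 * b + 7400) + a ^ 2 * (-21100 * b ^ 2 + 26600 * b - 8100) + a * (3000 * b ^ 2 -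
  3660 * b + 1020) + 1350 * b ^ 2 - 1860 * b + 630) + a ^ 3 * (13000 * b ^ 2 - 16700 * b + 5250)
  + a ^ 2 * (-16900 * b ^ 2 + 22230 * b - 7110) + a * (5400 * b ^ 2 - 7230 * b + 2340)) + T * z
  ^ 3 * (y * (a ^ 3 * (24000 * b ^ 2 - 28000 * b + 8000) + a ^ 2 * (-22000 * b ^ 2 + 26400 * b -
  7600) + a * (1000 * b ^ 2 - 800 * b) + 2000 * b ^ 2 - 2700 * b + 900) + a ^ 3 * (54000 * b ^ 2
  - 66200 * b + 19800) + a ^ 2 * (-66800 * b ^ 2 + 84400 * b - 25800) + a * (20200 * b ^ 2 -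
  26100 * b + 8100)) + z ^ 4 * (a ^ 3 * (72000 * b ^ 2 - 84000 * b + 24000) + a ^ 2 * (-84000 *
  b ^ 2 + 102000 * b - 30000) + a * (24000 * b ^ 2 - 30000 * b + 9000))

/-- The cofactor of `(y - x) z T` in `F`. -/
def coef1 (T z y a b : PolyTerm) : PolyTerm :=
  T ^ 5 * (y ^ 2 * (a ^ 3 * (-675 * b ^ 2 + 930 * b - 315) + a ^ 2 * (525 * b ^ 2 - 675 * b +
  216)) + a ^ 3 * (-75 * b ^ 2 + 45 * b) * y) + T ^ 4 * z * (y ^ 2 * (a ^ 3 * (-9100 * b ^ 2 +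
  12090 * b - 3930) + a ^ 2 * (6150 * b ^ 2 - 7470 * b + 2250) + a * (600 * b ^ 2 - 720 * b +
  216)) + y * (a ^ 3 * (-3000 * b ^ 2 + 3270 * b - 900) + a ^ 2 * (1350 * b ^ 2 - 1890 * b +
  648)) + a ^ 3 * (-150 * b ^ 2 + 90 * b)) + T ^ 3 * z ^ 2 * (y ^ 2 * (a ^ 3 * (-45100 * b ^ 2 +
  57500 * b - 17850) + a ^ 2 * (26500 * b ^ 2 - 29460 * b + 8040) + a * (5025 * b ^ 2 - 6060 * b
  + 1845) + 75 * b ^ 2 - 45 * b) + y * (a ^ 3 * (-33600 * b ^ 2 + 39630 * b - 11730) + a ^ 2 *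
  (18750 * b ^ 2 - 24480 * b + 7830) + a * (675 * b ^ 2 - 765 * b + 216)) + a ^ 3 * (-3300 * b ^
  2 + 2820 * b - 540) + a ^ 2 * (600 * b ^ 2 - 1080 * b + 432)) + T ^ 2 * z ^ 3 * (y ^ 2 * (a ^
  3 * (-96000 * b ^ 2 + 117200 * b - 34800) + a ^ 2 * (48500 * b ^ 2 - 46900 * b + 10950) + a *
  (14000 * b ^ 2 - 16650 * b + 4950)) + y * (a ^ 3 * (-157200 * b ^ 2 + 186600 * b - 54900) + a
  ^ 2 * (94200 * b ^ 2 - 114450 * b + 33990) + a * (4650 * b ^ 2 - 4890 * b + 1350) + 150 * b ^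
  2 - 90 * b) + a ^ 3 * (-28800 * b ^ 2 + 28200 * b - 6840) + a ^ 2 * (10200 * b ^ 2 - 15360 * b
  + 5400) + a * (-150 * b ^ 2 + 90 * b)) + T * z ^ 4 * (y ^ 2 * (a ^ 3 * (-72000 * b ^ 2 + 84000
  * b - 24000) + a ^ 2 * (30000 * b ^ 2 - 21000 * b + 3000) + a * (12000 * b ^ 2 - 15000 * b +
  4500)) + y * (a ^ 3 * (-318000 * b ^ 2 + 372600 * b - 107400) + a ^ 2 * (199800 * b ^ 2 -
  223200 * b + 61200) + a * (7800 * b ^ 2 - 7200 * b + 1800)) + a ^ 3 * (-108000 * b ^ 2 +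
  109800 * b - 27900) + a ^ 2 * (48600 * b ^ 2 - 66600 * b + 21600)) + z ^ 5 * (y * (a ^ 3 *
  (-216000 * b ^ 2 + 252000 * b - 72000) + a ^ 2 * (144000 * b ^ 2 - 144000 * b + 36000)) + a ^
  3 * (-144000 * b ^ 2 + 144000 * b - 36000) + a ^ 2 * (72000 * b ^ 2 - 90000 * b + 27000))

/-- The cofactor of `(y - x) Y a` in `F`. -/
def coef2 (T z y a b : PolyTerm) : PolyTerm :=
  T ^ 6 * (a ^ 2 * (300 * b ^ 2 - 360 * b + 108) * y ^ 2) + T ^ 5 * z * (y ^ 2 * (a ^ 2 * (4575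
  * b ^ 2 - 5370 * b + 1575) + a * (375 * b ^ 2 - 405 * b + 108)) + a ^ 2 * (1275 * b ^ 2 - 1485
  * b + 432) * y) + T ^ 4 * z ^ 2 * (y ^ 2 * (a ^ 2 * (27000 * b ^ 2 - 30525 * b + 8595) + a *
  (3675 * b ^ 2 - 4200 * b + 1215) + 75 * b ^ 2 - 45 * b) + y * (a ^ 2 * (19950 * b ^ 2 - 22890
  * b + 6570) + a * (1200 * b ^ 2 - 1080 * b + 216)) + a ^ 2 * (1350 * b ^ 2 - 1530 * b + 432))
  + T ^ 3 * z ^ 3 * (y ^ 2 * (a ^ 2 * (72000 * b ^ 2 - 77400 * b + 20700) + a * (13500 * b ^ 2 -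
  15975 * b + 4725)) + y * (a ^ 2 * (122400 * b ^ 2 - 136200 * b + 37800) + a * (9600 * b ^ 2 -
  9120 * b + 2160) + 375 * b ^ 2 - 225 * b) + a ^ 2 * (21600 * b ^ 2 - 24300 * b + 6840) + a *
  (900 * b ^ 2 - 540 * b)) + T ^ 2 * z ^ 4 * (y ^ 2 * (a ^ 2 * (72000 * b ^ 2 - 72000 * b +
  18000) + a * (18000 * b ^ 2 - 22500 * b + 6750)) + y * (a ^ 2 * (342000 * b ^ 2 - 364500 * b +
  96750) + a * (29700 * b ^ 2 - 30600 * b + 8100)) + a ^ 2 * (136800 * b ^ 2 - 150300 * b +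
  41220) + a * (4500 * b ^ 2 - 1440 * b - 540) + 450 * b ^ 2 - 270 * b) + T * z ^ 5 * (y * (a ^
  2 * (360000 * b ^ 2 - 360000 * b + 90000) + a * (36000 * b ^ 2 - 45000 * b + 13500)) + a ^ 2 *
  (396000 * b ^ 2 - 419400 * b + 110700) + a * (5400 * b ^ 2 + 2700 * b - 2700)) + z ^ 6 * (a ^
  2 * (432000 * b ^ 2 - 432000 * b + 108000))

/-- The polynomial `F` in `x = c₂`, `y = c₃`, `a = c₄`, `b = c₅`, `u = c'₃`, written in terms of
`Y = y (y - x)`, `T = Y - 2 u` and `z = x u`. -/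
def exprF : PolyTerm :=
  let x := X 0
  let y := X 1
  let a := X 2
  let b := X 3
  let u := X 4
  let Y := y * (y - x)
  let T := Y - 2 * u
  let z := x * u
  (y - x) * (Y * a * coef2 T z y a b + z * T * coef1 T z y a b) + (z * T) ^ 2 * coef0 T z y a b

theorem degreeOf_exprF : exprF.toMvPolynomial.degreeOf 0 = 8 ∧
    exprF.toMvPolynomial.degreeOf 1 = 17 ∧ exprF.toMvPolynomial.degreeOf 2 = 3 ∧
    exprF.toMvPolynomial.degreeOf 3 = 2 ∧ exprF.toMvPolynomial.degreeOf 4 = 8 := by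
  -- an integer point at which the five leading coefficients do not vanish
  refine ⟨?_, ?_, ?_, ?_, ?_⟩ <;>
    (rw [degreeOf_eq _ ![2, 3, 5, 7, 11] _ (by decide +kernel)]; decide +kernel)

end PolyTerm

namespace Chain

/-- The value of `PolyTerm.coef0` at real arguments. -/
def coef0 (T z y a b : ℝ) : ℝ :=
  T ^ 4 * (y * (a ^ 3 * (500 * b ^ 2 - 675 * b + 225) + a ^ 2 * (-675 * b ^ 2 + 930 * b - 315) +
  a * (225 * b ^ 2 - 315 * b + 108))) + T ^ 3 * z * (y * (a ^ 3 * (5500 * b ^ 2 - 7100 * b +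
  2250) + a ^ 2 * (-6600 * b ^ 2 + 8715 * b - 2805) + a * (1575 * b ^ 2 - 2100 * b + 675) + 225
  * b ^ 2 - 315 * b + 108) + a ^ 3 * (1000 * b ^ 2 - 1350 * b + 450) + a ^ 2 * (-1350 * b ^ 2 +
  1860 * b - 630) + a * (450 * b ^ 2 - 630 * b + 216)) + T ^ 2 * z ^ 2 * (y * (a ^ 3 * (20000 *
  b ^ 2 - 24600 * b + 7400) + a ^ 2 * (-21100 * b ^ 2 + 26600 * b - 8100) + a * (3000 * b ^ 2 -
  3660 * b + 1020) + 1350 * b ^ 2 - 1860 * b + 630) + a ^ 3 * (13000 * b ^ 2 - 16700 * b + 5250)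
  + a ^ 2 * (-16900 * b ^ 2 + 22230 * b - 7110) + a * (5400 * b ^ 2 - 7230 * b + 2340)) + T * z
  ^ 3 * (y * (a ^ 3 * (24000 * b ^ 2 - 28000 * b + 8000) + a ^ 2 * (-22000 * b ^ 2 + 26400 * b -
  7600) + a * (1000 * b ^ 2 - 800 * b) + 2000 * b ^ 2 - 2700 * b + 900) + a ^ 3 * (54000 * b ^ 2
  - 66200 * b + 19800) + a ^ 2 * (-66800 * b ^ 2 + 84400 * b - 25800) + a * (20200 * b ^ 2 -
  26100 * b + 8100)) + z ^ 4 * (a ^ 3 * (72000 * b ^ 2 - 84000 * b + 24000) + a ^ 2 * (-84000 *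
  b ^ 2 + 102000 * b - 30000) + a * (24000 * b ^ 2 - 30000 * b + 9000))

/-- The value of `PolyTerm.coef1` at real arguments. -/
def coef1 (T z y a b : ℝ) : ℝ :=
  T ^ 5 * (y ^ 2 * (a ^ 3 * (-675 * b ^ 2 + 930 * b - 315) + a ^ 2 * (525 * b ^ 2 - 675 * b +
  216)) + a ^ 3 * (-75 * b ^ 2 + 45 * b) * y) + T ^ 4 * z * (y ^ 2 * (a ^ 3 * (-9100 * b ^ 2 +
  12090 * b - 3930) + a ^ 2 * (6150 * b ^ 2 - 7470 * b + 2250) + a * (600 * b ^ 2 - 720 * b +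
  216)) + y * (a ^ 3 * (-3000 * b ^ 2 + 3270 * b - 900) + a ^ 2 * (1350 * b ^ 2 - 1890 * b +
  648)) + a ^ 3 * (-150 * b ^ 2 + 90 * b)) + T ^ 3 * z ^ 2 * (y ^ 2 * (a ^ 3 * (-45100 * b ^ 2 +
  57500 * b - 17850) + a ^ 2 * (26500 * b ^ 2 - 29460 * b + 8040) + a * (5025 * b ^ 2 - 6060 * b
  + 1845) + 75 * b ^ 2 - 45 * b) + y * (a ^ 3 * (-33600 * b ^ 2 + 39630 * b - 11730) + a ^ 2 *
  (18750 * b ^ 2 - 24480 * b + 7830) + a * (675 * b ^ 2 - 765 * b + 216)) + a ^ 3 * (-3300 * b ^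
  2 + 2820 * b - 540) + a ^ 2 * (600 * b ^ 2 - 1080 * b + 432)) + T ^ 2 * z ^ 3 * (y ^ 2 * (a ^
  3 * (-96000 * b ^ 2 + 117200 * b - 34800) + a ^ 2 * (48500 * b ^ 2 - 46900 * b + 10950) + a *
  (14000 * b ^ 2 - 16650 * b + 4950)) + y * (a ^ 3 * (-157200 * b ^ 2 + 186600 * b - 54900) + a
  ^ 2 * (94200 * b ^ 2 - 114450 * b + 33990) + a * (4650 * b ^ 2 - 4890 * b + 1350) + 150 * b ^
  2 - 90 * b) + a ^ 3 * (-28800 * b ^ 2 + 28200 * b - 6840) + a ^ 2 * (10200 * b ^ 2 - 15360 * b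
  + 5400) + a * (-150 * b ^ 2 + 90 * b)) + T * z ^ 4 * (y ^ 2 * (a ^ 3 * (-72000 * b ^ 2 + 84000
  * b - 24000) + a ^ 2 * (30000 * b ^ 2 - 21000 * b + 3000) + a * (12000 * b ^ 2 - 15000 * b +
  4500)) + y * (a ^ 3 * (-318000 * b ^ 2 + 372600 * b - 107400) + a ^ 2 * (199800 * b ^ 2 -
  223200 * b + 61200) + a * (7800 * b ^ 2 - 7200 * b + 1800)) + a ^ 3 * (-108000 * b ^ 2 +
  109800 * b - 27900) + a ^ 2 * (48600 * b ^ 2 - 66600 * b + 21600)) + z ^ 5 * (y * (a ^ 3 *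
  (-216000 * b ^ 2 + 252000 * b - 72000) + a ^ 2 * (144000 * b ^ 2 - 144000 * b + 36000)) + a ^
  3 * (-144000 * b ^ 2 + 144000 * b - 36000) + a ^ 2 * (72000 * b ^ 2 - 90000 * b + 27000))

/-- The value of `PolyTerm.coef2` at real arguments. -/
def coef2 (T z y a b : ℝ) : ℝ :=
  T ^ 6 * (a ^ 2 * (300 * b ^ 2 - 360 * b + 108) * y ^ 2) + T ^ 5 * z * (y ^ 2 * (a ^ 2 * (4575
  * b ^ 2 - 5370 * b + 1575) + a * (375 * b ^ 2 - 405 * b + 108)) + a ^ 2 * (1275 * b ^ 2 - 1485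
  * b + 432) * y) + T ^ 4 * z ^ 2 * (y ^ 2 * (a ^ 2 * (27000 * b ^ 2 - 30525 * b + 8595) + a *
  (3675 * b ^ 2 - 4200 * b + 1215) + 75 * b ^ 2 - 45 * b) + y * (a ^ 2 * (19950 * b ^ 2 - 22890
  * b + 6570) + a * (1200 * b ^ 2 - 1080 * b + 216)) + a ^ 2 * (1350 * b ^ 2 - 1530 * b + 432))
  + T ^ 3 * z ^ 3 * (y ^ 2 * (a ^ 2 * (72000 * b ^ 2 - 77400 * b + 20700) + a * (13500 * b ^ 2 -
  15975 * b + 4725)) + y * (a ^ 2 * (122400 * b ^ 2 - 136200 * b + 37800) + a * (9600 * b ^ 2 -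
  9120 * b + 2160) + 375 * b ^ 2 - 225 * b) + a ^ 2 * (21600 * b ^ 2 - 24300 * b + 6840) + a *
  (900 * b ^ 2 - 540 * b)) + T ^ 2 * z ^ 4 * (y ^ 2 * (a ^ 2 * (72000 * b ^ 2 - 72000 * b +
  18000) + a * (18000 * b ^ 2 - 22500 * b + 6750)) + y * (a ^ 2 * (342000 * b ^ 2 - 364500 * b +
  96750) + a * (29700 * b ^ 2 - 30600 * b + 8100)) + a ^ 2 * (136800 * b ^ 2 - 150300 * b +
  41220) + a * (4500 * b ^ 2 - 1440 * b - 540) + 450 * b ^ 2 - 270 * b) + T * z ^ 5 * (y * (a ^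
  2 * (360000 * b ^ 2 - 360000 * b + 90000) + a * (36000 * b ^ 2 - 45000 * b + 13500)) + a ^ 2 *
  (396000 * b ^ 2 - 419400 * b + 110700) + a * (5400 * b ^ 2 + 2700 * b - 2700)) + z ^ 6 * (a ^
  2 * (432000 * b ^ 2 - 432000 * b + 108000))

theorem eval_exprF (x y a b u : ℝ) : PolyTerm.exprF.eval ![x, y, a, b, u] =
    (y - x) * (y * (y - x) * a * coef2 (y * (y - x) - 2 * u) (x * u) y a b
      + x * u * (y * (y - x) - 2 * u) * coef1 (y * (y - x) - 2 * u) (x * u) y a b)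
      + (x * u * (y * (y - x) - 2 * u)) ^ 2 * coef0 (y * (y - x) - 2 * u) (x * u) y a b := by
  simp [PolyTerm.exprF, PolyTerm.coef0, PolyTerm.coef1, PolyTerm.coef2, coef0, coef1, coef2]

set_option maxHeartbeats 2000000 in
set_option maxRecDepth 4000 in
/-- The weighted sum of `V c stageX / stageD` over the stages `4, 5, 6` if `c₆ = 1`, with
denominators cleared. The differences of the nodes, which are the denominators of the weights,
divide it. -/
theorem sum_stages (T z Y y a b : ℝ) :
   (3 * T + 10 * z - b * (5 * T + 20 * z)) * (1 - b) * (a * stageX T z a 1 a) *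
        stageD T z Y y b (V5 T z a) (E5 T z a b) * stageD T z Y y 1 (V6 T z a b) (E6 T z a b)
     + (1 - a) * V5 T z a * (b * stageX T z b (V5 T z a) (E5 T z a b)) *
        stageD T z Y y a 1 a * stageD T z Y y 1 (V6 T z a b) (E6 T z a b)
     + (a - b) * V6 T z a b * (1 * stageX T z 1 (V6 T z a b) (E6 T z a b)) *
        stageD T z Y y a 1 a * stageD T z Y y b (V5 T z a) (E5 T z a b)
   = (1 - a) * (1 - b) * (a - b) * (Y ^ 2 * a * coef2 T z y a b + Y * (z * T) * coef1 T z y a b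
      + (z * T) ^ 2 * y * coef0 T z y a b) := by
  unfold stageX stageD stageN V5 V6 E5 E6 coef0 coef1 coef2
  ring

end Chain

/-! ### The last order condition if `c₆ = 1` -/

/-- An identity between continuous functions of a real variable need only be checked where a given
non-zero polynomial does not vanish. -/
theorem eq_of_polynomial_mul_eq {P : Polynomial ℝ} (hP : P ≠ 0) {f g : ℝ → ℝ} (hf : Continuous f)
    (hg : Continuous g) (h : ∀ t, P.eval t * f t = P.eval t * g t) : ∀ t, f t = g t := by
  intro t
  have hd : Dense ((P.roots.toFinset : Set ℝ)ᶜ) :=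
    (P.roots.toFinset.finite_toSet.countable).dense_compl ℝ
  refine congrFun (Continuous.ext_on hd hf hg fun t ht => ?_) t
  have : P.eval t ≠ 0 := fun h0 => ht (by simpa [hP] using h0)
  exact mul_left_cancel₀ this (h t)

namespace Chain

/-- Proportional to `k (k - u)`, if `k` is the value of `c'` at the stage. -/
def stageP (x T z y c V E : ℝ) : ℝ :=
  stageN T z y c V E * ((c + y - x) * stageN T z y c V E + z * T * V)

theorem StageForm.k_mul_k_sub {x y u T z c V E k τ : ℝ} (h : StageForm x y u T z c V E k τ)
    (hu : u ≠ 0) (hp : c * (c - x) * (c - y) ≠ 0) :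
    k * (k - u) * stageD T z (y * (y - x)) y c V E = u * (τ * stageP x T z y c V E) := by
  have h1 := h.k_mul hu hp
  have h2 := h.q
  have h3 : (k - u) * stageD T z (y * (y - x)) y c V E
      = u * (c - y) * ((c + y - x) * stageN T z y c V E + z * T * V) := by
    rw [sub_mul, h1, stageD]; ring
  rw [stageP]
  linear_combination k * h3 + u * ((c + y - x) * stageN T z y c V E + z * T * V) * h2

/-- The splitting `Y k (k - u) = v (k - c ^ 2 / 2) + (v c ^ 2 / 2 + u (c + y - x) q)`: the first
part vanishes with `u - y ^ 2 / 2`, and the sum of the second one over the stages is known from the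
moments of `v` and `q`. -/
theorem mul_stageP (x y u c V E : ℝ) {T z : ℝ} (hT : T = y * (y - x) - 2 * u) (hz : z = x * u) :
    y * (y - x) * u * stageP x T z y c V E =
      z * T * V * ((u - y ^ 2 / 2) * (y - x) * (c * stageX T z c V E)) +
      stageD T z (y * (y - x)) y c V E *
        (z * T * V * c ^ 2 / 2 + u * (c + y - x) * stageN T z y c V E) := by
  rw [stageP, stageD, stageN, stageX, hT, hz]
  ring

theorem continuous_coef {X : Type*} [TopologicalSpace X] {T z y a b : X → ℝ} (hT : Continuous T)
    (hz : Continuous z) (hy : Continuous y) (ha : Continuous a) (hb : Continuous b) :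
    Continuous (fun t => coef0 (T t) (z t) (y t) (a t) (b t)) ∧
    Continuous (fun t => coef1 (T t) (z t) (y t) (a t) (b t)) ∧
    Continuous (fun t => coef2 (T t) (z t) (y t) (a t) (b t)) := by
  unfold coef0 coef1 coef2
  exact ⟨by fun_prop, by fun_prop, by fun_prop⟩

set_option maxRecDepth 4000 in
/-- The last order condition as a sum over the stages `4, 5, 6`, with denominators cleared, if
`c₆ = 1`: it factors into the equations of types A′ and B′. The identity follows from `mul_stageP`
and `sum_stages` after multiplication by `y (y - x)`, which may vanish; as `y` varies, continuity
removes this factor. -/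
theorem sum_stageP (x u a b : ℝ) (y : ℝ) {T z : ℝ} (hT : T = y * (y - x) - 2 * u)
    (hz : z = x * u) :
    u * ((3 * T + 10 * z - b * (5 * T + 20 * z)) * (1 - b) * stageP x T z y a 1 a *
        stageD T z (y * (y - x)) y b (V5 T z a) (E5 T z a b) *
        stageD T z (y * (y - x)) y 1 (V6 T z a b) (E6 T z a b)
      + (1 - a) * stageP x T z y b (V5 T z a) (E5 T z a b) *
        stageD T z (y * (y - x)) y a 1 a *
        stageD T z (y * (y - x)) y 1 (V6 T z a b) (E6 T z a b)
      + (a - b) * stageP x T z y 1 (V6 T z a b) (E6 T z a b) *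
        stageD T z (y * (y - x)) y a 1 a *
        stageD T z (y * (y - x)) y b (V5 T z a) (E5 T z a b))
      - (6 - 20 * u) * (z * T) * ((a - b) * (1 - a) * (1 - b)) *
        (stageD T z (y * (y - x)) y a 1 a *
        stageD T z (y * (y - x)) y b (V5 T z a) (E5 T z a b) *
        stageD T z (y * (y - x)) y 1 (V6 T z a b) (E6 T z a b)) =
    z * T * ((a - b) * (1 - a) * (1 - b)) * (u - y ^ 2 / 2) *
      PolyTerm.exprF.eval ![x, y, a, b, u] := by
  subst hT hz
  revert y
  refine eq_of_polynomial_mul_eq (P := .X * (.X - .C x)) ?_ ?_ ?_ ?_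
  · exact mul_ne_zero Polynomial.X_ne_zero (Polynomial.X_sub_C_ne_zero x)
  · unfold stageP stageD stageN V5 V6 E5 E6
    fun_prop
  · simp only [eval_exprF]
    obtain ⟨h0, h1, h2⟩ := continuous_coef (X := ℝ) (T := fun y => y * (y - x) - 2 * u)
      (z := fun _ => x * u) (y := fun y => y) (a := fun _ => a) (b := fun _ => b) (by fun_prop)
      (by fun_prop) (by fun_prop) (by fun_prop) (by fun_prop)
    fun_prop
  · intro y
    simp only [Polynomial.eval_mul, Polynomial.eval_sub, Polynomial.eval_X, Polynomial.eval_C,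
      eval_exprF]
    obtain ⟨T, hT⟩ : ∃ T, T = y * (y - x) - 2 * u := ⟨_, rfl⟩
    obtain ⟨z, hz⟩ : ∃ z, z = x * u := ⟨_, rfl⟩
    simp only [← hT, ← hz]
    have e4 := mul_stageP x y u a 1 a hT hz
    have e5 := mul_stageP x y u b (V5 T z a) (E5 T z a b) hT hz
    have e6 := mul_stageP x y u 1 (V6 T z a b) (E6 T z a b) hT hz
    have e := sum_stages T z (y * (y - x)) y a b
    have e0 : (3 * T + 10 * z - b * (5 * T + 20 * z)) * (1 - b) *
          (z * T * 1 * a ^ 2 / 2 + u * (a + y - x) * stageN T z y a 1 a) +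
        (1 - a) * (z * T * V5 T z a * b ^ 2 / 2 +
          u * (b + y - x) * stageN T z y b (V5 T z a) (E5 T z a b)) +
        (a - b) * (z * T * V6 T z a b * 1 ^ 2 / 2 +
          u * (1 + y - x) * stageN T z y 1 (V6 T z a b) (E6 T z a b)) =
        y * (y - x) * (6 - 20 * u) * (z * T) * ((a - b) * (1 - a) * (1 - b)) := by
      rw [stageN, stageN, stageN, V5, V6, E5, E6, hT, hz]
      ring
    generalize stageD T z (y * (y - x)) y a 1 a = D4 at *
    generalize stageD T z (y * (y - x)) y b (V5 T z a) (E5 T z a b) = D5 at *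
    generalize stageD T z (y * (y - x)) y 1 (V6 T z a b) (E6 T z a b) = D6 at *
    linear_combination ((3 * T + 10 * z - b * (5 * T + 20 * z)) * (1 - b) * D5 * D6) * e4 +
      (1 - a) * D4 * D6 * e5 + (a - b) * D4 * D5 * e6 + D4 * D5 * D6 * e0 +
      z * T * (u - y ^ 2 / 2) * (y - x) * e

end Chain

/-! ### The last order condition if the equation for `c₄` holds -/

namespace Chain

/-- The polynomial of type B, `x = c₂`, `y = c₃`, `u = c'₃`. -/
def polyB (x y u : ℝ) : ℝ :=
  3 * (y - x) * (x + y - 4 * x * y) - u * (2 * (3 - 12 * x + 10 * x ^ 2))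

/-- The polynomial of type C, `x = c₂`, `y = c₃`, `u = c'₃`, `b = c₅`, `c = c₆`. -/
def polyC (x y u b c : ℝ) : ℝ :=
  let Z : ℝ → ℝ → ℝ → ℝ := fun α₀ α₁ α₂ => α₀ - α₁ * (b + c) + α₂ * (b * c)
  (3 * Z 12 15 20 - 3 * (x + y) * Z 33 40 50 + 2 * x * y * Z 138 165 200) *
        (y ^ 2 * (y - x) ^ 2)
    - ((12 + 50 * x ^ 2) * (Z 12 15 20 - y * Z 33 40 50) - 3 * x * Z 207 260 350
        + 2 * x * y * Z 852 1035 1300) * (u * y * (y - x))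
    + ((2 + 10 * x * y) * Z 12 15 20 - 15 * x * Z 3 4 6 - 2 * y * Z 33 40 50) *
        (2 * (3 - 12 * x + 10 * x ^ 2) * u ^ 2)

/-- The value at `v` of the interpolation polynomial with nodes `p` and `q`: if the functional with
moments `bᵀ v`, `bᵀ (v * c)`, `bᵀ (v * c * c)` is carried by three nodes, these values are its
weights up to the differences of the nodes. -/
noncomputable def lagrange (T z p q : ℝ) : ℝ :=
  (2 * T + 5 * z) / 20 - (p + q) * ((3 * T + 8 * z) / 24) + p * q * ((T + 3 * z) / 6)

/-- The quotient of `lagrange T z c₄ p` by `W T z`, if the equation for `c₄` holds. -/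
noncomputable def starWeight (T z p : ℝ) : ℝ :=
  (4 * T + 15 * z - p * (5 * T + 20 * z)) / (120 * Δ T z)

/-- The value of `q` at the node `c` if the equation for `c₄` holds, up to the factor of
`StageForm`. -/
def starN (T z y c : ℝ) : ℝ := stageN T z y c (-W T z) (z * (20 * z * c + 3 * T))

/-- The denominator of `c'` at the node `c` if the equation for `c₄` holds. -/
def starD (T z Y y c : ℝ) : ℝ := stageD T z Y y c (-W T z) (z * (20 * z * c + 3 * T))

/-- Proportional to `c' (c' - c'₃)` at the node `c` if the equation for `c₄` holds. -/
def starP (x T z y c : ℝ) : ℝ := stageP x T z y c (-W T z) (z * (20 * z * c + 3 * T))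

section Star

variable {T z a : ℝ}

theorem neg_W_mul (hz : z ≠ 0) (ha : a = -(T * z) / Δ T z) :
    -W T z * a = z * (20 * z * a + 3 * T) := by
  have := (Δ_pos (T := T) hz).ne'
  rw [ha, W]
  field_simp
  rw [Δ]; ring

theorem W_mul_starWeight (hz : z ≠ 0) (ha : a = -(T * z) / Δ T z) (p : ℝ) :
    W T z * starWeight T z p = lagrange T z a p := by
  have := (Δ_pos (T := T) hz).ne'
  rw [ha, starWeight, W, lagrange]
  field_simp
  rw [Δ]; ring

theorem starN_eq (hz : z ≠ 0) (ha : a = -(T * z) / Δ T z) (y : ℝ) :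
    -W T z * stageN T z y a 1 a = starN T z y a := by
  rw [starN, stageN, stageN]
  linear_combination (y * T + 2 * z) * neg_W_mul hz ha

theorem starD_eq (hz : z ≠ 0) (ha : a = -(T * z) / Δ T z) (Y y : ℝ) :
    -W T z * stageD T z Y y a 1 a = starD T z Y y a := by
  rw [starD, stageD, stageD, ← starN, ← starN_eq hz ha]
  ring

theorem starP_eq (hz : z ≠ 0) (ha : a = -(T * z) / Δ T z) (x y : ℝ) :
    W T z ^ 2 * stageP x T z y a 1 a = starP x T z y a := by
  rw [starP, stageP, stageP, ← starN, ← starN_eq hz ha]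
  ring

/-- `D` is linear in the node, and its constant term is the polynomial of type B. -/
theorem starD_factor (x y u c : ℝ) (hT : T = y * (y - x) - 2 * u) (hz : z = x * u) :
    starD T z (y * (y - x)) y c = 2 * u * z *
      ((10 * x * (y * (y - x)) * (y * T + 2 * z) - W T z) * c + y * T * polyB x y u) := by
  rw [starD, stageD, stageN, W, polyB, hT, hz]
  ring

/-- Up to a factor that all stages share, `stageX` is a function of the node alone. -/
theorem stageX_star (c : ℝ) : stageX T z c (-W T z) (z * (20 * z * c + 3 * T)) =
    2 * z ^ 2 * T * (10 * c ^ 2 - 12 * c + 3) := by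
  rw [stageX, W]; ring

/-- The sum of `β g / D` over the three nodes with the weights of `lagrange`, where `D` is the
linear function `A c + B`; here the functional annihilates `g`. -/
theorem sum_lagrange (a b c A B : ℝ) :
    (b - c) * lagrange T z b c * (a * (10 * a ^ 2 - 12 * a + 3)) * (A * b + B) * (A * c + B)
      - (a - c) * lagrange T z a c * (b * (10 * b ^ 2 - 12 * b + 3)) * (A * a + B) * (A * c + B)
      + (a - b) * lagrange T z a b * (c * (10 * c ^ 2 - 12 * c + 3)) * (A * a + B) * (A * b + B) =
    -(B * ((a - b) * (a - c) * (b - c)) / 120 *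
      (A * ((36 - 45 * (b + c) + 60 * b * c) * T + (90 - 120 * (b + c) + 180 * b * c) * z
        - a * ((45 - 60 * (b + c) + 90 * b * c) * T + (120 - 180 * (b + c) + 320 * b * c) * z))
      + B * ((99 - 120 * (b + c) + 150 * b * c) * T + (240 - 300 * (b + c) + 400 * b * c) * z
        - a * ((120 - 150 * (b + c) + 200 * b * c) * T
          + (300 - 400 * (b + c) + 600 * b * c) * z)))) := by
  rw [lagrange, lagrange, lagrange]
  ring

/-- The last factor in `sum_lagrange` is, up to known factors, the polynomial of type C. -/
theorem polyC_factor (x y u b c : ℝ) (hz0 : z ≠ 0) (ha : a = -(T * z) / Δ T z)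
    (hT : T = y * (y - x) - 2 * u) (hz : z = x * u) :
    Δ T z * ((10 * x * (y * (y - x)) * (y * T + 2 * z) - W T z) *
      ((36 - 45 * (b + c) + 60 * b * c) * T + (90 - 120 * (b + c) + 180 * b * c) * z
        - a * ((45 - 60 * (b + c) + 90 * b * c) * T + (120 - 180 * (b + c) + 320 * b * c) * z))
      + y * T * polyB x y u *
        ((99 - 120 * (b + c) + 150 * b * c) * T + (240 - 300 * (b + c) + 400 * b * c) * z
        - a * ((120 - 150 * (b + c) + 200 * b * c) * T
          + (300 - 400 * (b + c) + 600 * b * c) * z))) = -(T * W T z * polyC x y u b c) := by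
  have h0 : Δ T z * a = -(T * z) := by
    rw [ha, mul_div_cancel₀ _ (Δ_pos hz0).ne']
  rw [mul_add, mul_left_comm, mul_left_comm (Δ T z)]
  simp only [mul_sub (Δ T z), ← mul_assoc (Δ T z) a, h0]
  rw [Δ, W, polyB, polyC, hT, hz]
  ring

/-- The part of the last order condition that contributes no denominators, if the equation for `c₄`
holds. -/
theorem sum_starP_aux (x y u a b c : ℝ) (hT : T = y * (y - x) - 2 * u) (hz : z = x * u) :
    (b - c) * lagrange T z b c * (z * T * -W T z * a ^ 2 / 2 + u * (a + y - x) * starN T z y a)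
      - (a - c) * lagrange T z a c *
        (z * T * -W T z * b ^ 2 / 2 + u * (b + y - x) * starN T z y b)
      + (a - b) * lagrange T z a b *
        (z * T * -W T z * c ^ 2 / 2 + u * (c + y - x) * starN T z y c) =
    y * (y - x) * ((6 - 20 * u) / 120) * (z * T * -W T z) * ((a - b) * (a - c) * (b - c)) := by
  have h : ∀ n0 n1 : ℝ, (b - c) * lagrange T z b c *
        (z * T * -W T z * a ^ 2 / 2 + u * (a + y - x) * (n1 * a + n0))
      - (a - c) * lagrange T z a c *
        (z * T * -W T z * b ^ 2 / 2 + u * (b + y - x) * (n1 * b + n0))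
      + (a - b) * lagrange T z a b *
        (z * T * -W T z * c ^ 2 / 2 + u * (c + y - x) * (n1 * c + n0)) =
      (z * T * -W T z * ((2 * T + 5 * z) / 20) / 2
        + u * (n1 * ((2 * T + 5 * z) / 20 + (y - x) * ((3 * T + 8 * z) / 24))
          + n0 * ((3 * T + 8 * z) / 24 + (y - x) * ((T + 3 * z) / 6)))) *
        ((a - b) * (a - c) * (b - c)) := by
    intro n0 n1
    rw [lagrange, lagrange, lagrange]
    ring
  have e : ∀ t, starN T z y t =
      z * (20 * z * (y * T + 2 * z) - W T z) * t + z * (3 * T * (y * T + 2 * z)) := by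
    intro t
    rw [starN, stageN]; ring
  rw [e, e, e, h]
  congr 1
  rw [W, hT, hz]
  ring

end Star

/-- The polynomial in `y` whose value is `W`. -/
noncomputable def polynomialW (x u : ℝ) : Polynomial ℝ :=
  .C 3 * (.X * (.X - .C x) - .C (2 * u)) ^ 2
    + .C (24 * (x * u)) * (.X * (.X - .C x) - .C (2 * u)) + .C (40 * (x * u) ^ 2)

theorem eval_polynomialW (x u y : ℝ) :
    (polynomialW x u).eval y = W (y * (y - x) - 2 * u) (x * u) := by
  simp [polynomialW, W]

theorem polynomialW_ne_zero (x u : ℝ) : polynomialW x u ≠ 0 := by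
  intro h
  have e : ∀ y, W (y * (y - x) - 2 * u) (x * u) = 0 := fun y => by
    rw [← eval_polynomialW, h, Polynomial.eval_zero]
  -- the fourth difference of a polynomial with leading term `3 y ^ 4`
  have h0 := e 0
  have h1 := e 1
  have h2 := e 2
  have h3 := e 3
  have h4 := e 4
  simp only [W] at h0 h1 h2 h3 h4
  have : (72 : ℝ) = 0 := by linear_combination h0 - 4 * h1 + 6 * h2 - 4 * h3 + h4
  norm_num at this

/-- The last order condition as a sum over the stages `4, 5, 6`, with denominators cleared, if the
equation for `c₄` holds: it factors into the equations of types A, B and C. The identity is proved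
after multiplication by `y (y - x) W ^ 2`; as `y` varies, continuity removes this factor. -/
theorem sum_starP (x u b c : ℝ) (hxu : x * u ≠ 0) (y : ℝ) {T z a : ℝ}
    (hT : T = y * (y - x) - 2 * u) (hz : z = x * u) (ha : a = -(T * z) / Δ T z) :
    u * ((b - c) * lagrange T z b c * stageP x T z y a 1 a *
        starD T z (y * (y - x)) y b * starD T z (y * (y - x)) y c
      + (a - c) * starWeight T z c * starP x T z y b *
        stageD T z (y * (y - x)) y a 1 a * starD T z (y * (y - x)) y c
      - (a - b) * starWeight T z b * starP x T z y c *
        stageD T z (y * (y - x)) y a 1 a * starD T z (y * (y - x)) y b)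
      - (6 - 20 * u) / 120 * (z * T) * ((a - b) * (a - c) * (b - c)) *
        (stageD T z (y * (y - x)) y a 1 a * starD T z (y * (y - x)) y b *
          starD T z (y * (y - x)) y c) =
    -(z * T * ((a - b) * (a - c) * (b - c)) * (u - y ^ 2 / 2) *
      (8 * u ^ 2 * z ^ 4 * T ^ 3 * polyB x y u * polyC x y u b c / (120 * Δ T z))) := by
  subst ha hT hz
  revert y
  refine eq_of_polynomial_mul_eq (P := .X * (.X - .C x) * polynomialW x u ^ 2) ?_ ?_ ?_ ?_
  · exact mul_ne_zero (mul_ne_zero Polynomial.X_ne_zero (Polynomial.X_sub_C_ne_zero x))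
      (pow_ne_zero _ (polynomialW_ne_zero x u))
  · have hΔ : ∀ y, Δ (y * (y - x) - 2 * u) (x * u) ≠ 0 := fun y => (Δ_pos hxu).ne'
    have hc : Continuous fun y => -((y * (y - x) - 2 * u) * (x * u)) /
        Δ (y * (y - x) - 2 * u) (x * u) :=
      Continuous.div (by fun_prop) (by unfold Δ; fun_prop) hΔ
    have hw : ∀ t, Continuous fun y => starWeight (y * (y - x) - 2 * u) (x * u) t := fun t => by
      unfold starWeight
      exact Continuous.div (by fun_prop) (by unfold Δ; fun_prop)
        fun y => mul_ne_zero (by norm_num) (hΔ y)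
    have hb := hw b
    have hc' := hw c
    unfold starP starD stageP stageD stageN W lagrange
    fun_prop
  · have hΔ : ∀ y, Δ (y * (y - x) - 2 * u) (x * u) ≠ 0 := fun y => (Δ_pos hxu).ne'
    have hc : Continuous fun y => -((y * (y - x) - 2 * u) * (x * u)) /
        Δ (y * (y - x) - 2 * u) (x * u) :=
      Continuous.div (by fun_prop) (by unfold Δ; fun_prop) hΔ
    have hd : Continuous fun y => 8 * u ^ 2 * (x * u) ^ 4 * (y * (y - x) - 2 * u) ^ 3 *
        polyB x y u * polyC x y u b c / (120 * Δ (y * (y - x) - 2 * u) (x * u)) :=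
      Continuous.div (by unfold polyB polyC; fun_prop) (by unfold Δ; fun_prop)
        fun y => mul_ne_zero (by norm_num) (hΔ y)
    fun_prop
  · intro y
    simp only [Polynomial.eval_mul, Polynomial.eval_sub, Polynomial.eval_X, Polynomial.eval_C,
      Polynomial.eval_pow, eval_polynomialW]
    obtain ⟨T, hT⟩ : ∃ T, T = y * (y - x) - 2 * u := ⟨_, rfl⟩
    obtain ⟨z, hz⟩ : ∃ z, z = x * u := ⟨_, rfl⟩
    rw [← hz] at hxu
    simp only [← hT, ← hz]
    obtain ⟨a, ha⟩ : ∃ a, a = -(T * z) / Δ T z := ⟨_, rfl⟩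
    simp only [← ha]
    have hΔ := (Δ_pos (T := T) hxu).ne'
    have e4 := mul_stageP x y u a (-W T z) (z * (20 * z * a + 3 * T)) hT hz
    have e5 := mul_stageP x y u b (-W T z) (z * (20 * z * b + 3 * T)) hT hz
    have e6 := mul_stageP x y u c (-W T z) (z * (20 * z * c + 3 * T)) hT hz
    rw [stageX_star, ← starP, ← starD, ← starN] at e4 e5 e6
    have e0 := sum_starP_aux x y u a b c hT hz
    have es := sum_lagrange (T := T) (z := z) a b c
      (10 * x * (y * (y - x)) * (y * T + 2 * z) - W T z) (y * T * polyB x y u)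
    have eC := polyC_factor x y u b c hxu ha hT hz
    have d4 := starD_factor x y u a hT hz
    have d5 := starD_factor x y u b hT hz
    have d6 := starD_factor x y u c hT hz
    have hP := starP_eq hxu ha x y
    have hD := starD_eq hxu ha (y * (y - x)) y
    have w5 := W_mul_starWeight hxu ha b
    have w6 := W_mul_starWeight hxu ha c
    rw [mul_comm, ← eq_div_iff hΔ] at eC
    rw [eC] at es
    generalize 10 * x * (y * (y - x)) * (y * T + 2 * z) - W T z = A at *
    generalize starN T z y a = N4 at *
    generalize starN T z y b = N5 at *
    generalize starN T z y c = N6 at *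
    generalize starP x T z y a = Q4 at *
    generalize starP x T z y b = Q5 at *
    generalize starP x T z y c = Q6 at *
    generalize stageP x T z y a 1 a = P4 at *
    generalize stageD T z (y * (y - x)) y a 1 a = D4 at *
    generalize starD T z (y * (y - x)) y a = S4 at *
    generalize starD T z (y * (y - x)) y b = S5 at *
    generalize starD T z (y * (y - x)) y c = S6 at *
    have es' : (b - c) * lagrange T z b c * (a * (10 * a ^ 2 - 12 * a + 3)) * S5 * S6
        - (a - c) * lagrange T z a c * (b * (10 * b ^ 2 - 12 * b + 3)) * S4 * S6
        + (a - b) * lagrange T z a b * (c * (10 * c ^ 2 - 12 * c + 3)) * S4 * S5 =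
        (2 * u * z) ^ 2 * (y * T * polyB x y u * ((a - b) * (a - c) * (b - c)) / 120 *
          (T * W T z * polyC x y u b c / Δ T z)) := by
      rw [d4, d5, d6]
      linear_combination (2 * u * z) ^ 2 * es
    have eL : W T z ^ 2 * (u * ((b - c) * lagrange T z b c * P4 * S5 * S6
          + (a - c) * starWeight T z c * Q5 * D4 * S6
          - (a - b) * starWeight T z b * Q6 * D4 * S5)
        - (6 - 20 * u) / 120 * (z * T) * ((a - b) * (a - c) * (b - c)) * (D4 * S5 * S6)) =
        u * ((b - c) * lagrange T z b c * Q4 * S5 * S6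
          - (a - c) * lagrange T z a c * Q5 * S4 * S6
          + (a - b) * lagrange T z a b * Q6 * S4 * S5)
        - (6 - 20 * u) / 120 * (z * T * -W T z) * ((a - b) * (a - c) * (b - c)) *
          (S4 * S5 * S6) := by
      linear_combination u * (b - c) * lagrange T z b c * S5 * S6 * hP
        + u * (a - c) * Q5 * S6 * (W T z * D4 * w6 - lagrange T z a c * hD)
        - u * (a - b) * Q6 * S5 * (W T z * D4 * w5 - lagrange T z a b * hD)
        + (6 - 20 * u) / 120 * (z * T) * ((a - b) * (a - c) * (b - c)) * (S5 * S6) * W T z * hD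
    rw [mul_assoc, eL]
    have hdiv : 8 * u ^ 2 * z ^ 4 * T ^ 3 * polyB x y u * polyC x y u b c / (120 * Δ T z) =
        8 * u ^ 2 * z ^ 4 * T ^ 3 * polyB x y u / 120 * (polyC x y u b c / Δ T z) := by
      field_simp
    rw [hdiv]
    have hdiv' : T * W T z * polyC x y u b c / Δ T z =
        T * W T z * (polyC x y u b c / Δ T z) := mul_div_assoc _ _ _
    rw [hdiv'] at es'
    generalize polyC x y u b c / Δ T z = q at *
    linear_combination (b - c) * lagrange T z b c * S5 * S6 * e4
      - (a - c) * lagrange T z a c * S4 * S6 * e5 + (a - b) * lagrange T z a b * S4 * S5 * e6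
      + S4 * S5 * S6 * e0
      + z * T * -W T z * (u - y ^ 2 / 2) * (y - x) * (2 * z ^ 2 * T) * es'

end Chain

/-! ### The last order condition -/

namespace Chain

variable {C : Chain} {T z v4 v5 v6 : ℝ}

/-- The factor of a stage, multiplied by the weight, from the weighted values. -/
theorem StageForm.weight_eq {x y u T z c V E k τ β θ : ℝ} (h : StageForm x y u T z c V E k τ)
    (hu : u ≠ 0) (hp : c * (c - x) * (c - y) ≠ 0)
    (hv : β * (τ * (z * T * V)) = θ * (z * T * V))
    (hq : β * (τ * stageN T z y c V E) = θ * stageN T z y c V E) : β * τ = θ := by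
  refine mul_right_cancel₀ (h.stageD_ne hu hp) ?_
  rw [stageD]
  linear_combination y * (y - x) * hq - (c - y) * hv

/-- The values of `v` and `q` at a stage with node `c`, multiplied by the weight of the stage, from
those at the stage with node `a = c₄`; `b` is the remaining node. -/
theorem star_weight {y a b c v q t : ℝ} (hz : z ≠ 0) (hT : T ≠ 0) (ha : a = -(T * z) / Δ T z)
    (hab : a - b ≠ 0) (hac : a - c ≠ 0) (hbc : b - c ≠ 0)
    (ht : t * (z * T) * ((a - b) * (a - c)) = lagrange T z b c)
    (hv : v * ((c - a) * (c - b)) = lagrange T z a b)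
    (hq : q * (c - b) = 1 / 10 - y / 8 - b * (1 / 8 - y / 6)
      - (a - b) * (t * stageN T z y a 1 a)) :
    v = -starWeight T z b / (z * T * ((c - a) * (c - b))) * (z * T * -W T z) ∧
    q = -starWeight T z b / (z * T * ((c - a) * (c - b))) * starN T z y c := by
  have hΔ := (Δ_pos (T := T) hz).ne'
  have hca : c - a ≠ 0 := by rw [← neg_sub]; exact neg_ne_zero.2 hac
  have hcb : c - b ≠ 0 := by rw [← neg_sub]; exact neg_ne_zero.2 hbc
  constructor
  · refine mul_right_cancel₀ (mul_ne_zero hca hcb) ?_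
    rw [hv, ← W_mul_starWeight hz ha]
    field_simp
  · have ht' : t = lagrange T z b c / (z * T * ((a - b) * (a - c))) := by
      rw [eq_div_iff (by positivity), ← ht]; ring
    refine mul_right_cancel₀ hcb ?_
    rw [hq, ht', starWeight, lagrange, starN, stageN, stageN, W]
    field_simp
    rw [ha]
    field_simp
    rw [Δ]
    ring

/-- `bᵀ (c' * (c' - c'₃ 1))` at the stages `4, 5, 6`, with denominators cleared. -/
theorem sum_k_mul {x y u c4 c5 c6 V4 V5 V6 E4 E5 E6 k4 k5 k6 τ4 τ5 τ6 : ℝ} (b4 b5 b6 : ℝ)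
    (hu : u ≠ 0) (h4 : StageForm x y u T z c4 V4 E4 k4 τ4)
    (h5 : StageForm x y u T z c5 V5 E5 k5 τ5) (h6 : StageForm x y u T z c6 V6 E6 k6 τ6)
    (p4 : c4 * (c4 - x) * (c4 - y) ≠ 0) (p5 : c5 * (c5 - x) * (c5 - y) ≠ 0)
    (p6 : c6 * (c6 - x) * (c6 - y) ≠ 0) :
    (b4 * (k4 * (k4 - u)) + b5 * (k5 * (k5 - u)) + b6 * (k6 * (k6 - u))) *
      (stageD T z (y * (y - x)) y c4 V4 E4 * stageD T z (y * (y - x)) y c5 V5 E5 *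
        stageD T z (y * (y - x)) y c6 V6 E6) =
    u * (b4 * τ4 * stageP x T z y c4 V4 E4 * stageD T z (y * (y - x)) y c5 V5 E5 *
        stageD T z (y * (y - x)) y c6 V6 E6
      + b5 * τ5 * stageP x T z y c5 V5 E5 * stageD T z (y * (y - x)) y c4 V4 E4 *
        stageD T z (y * (y - x)) y c6 V6 E6
      + b6 * τ6 * stageP x T z y c6 V6 E6 * stageD T z (y * (y - x)) y c4 V4 E4 *
        stageD T z (y * (y - x)) y c5 V5 E5) := by
  have e4 := h4.k_mul_k_sub hu p4
  have e5 := h5.k_mul_k_sub hu p5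
  have e6 := h6.k_mul_k_sub hu p6
  generalize stageD T z (y * (y - x)) y c4 V4 E4 = D4 at *
  generalize stageD T z (y * (y - x)) y c5 V5 E5 = D5 at *
  generalize stageD T z (y * (y - x)) y c6 V6 E6 = D6 at *
  linear_combination b4 * D5 * D6 * e4 + b5 * D4 * D6 * e5 + b6 * D4 * D5 * e6

/-- The values `k` of `c'` at the stages `4, 5, 6`, where `x = c₂`, `y = c₃` and `u = c'₃`, satisfy
the conditions on the vectors `v`, `q` and `p` of a non-exceptional almost-pair. -/
structure Values (C : Chain) (x y u T z k4 k5 k6 : ℝ) : Prop where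
  hT : T = y * (y - x) - 2 * u
  hz : z = x * u
  hu : u ≠ 0
  z_ne : z ≠ 0
  ρ_ne : C.ρ ≠ 0
  p4 : C.c4 * (C.c4 - x) * (C.c4 - y) ≠ 0
  p5 : C.c5 * (C.c5 - x) * (C.c5 - y) ≠ 0
  p6 : C.c6 * (C.c6 - x) * (C.c6 - y) ≠ 0
  bb : C.Backbone T z (y * (y - x) * k4 - u * (C.c4 * (C.c4 - x)))
    (y * (y - x) * k5 - u * (C.c5 * (C.c5 - x))) (y * (y - x) * k6 - u * (C.c6 * (C.c6 - x)))
  q : C.Moment (k4 * (C.c4 - y)) (k5 * (C.c5 - y)) (k6 * (C.c6 - y)) (1 / 2 - y / 2)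
    (1 / 40 - y / 24) (1 / 8 - y / 6)
  p : C.Moment (C.c4 * (C.c4 - x) * (C.c4 - y)) (C.c5 * (C.c5 - x) * (C.c5 - y))
    (C.c6 * (C.c6 - x) * (C.c6 - y)) ((1 - x) * (1 - y)) (1 / 20 - (x + y) / 12 + x * y / 6)
    (1 / 4 - (x + y) / 3 + x * y / 2)

namespace Values

variable {x y u k4 k5 k6 : ℝ}

/-- The order condition on `c' * c'`, with `c'₃ c'` subtracted, so that the first three stages do
not contribute. -/
def Last (C : Chain) (u k4 k5 k6 : ℝ) : Prop :=
  C.b4 * (k4 * (k4 - u)) + C.b5 * (k5 * (k5 - u)) + C.b6 * (k6 * (k6 - u)) = 1 / 20 - u / 6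

/-- The stages `4` and `5`. -/
theorem forms (h : C.Values x y u T z k4 k5 k6) : T ≠ 0 ∧ ∃ τ4 τ5 : ℝ,
    StageForm x y u T z C.c4 1 C.c4 k4 τ4 ∧
    StageForm x y u T z C.c5 (Chain.V5 T z C.c4) (Chain.E5 T z C.c4 C.c5) k5 τ5 ∧
    C.f4 * τ4 = (3 * T + 10 * z - C.c5 * (5 * T + 20 * z)) / (120 * (C.c4 - C.c5) * (z * T)) ∧
    C.f5 * τ5 = 1 / (120 * (C.c4 - C.c5) * (z * T)) := by
  obtain ⟨hT, τ4, τ5, ⟨v4, q4, f4⟩, v5, q5, f5⟩ := h.bb.forms h.z_ne h.ρ_ne h.q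
  exact ⟨hT, τ4, τ5, ⟨v4, q4⟩, ⟨v5, q5⟩, f4, f5⟩

/-- The stages and their weights if `c₆ = 1`. -/
theorem forms_of_c6 (h : C.Values x y u T z k4 k5 k6) (h6 : C.c6 = 1) : ∃ τ4 τ5 τ6 : ℝ,
    StageForm x y u T z C.c4 1 C.c4 k4 τ4 ∧
    StageForm x y u T z C.c5 (Chain.V5 T z C.c4) (Chain.E5 T z C.c4 C.c5) k5 τ5 ∧
    StageForm x y u T z C.c6 (Chain.V6 T z C.c4 C.c5) (Chain.E6 T z C.c4 C.c5) k6 τ6 ∧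
    C.b4 * τ4 = (3 * T + 10 * z - C.c5 * (5 * T + 20 * z)) /
      (120 * (C.c4 - C.c5) * (1 - C.c4) * (z * T)) ∧
    C.b5 * τ5 = 1 / (120 * (C.c4 - C.c5) * (1 - C.c5) * (z * T)) ∧
    C.b6 * τ6 = 1 / (120 * (1 - C.c4) * (1 - C.c5) * (z * T)) := by
  have hG := h.bb.G_ne_zero h.z_ne
  obtain ⟨e4, e5⟩ := h.bb.e_eq_zero hG h6 h.p h.p5
  obtain ⟨hT, τ4, τ5, s4, s5, f4, f5⟩ := h.forms
  obtain ⟨w4, w5, τ6, v6, q6, w6⟩ :=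
    h.bb.form_six_of_c6 h.z_ne hT h6 e4 e5 h.q s4.v s4.q f4 s5.v s5.q f5
  rw [← h6] at q6
  exact ⟨τ4, τ5, τ6, s4, s5, ⟨v6, q6⟩, w4, w5, w6⟩

theorem last_iff_of_c6 (h : C.Values x y u T z k4 k5 k6) (h6 : C.c6 = 1) :
    Last C u k4 k5 k6 ↔
      u = y ^ 2 / 2 ∨ PolyTerm.exprF.eval ![x, y, C.c4, C.c5, u] = 0 := by
  have hz := h.z_ne
  have hu := h.hu
  have hT := h.forms.1
  obtain ⟨τ4, τ5, τ6, s4, s5, s6, w4, w5, w6⟩ := h.forms_of_c6 h6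
  have hs := sum_k_mul C.b4 C.b5 C.b6 hu s4 s5 s6 h.p4 h.p5 h.p6
  have d4 := s4.stageD_ne hu h.p4
  have d5 := s5.stageD_ne hu h.p5
  have d6 := s6.stageD_ne hu h.p6
  have hab : C.c4 - C.c5 ≠ 0 := sub_ne_zero.2 h.bb.ne45
  have ha1 : 1 - C.c4 ≠ 0 := sub_ne_zero.2 (h6 ▸ h.bb.ne46.symm)
  have hb1 : 1 - C.c5 ≠ 0 := sub_ne_zero.2 (h6 ▸ h.bb.ne56.symm)
  have hF := sum_stageP x u C.c4 C.c5 y h.hT h.hz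
  rw [w4, w5, w6] at hs
  rw [h6] at hs d6
  rw [Last]
  generalize PolyTerm.exprF.eval ![x, y, C.c4, C.c5, u] = F at *
  generalize stageD T z (y * (y - x)) y C.c4 1 C.c4 = D4 at *
  generalize stageD T z (y * (y - x)) y C.c5 (Chain.V5 T z C.c4) (Chain.E5 T z C.c4 C.c5) = D5 at *
  generalize stageD T z (y * (y - x)) y 1 (Chain.V6 T z C.c4 C.c5) (Chain.E6 T z C.c4 C.c5) = D6
    at *
  generalize C.b4 * (k4 * (k4 - u)) + C.b5 * (k5 * (k5 - u)) + C.b6 * (k6 * (k6 - u)) = S at *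
  have key : (S - (1 / 20 - u / 6)) * (120 * (D4 * D5 * D6)) = (u - y ^ 2 / 2) * F := by
    have hV : z * T * ((C.c4 - C.c5) * (1 - C.c4) * (1 - C.c5)) ≠ 0 :=
      mul_ne_zero (mul_ne_zero hz hT) (mul_ne_zero (mul_ne_zero hab ha1) hb1)
    refine mul_left_cancel₀ hV ?_
    field_simp at hs
    linear_combination hF + hs
  rw [← sub_eq_zero (b := y ^ 2 / 2), ← mul_eq_zero, ← key, ← sub_eq_zero (a := S), mul_eq_zero,
    or_iff_left (by positivity)]

/-- The stages and their weights if the equation for `c₄` holds. -/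
theorem forms_of_star (h : C.Values x y u T z k4 k5 k6) (hs : star T z C.c4 = 0) :
    ∃ τ4 τ5 τ6 : ℝ,
    StageForm x y u T z C.c4 1 C.c4 k4 τ4 ∧
    StageForm x y u T z C.c5 (-W T z) (z * (20 * z * C.c5 + 3 * T)) k5 τ5 ∧
    StageForm x y u T z C.c6 (-W T z) (z * (20 * z * C.c6 + 3 * T)) k6 τ6 ∧
    C.b4 * τ4 = lagrange T z C.c5 C.c6 / (z * T * ((C.c4 - C.c5) * (C.c4 - C.c6))) ∧
    C.b5 * τ5 = -starWeight T z C.c6 / (z * T * ((C.c5 - C.c4) * (C.c5 - C.c6))) ∧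
    C.b6 * τ6 = -starWeight T z C.c5 / (z * T * ((C.c6 - C.c4) * (C.c6 - C.c5))) := by
  have hG := h.bb.G_ne_zero h.z_ne
  have hz := h.z_ne
  have hu := h.hu
  have hb := h.bb.b6_ne hG
  obtain ⟨hT, τ4, τ5, s4, ⟨v5, q5⟩, -⟩ := h.forms
  have v4 := s4.v
  have q4 := s4.q
  have ha := eq_of_star hz hs
  have hab : C.c4 - C.c5 ≠ 0 := sub_ne_zero.2 h.bb.ne45
  have hac : C.c4 - C.c6 ≠ 0 := sub_ne_zero.2 h.bb.ne46
  have hbc : C.c5 - C.c6 ≠ 0 := sub_ne_zero.2 h.bb.ne56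
  obtain ⟨l4, l5, l6⟩ := h.bb.weights
  have ht : C.b4 * τ4 * (z * T) * ((C.c4 - C.c5) * (C.c4 - C.c6)) = lagrange T z C.c5 C.c6 := by
    rw [v4] at l4
    rw [lagrange]
    linear_combination l4
  obtain ⟨g6, g6q⟩ := star_weight (y := y) (v := C.b6 * _) (q := C.b6 * (k6 * (C.c6 - y))) hz hT ha
    hab hac hbc ht l6 (by
      have h1 := h.q.bc
      have h2 := h.q.b
      rw [q4] at h1 h2
      linear_combination h1 - C.c5 * h2)
  have ht' : C.b4 * τ4 * (z * T) * ((C.c4 - C.c6) * (C.c4 - C.c5)) = lagrange T z C.c6 C.c5 := by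
    rw [lagrange] at ht ⊢
    linear_combination ht
  obtain ⟨g5, g5q⟩ := star_weight (y := y) (v := C.b5 * _) (q := C.b5 * (k5 * (C.c5 - y))) hz hT ha
    hac hab (by rw [← neg_sub]; exact neg_ne_zero.2 hbc) ht' l5 (by
      have h1 := h.q.bc
      have h2 := h.q.b
      rw [q4] at h1 h2
      linear_combination h1 - C.c6 * h2)
  rw [V5_of_star hz hs] at v5
  rw [V5_of_star hz hs, E5_of_star hz hs] at q5
  set θ5 := -starWeight T z C.c6 / (z * T * ((C.c5 - C.c4) * (C.c5 - C.c6))) with hθ5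
  set θ6 := -starWeight T z C.c5 / (z * T * ((C.c6 - C.c4) * (C.c6 - C.c5))) with hθ6
  have s5 : StageForm x y u T z C.c5 (-W T z) (z * (20 * z * C.c5 + 3 * T)) k5
      (τ5 * ((T + 5 * z) / Δ T z)) :=
    ⟨by rw [v5]; ring, by rw [q5, stageN, stageN]; ring⟩
  have s6 : StageForm x y u T z C.c6 (-W T z) (z * (20 * z * C.c6 + 3 * T)) k6 (θ6 / C.b6) := by
    constructor
    · refine mul_left_cancel₀ hb ?_
      rw [g6]; field_simp
    · refine mul_left_cancel₀ hb ?_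
      rw [g6q, starN]; field_simp
  have w5 : C.b5 * (τ5 * ((T + 5 * z) / Δ T z)) = θ5 := by
    refine s5.weight_eq hu h.p5 ?_ ?_
    · rw [← s5.v, g5]
    · rw [← s5.q, g5q, starN]
  have w6 : C.b6 * (θ6 / C.b6) = θ6 := mul_div_cancel₀ _ hb
  have w4 : C.b4 * τ4 = lagrange T z C.c5 C.c6 / (z * T * ((C.c4 - C.c5) * (C.c4 - C.c6))) := by
    rw [eq_div_iff (by positivity), ← ht]; ring
  exact ⟨τ4, _, _, s4, s5, s6, w4, w5, w6⟩

theorem last_iff_of_star (h : C.Values x y u T z k4 k5 k6) (hs : star T z C.c4 = 0) :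
    Last C u k4 k5 k6 ↔
      u = y ^ 2 / 2 ∨ polyB x y u = 0 ∨ polyC x y u C.c5 C.c6 = 0 := by
  have hz := h.z_ne
  have hu := h.hu
  have hΔ := (Δ_pos (T := T) hz).ne'
  have hT := h.forms.1
  have ha := eq_of_star hz hs
  have hab : C.c4 - C.c5 ≠ 0 := sub_ne_zero.2 h.bb.ne45
  have hac : C.c4 - C.c6 ≠ 0 := sub_ne_zero.2 h.bb.ne46
  have hbc : C.c5 - C.c6 ≠ 0 := sub_ne_zero.2 h.bb.ne56
  obtain ⟨τ4, τ5, τ6, s4, s5, s6, w4, w5, w6⟩ := h.forms_of_star hs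
  have hsum := sum_k_mul C.b4 C.b5 C.b6 hu s4 s5 s6 h.p4 h.p5 h.p6
  have d4 := s4.stageD_ne hu h.p4
  have d5 := s5.stageD_ne hu h.p5
  have d6 := s6.stageD_ne hu h.p6
  have hF := sum_starP x u C.c5 C.c6 (h.hz ▸ hz) y h.hT h.hz ha
  rw [w4, w5, w6] at hsum
  have eD : ∀ c, stageD T z (y * (y - x)) y c (-W T z) (z * (20 * z * c + 3 * T)) =
    starD T z (y * (y - x)) y c := fun _ => rfl
  have eP : ∀ c, stageP x T z y c (-W T z) (z * (20 * z * c + 3 * T)) =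
    starP x T z y c := fun _ => rfl
  simp only [eD, eP] at hsum d5 d6
  rw [Last]
  generalize stageD T z (y * (y - x)) y C.c4 1 C.c4 = D4 at *
  generalize starD T z (y * (y - x)) y C.c5 = D5 at *
  generalize starD T z (y * (y - x)) y C.c6 = D6 at *
  generalize C.b4 * (k4 * (k4 - u)) + C.b5 * (k5 * (k5 - u)) + C.b6 * (k6 * (k6 - u)) = S at *
  have key : (S - (1 / 20 - u / 6)) * (D4 * D5 * D6) = (u - y ^ 2 / 2) *
      (polyB x y u * polyC x y u C.c5 C.c6) * -(8 * u ^ 2 * z ^ 4 * T ^ 3 / (120 * Δ T z)) := by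
    have hV : z * T * ((C.c4 - C.c5) * (C.c4 - C.c6) * (C.c5 - C.c6)) ≠ 0 :=
      mul_ne_zero (mul_ne_zero hz hT) (mul_ne_zero (mul_ne_zero hab hac) hbc)
    have hba : C.c5 - C.c4 = -(C.c4 - C.c5) := by ring
    have hca : C.c6 - C.c4 = -(C.c4 - C.c6) := by ring
    have hcb : C.c6 - C.c5 = -(C.c5 - C.c6) := by ring
    rw [hba, hca, hcb] at hsum
    refine mul_left_cancel₀ hV ?_
    generalize C.c4 - C.c5 = r at *
    generalize C.c4 - C.c6 = s at *
    generalize C.c5 - C.c6 = t at *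
    rw [sub_mul, mul_sub, hsum]
    field_simp
    field_simp at hF
    linear_combination 120 * hF
  have hne : -(8 * u ^ 2 * z ^ 4 * T ^ 3 / (120 * Δ T z)) ≠ 0 := by
    refine neg_ne_zero.2 (div_ne_zero ?_ (mul_ne_zero (by norm_num) hΔ))
    positivity
  rw [← sub_eq_zero (b := y ^ 2 / 2), ← mul_eq_zero (a := polyB x y u), ← mul_eq_zero,
    ← or_iff_left (a := _ = 0) hne, ← mul_eq_zero, ← key, ← sub_eq_zero (a := S), mul_eq_zero,
    or_iff_left (by positivity)]

end Values

end Chain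

/-! ### The classification -/

namespace Tableau

variable {M N : Tableau}

namespace IsPairExceptLast

theorem values (h : M.IsPairExceptLast) (hn : M.NonExceptional) :
    M.chain.Values (M.c 1) (M.c 2) (M.c' 2) M.T M.z (M.c' 3) (M.c' 4) (M.c' 5) where
  hT := rfl
  hz := rfl
  hu := h.c'_two_ne hn
  z_ne := h.z_ne hn
  ρ_ne := (h.backbone hn).ρ_ne_zero (h.z_ne hn) h.moment_c'' h.moment_p (hn.p_ne (Or.inl rfl))
    (h.d_ne (h.c_one_ne hn) (h.c'_two_ne hn))
  p4 := by have := hn.p_ne (Or.inl rfl); rwa [p_apply] at this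
  p5 := by have := hn.p_ne (Or.inr (Or.inl rfl)); rwa [p_apply] at this
  p6 := by have := hn.p_ne (Or.inr (Or.inr rfl)); rwa [p_apply] at this
  bb := by have := h.backbone hn; rwa [v_apply, v_apply, v_apply, Y] at this
  q := by have := h.moment_q; rwa [q_apply, q_apply, q_apply] at this
  p := by
    have := h.moment_p
    rwa [p_apply, p_apply, p_apply, p_apply, h.fsal.1, one_mul] at this

theorem lastCondition_iff (h : M.IsPairExceptLast) :
    M.LastCondition ↔ Chain.Values.Last M.chain (M.c' 2) (M.c' 3) (M.c' 4) (M.c' 5) := by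
  have e := h.vmoment_c'.b
  rw [LastCondition, Chain.Values.Last]
  rw [dotProduct, Fin.sum_univ_seven, h.b_six] at e ⊢
  simp only [Pi.mul_apply, h.c'_zero, h.c'_one, chain] at e ⊢
  constructor <;> intro h'
  · linear_combination h' - M.c' 2 * e
  · linear_combination h' + M.c' 2 * e

theorem c4Equation_iff (h : M.IsPairExceptLast) (hn : M.NonExceptional) :
    M.C4Equation ↔ Chain.star M.T M.z (M.c 3) = 0 := by
  have hz := h.z_ne hn
  have e : (2 * M.c' 2 * (1 - 2 * M.c 1) - M.c 2 * (M.c 2 - M.c 1)) ^ 2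
      + 4 * M.c' 2 ^ 2 * M.c 1 ^ 2 = Chain.Δ M.T M.z := by
    rw [Chain.Δ, T, z, Y]; ring
  have hΔ := (Chain.Δ_pos (T := M.T) hz).ne'
  simp only [C4Equation]
  rw [e, eq_div_iff hΔ, ← sub_eq_zero, Chain.star, Chain.Δ, T, z, Y]
  ring_nf

theorem eqB_iff : M.EqB ↔ Chain.polyB (M.c 1) (M.c 2) (M.c' 2) = 0 := by
  simp only [EqB, Chain.polyB]
  rw [sub_eq_zero, eq_comm]

theorem eqC_iff : M.EqC ↔ Chain.polyC (M.c 1) (M.c 2) (M.c' 2) (M.c 4) (M.c 5) = 0 := Iff.rfl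

theorem eqB'_iff : M.EqB' PolyTerm.exprF.toMvPolynomial ↔
    PolyTerm.exprF.eval ![M.c 1, M.c 2, M.c 3, M.c 4, M.c' 2] = 0 := by
  rw [EqB', PolyTerm.aeval_toMvPolynomial]

/-- If `c'₃ = c₃ ^ 2 / 2`, the vector `(c - c₂) (c' - c * c / 2)` vanishes at the first three
stages, and the moments show that it vanishes at the others. -/
theorem simplifying_iff (h : M.IsPairExceptLast) (hn : M.NonExceptional) :
    M.Simplifying ↔ M.EqA := by
  refine ⟨fun hs => hs 2 (by decide), fun hA => ?_⟩
  have hv := h.values hn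
  have hf := hv.bb.f5_ne (hv.bb.G_ne_zero hv.z_ne)
  have hb := hv.bb.b6_ne (hv.bb.G_ne_zero hv.z_ne)
  -- all moments of `(c - c₂) * (c' - c * c / 2)` vanish, and so do its first three entries
  have hw := ((h.vmoment_c'_mul_c.add (h.vmoment_c'.smul (-M.c 1))).add
    (h.vmoment_cube.smul (-1 / 2))).add (h.vmoment_sq.smul (M.c 1 / 2))
  obtain ⟨w, hwdef⟩ : ∃ w, w = M.c' * M.c + -M.c 1 • M.c' + (-1 / 2 : ℝ) • (M.c * M.c * M.c)
    + (M.c 1 / 2) • (M.c * M.c) := ⟨_, rfl⟩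
  have hwi : ∀ i, w i = (M.c i - M.c 1) * (M.c' i - M.c i ^ 2 / 2) := fun i => by
    rw [hwdef]
    simp only [Pi.add_apply, Pi.smul_apply, Pi.mul_apply, smul_eq_mul]
    ring
  have hm := h.moment (hw.congr hwdef (mf' := 0) (mb' := 0) (by ring) (by ring))
    (by rw [hwi, h.c_zero, h.c'_zero]; ring) (by rw [hwi]; ring)
    (by rw [hwi, hA]; ring)
  rw [show w 6 = 0 by rw [hwi, h.fsal.1, h.c'_six]; ring] at hm
  have h3 : w 3 = 0 := by
    have := hm.ρ_mul hf hb
    exact (mul_eq_zero.1 (show M.chain.ρ * w 3 = 0 by rw [this]; ring)).resolve_left hv.ρ_ne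
  have h4 : w 4 = 0 := by
    have := hm.f
    rw [h3] at this
    exact (mul_eq_zero.1 (show M.chain.f5 * w 4 = 0 by linear_combination this)).resolve_left hf
  have h5 : w 5 = 0 := by
    have := hm.b
    rw [h3, h4] at this
    exact (mul_eq_zero.1 (show M.chain.b6 * w 5 = 0 by linear_combination this)).resolve_left hb
  have key : ∀ i : Fin 7, (i = 3 ∨ i = 4 ∨ i = 5) → w i = 0 → M.c' i = M.c i ^ 2 / 2 := by
    intro i hi h0
    rw [hwi] at h0
    exact sub_eq_zero.1 ((mul_eq_zero.1 h0).resolve_left (sub_ne_zero.2 (hn.2.1 i hi).2.1))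
  intro i hi
  fin_cases i
  · simp [h.c'_zero, h.c_zero]
  · exact absurd rfl hi
  · exact hA
  · exact key 3 (Or.inl rfl) h3
  · exact key 4 (Or.inr (Or.inl rfl)) h4
  · exact key 5 (Or.inr (Or.inr rfl)) h5
  · simp only [Fin.reduceFinMk, h.c'_six, h.fsal.1]; norm_num

/-- The statements about a single non-exceptional almost-pair. -/
theorem classification (h : M.IsPairExceptLast) (hn : M.NonExceptional) :
    (M.C4Equation ∨ M.c 5 = 1) ∧
    (M.C4Equation → M.d 6 = 0 ∧ (M.LastCondition ↔ M.EqA ∨ M.EqB ∨ M.EqC)) ∧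
    (M.c 5 = 1 →
      (M.LastCondition ↔ M.EqA ∨ M.EqB' PolyTerm.exprF.toMvPolynomial)) ∧
    (M.Simplifying ↔ M.EqA) := by
  have hv := h.values hn
  have hG := hv.bb.G_ne_zero hv.z_ne
  refine ⟨?_, fun hs => ⟨?_, ?_⟩, fun h6 => ?_, h.simplifying_iff hn⟩
  · rw [c4Equation_iff h hn]
    by_cases h6 : M.c 5 = 1
    · exact Or.inr h6
    · exact Or.inl (hv.bb.star_eq_zero hG (Or.inr hv.z_ne) h6)
  · rw [c4Equation_iff h hn] at hs
    obtain ⟨t, -, -, h7⟩ := hv.bb.proportional hG (Or.inr hv.z_ne)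
    simp only [chain_d7, chain_c4, hs, mul_zero] at h7
    exact h7
  · rw [h.lastCondition_iff, hv.last_iff_of_star ((c4Equation_iff h hn).1 hs), eqB_iff, eqC_iff]
    rfl
  · rw [h.lastCondition_iff, hv.last_iff_of_c6 h6, eqB'_iff]
    rfl

/-- `d` is determined by `A` up to a scalar factor. -/
theorem d_unique (h : M.IsPairExceptLast) (h' : N.IsPairExceptLast) (hn : M.NonExceptional)
    (ha : M.a = N.a) : ∃ r : ℝ, r ≠ 0 ∧ N.d = r • M.d := by
  have hc : N.c = M.c := by rw [h.c_eq, h'.c_eq, ha]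
  have hc' : N.c' = M.c' := by rw [c', c', hc, ha]
  have hb : N.b = M.b := funext fun j => by rw [← h.fsal.2, ← h'.fsal.2, ha]
  have hn' : N.NonExceptional := by
    rw [NonExceptional, SubdiagonalNeZero, NodesGeneric] at hn ⊢
    rwa [hc, ← ha]
  have hx := h.c_one_ne hn
  have hu := h.c'_two_ne hn
  have hv := h.values hn
  have hv' := h'.values hn'
  have hT : N.T = M.T := by simp only [T, Y, hc, hc']
  have hz : N.z = M.z := by simp only [z, hc, hc']
  have hC : N.chain = { M.chain with
      d4 := N.chain.d4, d5 := N.chain.d5, d6 := N.chain.d6, d7 := N.chain.d7 } := by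
    simp only [chain, hc, hb, ha]
  have hbb := hv'.bb
  have hp' := hv'.p
  simp only [chain_c4, chain_c5, chain_c6, hT, hz, hc, hc'] at hbb hp'
  obtain ⟨r, hr, r4, r5, r6, r7⟩ := hv.bb.d_unique hbb (hv.bb.G_ne_zero hv.z_ne) (Or.inr hv.z_ne)
    hC hv.p hp' hv.p4 (h.d_ne hx hu) (h'.d_ne (hc ▸ hx) (hc' ▸ hu))
  refine ⟨r, hr, sub_eq_zero.1 (h.eq_zero_of_orthogonal hx hu ?_ ?_ ?_ ?_ ?_ ?_ ?_)⟩
  · rw [sub_dotProduct, smul_dotProduct, h.d_sum, h'.d_sum]; simp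
  · rw [sub_dotProduct, smul_dotProduct, h.vmoment_c.d, ← hc, h'.vmoment_c.d]; simp
  · rw [sub_dotProduct, smul_dotProduct, h.vmoment_c'.d, ← hc', h'.vmoment_c'.d]; simp
  · simpa [sub_eq_zero] using r4
  · simpa [sub_eq_zero] using r5
  · simpa [sub_eq_zero] using r6
  · simpa [sub_eq_zero] using r7

end IsPairExceptLast

end Tableau

theorem allPairs_eq_iUnion_family :
    allPairs = ⋃ k, family PolyTerm.exprF.toMvPolynomial k := by
  ext a
  rw [Set.mem_iUnion]
  constructor
  · rintro ⟨M, rfl', hM, hn⟩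
    obtain ⟨h1, h2, h3, -⟩ := hM.1.classification hn
    rcases h1 with h | h
    · rcases (h2 h).2.1 hM.2 with h' | h' | h'
      · exact ⟨.A, M, rfl', hM, hn, h, h'⟩
      · exact ⟨.B, M, rfl', hM, hn, h, h'⟩
      · exact ⟨.C, M, rfl', hM, hn, h, h'⟩
    · rcases (h3 h).1 hM.2 with h' | h'
      · exact ⟨.A', M, rfl', hM, hn, h, h'⟩
      · exact ⟨.B', M, rfl', hM, hn, h, h'⟩
  · rintro ⟨k, M, rfl', hM, hn, -⟩
    exact ⟨M, rfl', hM, hn⟩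

/-! ### Lipschitz functions on a set, and the dimension of zero sets -/

section Controlled

open Filter Topology Asymptotics

/-- A map `π` on a set, near a point `pt` of the space. -/
structure Projection (X E : Type*) where
  /-- the map -/
  π : X → E
  /-- the set on which the map is considered -/
  set : Set X
  /-- the point near which the map is considered -/
  pt : X

variable {X E : Type*} [NormedAddCommGroup X] [NormedAddCommGroup E]

/-- The filter of the neighbourhoods of the point within the set. -/
def Projection.nhds (D : Projection X E) : Filter X := 𝓝[D.set] D.pt

/-- Near the point of `D`, the restriction of the function `g` to the set of `D` is continuous at
the point, and its differences are bounded by a multiple of those of the map `π`; so `g` is a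
Lipschitz function of `π`. -/
@[fun_prop]
def Controlled (D : Projection X E) (g : X → ℝ) : Prop :=
  Tendsto g D.nhds (𝓝 (g D.pt)) ∧
    (fun w : X × X => g w.1 - g w.2) =O[D.nhds ×ˢ D.nhds] fun w => D.π w.1 - D.π w.2

namespace Controlled

variable {D : Projection X E} {f g h k : X → ℝ}

@[fun_prop]
theorem const (r : ℝ) : Controlled D fun _ => r :=
  ⟨tendsto_const_nhds, by simpa using isBigO_zero _ _⟩

@[fun_prop]
theorem add (hf : Controlled D f) (hg : Controlled D g) :
    Controlled D fun a => f a + g a :=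
  ⟨hf.1.add hg.1, (hf.2.add hg.2).congr_left fun w => by ring⟩

@[fun_prop]
theorem neg (hf : Controlled D f) : Controlled D fun a => -f a :=
  ⟨hf.1.neg, hf.2.neg_left.congr_left fun w => by ring⟩

@[fun_prop]
theorem sub (hf : Controlled D f) (hg : Controlled D g) :
    Controlled D fun a => f a - g a :=
  ⟨hf.1.sub hg.1, (hf.2.sub hg.2).congr_left fun w => by ring⟩

@[fun_prop]
theorem mul (hf : Controlled D f) (hg : Controlled D g) :
    Controlled D fun a => f a * g a := by
  refine ⟨hf.1.mul hg.1, ?_⟩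
  have h1 : (fun w : X × X => f w.1 * (g w.1 - g w.2)) =O[D.nhds ×ˢ D.nhds]
      fun w => D.π w.1 - D.π w.2 := by
    have := ((hf.1.comp tendsto_fst).isBigO_one ℝ (l := D.nhds ×ˢ D.nhds)).mul hg.2.norm_right
    simpa using this
  have h2 : (fun w : X × X => g w.2 * (f w.1 - f w.2)) =O[D.nhds ×ˢ D.nhds]
      fun w => D.π w.1 - D.π w.2 := by
    have := ((hg.1.comp tendsto_snd).isBigO_one ℝ (l := D.nhds ×ˢ D.nhds)).mul hf.2.norm_right
    simpa using this
  exact (h1.add h2).congr_left fun w => by ring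

@[fun_prop]
theorem pow (hf : Controlled D f) (n : ℕ) : Controlled D fun a => f a ^ n := by
  induction n with
  | zero => simpa using const 1
  | succ n ih => simpa only [pow_succ] using ih.mul hf

/-- A factor of a controlled product is controlled where the other factor is controlled and does
not vanish. -/
theorem of_mul_eq (hk : Controlled D k) (hh : Controlled D h) (hp : D.pt ∈ D.set)
    (h0 : h D.pt ≠ 0) (e : ∀ a ∈ D.set, g a * h a = k a) : Controlled D g := by
  have hS : ∀ᶠ a in D.nhds, a ∈ D.set := self_mem_nhdsWithin
  have hne : ∀ᶠ a in D.nhds, h a ≠ 0 := hh.1.eventually_ne h0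
  have hgk : ∀ a ∈ D.set, h a ≠ 0 → g a = k a / h a := fun a ha h1 => by
    rw [eq_div_iff h1, e a ha]
  constructor
  · rw [hgk D.pt hp h0]
    refine (hk.1.div hh.1 h0).congr' ?_
    filter_upwards [hS, hne] with a ha h1
    rw [hgk a ha h1]; rfl
  · have h1 : (fun w : X × X => (h w.1)⁻¹ * (k w.1 - k w.2)) =O[D.nhds ×ˢ D.nhds]
        fun w => D.π w.1 - D.π w.2 := by
      have := (((hh.1.inv₀ h0).comp tendsto_fst).isBigO_one ℝ
        (l := D.nhds ×ˢ D.nhds)).mul hk.2.norm_right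
      simpa using this
    have h2 : (fun w : X × X => (h w.1)⁻¹ * (k w.2 / h w.2) * (h w.1 - h w.2))
        =O[D.nhds ×ˢ D.nhds] fun w => D.π w.1 - D.π w.2 := by
      have := ((((hh.1.inv₀ h0).comp tendsto_fst).mul
        ((hk.1.div hh.1 h0).comp tendsto_snd)).isBigO_one ℝ
        (l := D.nhds ×ˢ D.nhds)).mul hh.2.norm_right
      simpa using this
    refine (h1.sub h2).congr' ?_ EventuallyEq.rfl
    filter_upwards [(hS.and hne).prod_mk (hS.and hne)] with w hw
    obtain ⟨⟨ha, h3⟩, hb, h4⟩ := hw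
    rw [hgk _ ha h3, hgk _ hb h4]
    field_simp
    ring

end Controlled

variable {π : X → E} {S : Set X}

/-- A set on which the identity is locally a Lipschitz function of `π` has at most the dimension of
its image under `π`. -/
theorem dimH_le_of_isBigO [SecondCountableTopology X]
    (h : ∀ p ∈ S, (fun w : X × X => w.1 - w.2) =O[𝓝[S] p ×ˢ 𝓝[S] p] fun w => π w.1 - π w.2) :
    dimH S ≤ dimH (π '' S) := by
  by_contra! hlt
  obtain ⟨p, hp, hd⟩ := exists_mem_nhdsWithin_lt_dimH_of_lt_dimH hlt
  obtain ⟨K, hK, hb⟩ := (h p hp).exists_pos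
  rw [IsBigOWith, eventually_iff, mem_prod_self_iff] at hb
  obtain ⟨t, ht, hts⟩ := hb
  have hanti : AntilipschitzWith K.toNNReal fun a : (t ∩ S : Set X) => π a := by
    refine AntilipschitzWith.of_le_mul_dist fun a b => ?_
    have := hts (Set.mk_mem_prod a.2.1 b.2.1)
    rw [Subtype.dist_eq, dist_eq_norm, dist_eq_norm, Real.coe_toNNReal K hK.le]
    exact this
  refine (hd (t ∩ S) (inter_mem ht self_mem_nhdsWithin)).not_ge ?_
  have h1 := hanti.le_dimH_image Set.univ
  have h2 := (isometry_subtype_coe (s := t ∩ S)).dimH_image Set.univ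
  rw [Set.image_univ, Subtype.range_coe] at h2
  rw [h2]
  refine h1.trans (dimH_mono ?_)
  rintro _ ⟨a, -, rfl⟩
  exact ⟨a, a.2.2, rfl⟩

end Controlled

section ZeroSet

open MvPolynomial Filter Topology Asymptotics

theorem MvPolynomial.hasStrictFDerivAt_eval {σ : Type*} [Fintype σ] (f : MvPolynomial σ ℝ)
    (v : σ → ℝ) : HasStrictFDerivAt (fun v => eval v f)
      (∑ j, eval v (pderiv j f) • ContinuousLinearMap.proj (R := ℝ) (φ := fun _ : σ => ℝ) j) v := by
  classical
  induction f using MvPolynomial.induction_on with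
  | C r => simpa using hasStrictFDerivAt_const r v
  | add f g hf hg =>
    simp only [map_add, add_smul, Finset.sum_add_distrib]
    exact hf.add hg
  | mul_X f i hf =>
    simp only [map_mul, eval_X]
    refine (hf.mul (hasStrictFDerivAt_apply i v)).congr_fderiv ?_
    ext w
    have e : ∀ x, w x * (eval v (if i = x then f else 0) + v i * eval v (pderiv x f)) =
        (if i = x then w x * eval v f else 0) + v i * (w x * eval v (pderiv x f)) := fun x => by
      split_ifs
      · ring
      · rw [map_zero]; ring
    simp [pderiv_X, Pi.single_apply, Finset.mul_sum, mul_comm, e, Finset.sum_add_distrib]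

theorem MvPolynomial.exists_pderiv_ne_zero {σ : Type*} [Fintype σ] {f : MvPolynomial σ ℝ}
    (hf : 0 < f.totalDegree) :
    ∃ i, pderiv i f ≠ 0 ∧ (pderiv i f).totalDegree < f.totalDegree := by
  classical
  obtain ⟨m, hm, i, hi⟩ : ∃ m ∈ f.support, ∃ i, m i ≠ 0 := by
    by_contra! h
    refine hf.ne' (Nat.le_zero.1 (Finset.sup_le fun m hm => ?_))
    rw [show m = 0 from Finsupp.ext (h m hm)]
    simp
  have hle : Finsupp.single i 1 ≤ m := by
    rw [Finsupp.single_le_iff]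
    exact Nat.one_le_iff_ne_zero.2 hi
  refine ⟨i, fun h0 => ?_, ?_⟩
  · have := congrArg (coeff (m - Finsupp.single i 1)) h0
    rw [coeff_pderiv, tsub_add_cancel_of_le hle, coeff_zero, mul_eq_zero] at this
    rcases this with h | h
    · exact (mem_support_iff.1 hm) h
    · exact absurd h (by positivity)
  · rw [totalDegree, Finset.sup_lt_iff hf]
    intro k hk
    rw [mem_support_iff, coeff_pderiv] at hk
    have := le_totalDegree (mem_support_iff.2 (left_ne_zero_of_mul hk))
    rw [Finsupp.sum_add_index' (fun _ => rfl) (fun _ _ _ => rfl),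
      Finsupp.sum_single_index rfl] at this
    exact this

/-- The zero set of a non-zero polynomial in `n + 1` variables has dimension at most `n`. -/
theorem MvPolynomial.dimH_zeroSet_le {n : ℕ} {f : MvPolynomial (Fin (n + 1)) ℝ} (hf : f ≠ 0) :
    dimH {v : Fin (n + 1) → ℝ | eval v f = 0} ≤ n := by
  induction hd : f.totalDegree using Nat.strong_induction_on generalizing f with
  | _ d ih =>
    subst hd
    rcases Nat.eq_zero_or_pos f.totalDegree with h0 | hpos
    · rw [totalDegree_eq_zero_iff_eq_C] at h0
      have : {v : Fin (n + 1) → ℝ | eval v f = 0} = ∅ := by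
        ext v
        rw [h0] at hf ⊢
        simpa using hf
      rw [this, dimH_empty]
      exact zero_le
    obtain ⟨i, hi, hlt⟩ := exists_pderiv_ne_zero hpos
    have hsub : {v : Fin (n + 1) → ℝ | eval v f = 0} ⊆
        {v | eval v (pderiv i f) = 0} ∪ {v | eval v f = 0 ∧ eval v (pderiv i f) ≠ 0} := by
      intro v hv
      by_cases h : eval v (pderiv i f) = 0
      · exact Or.inl h
      · exact Or.inr ⟨hv, h⟩
    refine (dimH_mono hsub).trans ?_
    rw [dimH_union]
    refine max_le (ih _ hlt hi rfl) ?_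
    set S := {v : Fin (n + 1) → ℝ | eval v f = 0 ∧ eval v (pderiv i f) ≠ 0} with hS
    -- where the partial derivative does not vanish, the other coordinates determine the point
    let π : (Fin (n + 1) → ℝ) → Fin n → ℝ := fun v j => v (i.succAbove j)
    have key : dimH S ≤ dimH (π '' S) := by
      refine dimH_le_of_isBigO fun p hp => ?_
      have hc : eval p (pderiv i f) ≠ 0 := hp.2
      let L := ∑ j, eval p (pderiv j f) •
        ContinuousLinearMap.proj (R := ℝ) (φ := fun _ : Fin (n + 1) => ℝ) j
      have hLv : ∀ d, L d = ∑ j, eval p (pderiv j f) * d j := fun d => by simp [L]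
      have hπ : ∀ j, (fun w : (Fin (n + 1) → ℝ) × (Fin (n + 1) → ℝ) => (π w.1 - π w.2) j)
          =O[𝓝[S] p ×ˢ 𝓝[S] p] fun w => π w.1 - π w.2 := isBigO_pi.1 (isBigO_refl _ _)
      have hL : (fun w : (Fin (n + 1) → ℝ) × (Fin (n + 1) → ℝ) => L (w.1 - w.2))
          =o[𝓝[S] p ×ˢ 𝓝[S] p] fun w => w.1 - w.2 := by
        have h1 := (hasStrictFDerivAt_eval f p).isLittleO.mono
          (show 𝓝[S] p ×ˢ 𝓝[S] p ≤ 𝓝 (p, p) by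
            rw [nhds_prod_eq]; exact prod_mono nhdsWithin_le_nhds nhdsWithin_le_nhds)
        refine h1.neg_left.congr' ?_ EventuallyEq.rfl
        have hself : ∀ᶠ a in 𝓝[S] p, a ∈ S := self_mem_nhdsWithin
        filter_upwards [hself.prod_mk hself] with w hw
        rw [hw.1.1, hw.2.1]
        simp [L]
      have hB : (fun w : (Fin (n + 1) → ℝ) × (Fin (n + 1) → ℝ) =>
          ((eval p (pderiv i f))⁻¹ * L (w.1 - w.2)) • (Pi.single i 1 : Fin (n + 1) → ℝ))
          =o[𝓝[S] p ×ˢ 𝓝[S] p] fun w => w.1 - w.2 := by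
        refine IsBigO.trans_isLittleO (IsBigO.of_bound
          (‖(eval p (pderiv i f))⁻¹‖ * ‖(Pi.single i 1 : Fin (n + 1) → ℝ)‖)
          (Eventually.of_forall fun w => ?_)) hL
        rw [norm_smul, norm_mul]
        exact le_of_eq (by ring)
      refine hB.right_isBigO_sub.trans ?_
      rw [isBigO_pi]
      intro j
      rcases Fin.eq_self_or_eq_succAbove i j with hj | ⟨j, rfl⟩
      · have : ∀ w : (Fin (n + 1) → ℝ) × (Fin (n + 1) → ℝ),
            (w.1 - w.2 - ((eval p (pderiv i f))⁻¹ * L (w.1 - w.2)) •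
              (Pi.single i 1 : Fin (n + 1) → ℝ)) i =
            ∑ j, -((eval p (pderiv i f))⁻¹ * eval p (pderiv (i.succAbove j) f)) *
              (π w.1 - π w.2) j := fun w => by
          rw [hLv, Fin.sum_univ_succAbove _ i]
          simp only [Pi.sub_apply, Pi.smul_apply, smul_eq_mul, Pi.single_eq_same, π, mul_one,
            mul_add, inv_mul_cancel_left₀ hc, sub_add_cancel_left, Finset.mul_sum, neg_mul,
            mul_assoc, Finset.sum_neg_distrib]
        rw [hj]
        simp only [this]
        exact IsBigO.fun_sum fun j _ => (hπ j).const_mul_left _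
      · refine (hπ j).congr_left fun w => ?_
        simp [π]
    exact key.trans ((dimH_mono (Set.subset_univ _)).trans (Real.dimH_univ_pi_fin n).le)

end ZeroSet

/-! ### The entries of `A` as Lipschitz functions -/

namespace Controlled

variable {X E : Type*} [NormedAddCommGroup X] [NormedAddCommGroup E]
  {D : Projection X E}

theorem congr {f g : X → ℝ} (hf : Controlled D f) (hp : D.pt ∈ D.set)
    (e : ∀ a ∈ D.set, g a = f a) : Controlled D g :=
  of_mul_eq hf (const 1) hp one_ne_zero fun a ha => by rw [mul_one, e a ha]

section Stage

variable {x y u T z c V W k : X → ℝ}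

@[fun_prop]
theorem stageN (hT : Controlled D T) (hz : Controlled D z) (hy : Controlled D y)
    (hc : Controlled D c) (hV : Controlled D V) (hW : Controlled D W) :
    Controlled D fun a => Chain.stageN (T a) (z a) (y a) (c a) (V a) (W a) := by
  unfold Chain.stageN
  fun_prop

/-- The value of `c'` at a stage is a Lipschitz function of the quantities in the form of the
stage. -/
theorem of_stageForm (hp : D.pt ∈ D.set) (hx : Controlled D x) (hy : Controlled D y)
    (hu : Controlled D u) (hT : Controlled D T) (hz : Controlled D z)
    (hc : Controlled D c) (hV : Controlled D V) (hW : Controlled D W)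
    (hu0 : ∀ a ∈ D.set, u a ≠ 0) (hp0 : ∀ a ∈ D.set, c a * (c a - x a) * (c a - y a) ≠ 0)
    (h : ∀ a ∈ D.set, ∃ τ,
      Chain.StageForm (x a) (y a) (u a) (T a) (z a) (c a) (V a) (W a) (k a) τ) :
    Controlled D k := by
  have hD : Controlled D fun a =>
      Chain.stageD (T a) (z a) (y a * (y a - x a)) (y a) (c a) (V a) (W a) := by
    unfold Chain.stageD
    fun_prop
  refine of_mul_eq (k := fun a => u a * (c a * (c a - x a)) *
    Chain.stageN (T a) (z a) (y a) (c a) (V a) (W a)) (by fun_prop) hD hp ?_ fun a ha => ?_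
  · obtain ⟨τ, h⟩ := h D.pt hp
    exact h.stageD_ne (hu0 D.pt hp) (hp0 D.pt hp)
  · obtain ⟨τ, h⟩ := h a ha
    exact h.k_mul (hu0 a ha) (hp0 a ha)

end Stage

end Controlled

namespace Tableau

namespace IsPairExceptLast

variable {M : Tableau}

/-- `c''₄` in terms of `c₄` and `v₄`: by `Backbone.proportional`, both `ρ v₄` and `ρ c''₄` are
explicit multiples of the same factor. -/
theorem c''_three_mul (h : M.IsPairExceptLast) (hn : M.NonExceptional) :
    M.c'' 3 * M.T = M.c 3 * M.v 3 := by
  have hb := h.backbone hn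
  have hv := h.values hn
  have hG := hb.G_ne_zero hv.z_ne
  obtain ⟨t, hD, hδ, h7⟩ := hb.proportional hG (Or.inr hv.z_ne)
  have e1 := hb.ρ_mul_v hG
  have e2 := h.moment_c''.ρ_mul (hb.f5_ne hG) (hb.b6_ne hG)
  rw [hD, hδ, h7, Chain.star] at e1 e2
  refine mul_left_cancel₀ hv.ρ_ne ?_
  simp only [chain_c4] at e1 e2 ⊢
  linear_combination M.T * e2 - M.c 3 * e1

end IsPairExceptLast

variable {E : Type*} [NormedAddCommGroup E] {D : Projection (Fin 7 → Fin 7 → ℝ) E}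
  {M : (Fin 7 → Fin 7 → ℝ) → Tableau}

/-- The entries of `A` are locally Lipschitz functions of the nodes and of the values of `c'` at the
stages `3` and `6`. -/
theorem controlled_entries (hp : D.pt ∈ D.set) (hM : ∀ a ∈ D.set, (M a).a = Matrix.of a)
    (hA : ∀ a ∈ D.set, (M a).IsPairExceptLast) (hN : ∀ a ∈ D.set, (M a).NonExceptional)
    (hx : Controlled D fun a => (M a).c 1) (hy : Controlled D fun a => (M a).c 2)
    (hu : Controlled D fun a => (M a).c' 2) (h3 : Controlled D fun a => (M a).c 3)
    (h4 : Controlled D fun a => (M a).c 4) (h5 : Controlled D fun a => (M a).c 5)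
    (hk5 : Controlled D fun a => (M a).c' 5) (i j : Fin 7) :
    Controlled D fun a => a i j := by
  have hx0 : ∀ a ∈ D.set, (M a).c 1 ≠ 0 := fun a ha => (hA a ha).c_one_ne (hN a ha)
  have hu0 : ∀ a ∈ D.set, (M a).c' 2 ≠ 0 := fun a ha => (hA a ha).c'_two_ne (hN a ha)
  have hG0 : ∀ a ∈ D.set, (M a).T + 5 * (M a).z ≠ 0 := fun a ha =>
    ((hA a ha).backbone (hN a ha)).G_ne_zero ((hA a ha).z_ne (hN a ha))
  have hp0 : ∀ a ∈ D.set, ∀ i, i = 3 ∨ i = 4 ∨ i = 5 → (M a).p i ≠ 0 :=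
    fun a ha i hi => (hN a ha).p_ne hi
  have hT0 : ∀ a ∈ D.set, (M a).T ≠ 0 := fun a ha => ((hA a ha).values (hN a ha)).forms.1
  have hT : Controlled D fun a => (M a).T := by
    unfold T Y
    fun_prop
  have hz : Controlled D fun a => (M a).z := by
    unfold z
    fun_prop
  have hk3 : Controlled D fun a => (M a).c' 3 :=
    .of_stageForm hp hx hy hu hT hz h3 (.const 1) h3 hu0
      (fun a ha => by rw [← p_apply]; exact hp0 a ha 3 (Or.inl rfl)) fun a ha => by
        obtain ⟨-, τ4, τ5, s4, -⟩ := ((hA a ha).values (hN a ha)).forms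
        exact ⟨τ4, s4⟩
  have hk4 : Controlled D fun a => (M a).c' 4 := by
    refine .of_stageForm hp hx hy hu hT hz h4
      (V := fun a => Chain.V5 (M a).T (M a).z ((M a).c 3))
      (W := fun a => Chain.E5 (M a).T (M a).z ((M a).c 3) ((M a).c 4))
      (by unfold Chain.V5; fun_prop) (by unfold Chain.E5; fun_prop) hu0
      (fun a ha => by rw [← p_apply]; exact hp0 a ha 4 (Or.inr (Or.inl rfl))) fun a ha => by
        obtain ⟨-, τ4, τ5, -, s5, -⟩ := ((hA a ha).values (hN a ha)).forms
        exact ⟨τ5, s5⟩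
  have hv3 : Controlled D fun a => (M a).v 3 := by
    simp only [v_apply, Y]
    fun_prop
  have hp3 : Controlled D fun a => (M a).p 3 := by
    simp only [p_apply]
    fun_prop
  have hp4 : Controlled D fun a => (M a).p 4 := by
    simp only [p_apply]
    fun_prop
  have hp5 : Controlled D fun a => (M a).p 5 := by
    simp only [p_apply]
    fun_prop
  have hv0 : ∀ a ∈ D.set, (M a).v 3 ≠ 0 := fun a ha =>
    ((hA a ha).backbone (hN a ha)).v4_ne (hG0 a ha)
  have hf50 : ∀ a ∈ D.set, (M a).chain.f5 ≠ 0 := fun a ha =>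
    ((hA a ha).backbone (hN a ha)).f5_ne (hG0 a ha)
  have hb50 : ∀ a ∈ D.set, (M a).b 5 ≠ 0 := fun a ha =>
    ((hA a ha).backbone (hN a ha)).b6_ne (hG0 a ha)
  have h34 : ∀ a ∈ D.set, (M a).c 3 - (M a).c 4 ≠ 0 := fun a ha => sub_ne_zero.2 (hN a ha).2.2.1
  have h35 : ∀ a ∈ D.set, (M a).c 3 - (M a).c 5 ≠ 0 := fun a ha => sub_ne_zero.2 (hN a ha).2.2.2.1
  have h45 : ∀ a ∈ D.set, (M a).c 4 - (M a).c 5 ≠ 0 := fun a ha => sub_ne_zero.2 (hN a ha).2.2.2.2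
  -- the rows `f = b A` and `b`
  have hf4 : Controlled D fun a => (M a).chain.f4 := by
    refine .of_mul_eq (k := fun a => (3 * (M a).T + 10 * (M a).z) * (1 / 120) -
        (M a).c 4 * (((M a).T + 4 * (M a).z) * (1 / 24))) (by fun_prop)
      (h := fun a => (M a).v 3 * ((M a).c 3 - (M a).c 4)) (by fun_prop) hp
      (mul_ne_zero (hv0 D.pt hp) (h34 D.pt hp)) fun a ha => ?_
    have e1 := ((hA a ha).backbone (hN a ha)).v.f
    have e2 := ((hA a ha).backbone (hN a ha)).cv.f
    simp only [chain_c4, chain_c5] at e1 e2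
    linear_combination e2 - (M a).c 4 * e1
  have hf5 : Controlled D fun a => (M a).chain.f5 := by
    refine .of_mul_eq (k := fun a => 1 / 20 - ((M a).c 1 + (M a).c 2) * (1 / 12)
        + (M a).c 1 * (M a).c 2 * (1 / 6) - (M a).chain.f4 * (M a).p 3) (by fun_prop)
      hp4 hp (hp0 D.pt hp 4 (Or.inr (Or.inl rfl))) fun a ha => ?_
    linear_combination (hA a ha).moment_p.f
  have hb3 : Controlled D fun a => (M a).b 3 := by
    refine .of_mul_eq (k := fun a => (2 * (M a).T + 5 * (M a).z) * (1 / 20)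
        - ((M a).c 4 + (M a).c 5) * ((3 * (M a).T + 8 * (M a).z) * (1 / 24))
        + (M a).c 4 * (M a).c 5 * (((M a).T + 3 * (M a).z) * (1 / 6))) (by fun_prop)
      (h := fun a => (M a).v 3 * (((M a).c 3 - (M a).c 4) * ((M a).c 3 - (M a).c 5)))
      (by fun_prop) hp (mul_ne_zero (hv0 D.pt hp) (mul_ne_zero (h34 D.pt hp) (h35 D.pt hp)))
      fun a ha => ?_
    have := ((hA a ha).backbone (hN a ha)).weights.1
    simp only [chain_c4, chain_c5, chain_c6, chain_b4] at this
    linear_combination this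
  have hb4 : Controlled D fun a => (M a).b 4 := by
    refine .of_mul_eq (k := fun a => (1 / 4 - ((M a).c 1 + (M a).c 2) * (1 / 3)
          + (M a).c 1 * (M a).c 2 * (1 / 2)) * (1 - (M a).c 5)
        - (1 / 20 - ((M a).c 1 + (M a).c 2) * (1 / 12) + (M a).c 1 * (M a).c 2 * (1 / 6))
        - (M a).b 3 * (M a).p 3 * ((M a).c 3 - (M a).c 5)) (by fun_prop)
      (h := fun a => (M a).p 4 * ((M a).c 4 - (M a).c 5)) (by fun_prop) hp
      (mul_ne_zero (hp0 D.pt hp 4 (Or.inr (Or.inl rfl))) (h45 D.pt hp)) fun a ha => ?_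
    have e1 := (hA a ha).moment_p.b
    have e2 := (hA a ha).moment_p.bc
    simp only [chain_c4, chain_c5, chain_c6, chain_b4, chain_b5, chain_b6] at e1 e2
    linear_combination e2 - (M a).c 5 * e1
  have hb5 : Controlled D fun a => (M a).b 5 := by
    refine .of_mul_eq (k := fun a => 1 / 4 - ((M a).c 1 + (M a).c 2) * (1 / 3)
          + (M a).c 1 * (M a).c 2 * (1 / 2) - (M a).b 3 * (M a).p 3 - (M a).b 4 * (M a).p 4)
      (by fun_prop) hp5 hp (hp0 D.pt hp 5 (Or.inr (Or.inr rfl))) fun a ha => ?_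
    have e1 := (hA a ha).moment_p.b
    simp only [chain_b4, chain_b5, chain_b6] at e1
    linear_combination e1
  have hb2 : Controlled D fun a => (M a).b 2 := by
    refine .of_mul_eq (k := fun a => 1 / 6 - (M a).b 3 * (M a).c' 3 - (M a).b 4 * (M a).c' 4
        - (M a).b 5 * (M a).c' 5) (by fun_prop) hu hp (hu0 D.pt hp) fun a ha => ?_
    have e1 := (hA a ha).vmoment_c'.b
    rw [dotProduct, Fin.sum_univ_seven, (hA a ha).b_six, (hA a ha).c'_zero, (hA a ha).c'_one] at e1
    linear_combination e1
  have hb1 : Controlled D fun a => (M a).b 1 := by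
    refine .of_mul_eq (k := fun a => 1 / 2 - (M a).b 2 * (M a).c 2 - (M a).b 3 * (M a).c 3
        - (M a).b 4 * (M a).c 4 - (M a).b 5 * (M a).c 5) (by fun_prop) hx hp (hx0 D.pt hp)
      fun a ha => ?_
    have e1 := (hA a ha).b_dot_c
    rw [dotProduct, Fin.sum_univ_seven, (hA a ha).b_six, (hA a ha).c_zero] at e1
    linear_combination e1
  have hb0 : Controlled D fun a => (M a).b 0 := by
    refine .congr (f := fun a => 1 - (M a).b 1 - (M a).b 2 - (M a).b 3 - (M a).b 4 - (M a).b 5)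
      (by fun_prop) hp fun a ha => ?_
    have e1 := (hA a ha).b_sum
    rw [dotProduct, Fin.sum_univ_seven, (hA a ha).b_six] at e1
    simp only [Pi.one_apply] at e1
    linear_combination e1
  -- the subdiagonal part of `A`
  have ha43 : Controlled D fun a => (M a).a 4 3 := by
    refine .of_mul_eq (k := fun a => ((M a).T + 5 * (M a).z) * (1 / 120)) (by fun_prop)
      (h := fun a => (M a).chain.f5 * (M a).v 3) (by fun_prop) hp
      (mul_ne_zero (hf50 D.pt hp) (hv0 D.pt hp)) fun a ha => ?_
    have := ((hA a ha).backbone (hN a ha)).r.f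
    simp only [chain_a54] at this
    linear_combination this
  have ha54 : Controlled D fun a => (M a).a 5 4 :=
    .of_mul_eq hf5 hb5 hp (hb50 D.pt hp) fun a ha => by
      simp only [Chain.f5, chain_a65, chain_b6]; ring
  have ha53 : Controlled D fun a => (M a).a 5 3 := by
    refine .of_mul_eq (k := fun a => (M a).chain.f4 - (M a).b 4 * (M a).a 4 3) (by fun_prop) hb5 hp
      (hb50 D.pt hp) fun a ha => ?_
    simp only [Chain.f4, chain_a64, chain_a54, chain_b5, chain_b6]; ring
  -- the vector `c''`
  have hs3 : Controlled D fun a => (M a).c'' 3 :=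
    .of_mul_eq (h3.mul hv3) hT hp (hT0 D.pt hp) fun a ha => (hA a ha).c''_three_mul (hN a ha)
  have hs4 : Controlled D fun a => (M a).c'' 4 := by
    refine .of_mul_eq (k := fun a => 1 / 120 - (M a).chain.f4 * (M a).c'' 3) (by fun_prop) hf5 hp
      (hf50 D.pt hp) fun a ha => ?_
    linear_combination (hA a ha).moment_c''.f
  have hs5 : Controlled D fun a => (M a).c'' 5 := by
    refine .of_mul_eq (k := fun a => 1 / 24 - (M a).b 3 * (M a).c'' 3 - (M a).b 4 * (M a).c'' 4)
      (by fun_prop) hb5 hp (hb50 D.pt hp) fun a ha => ?_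
    have := (hA a ha).moment_c''.b
    simp only [chain_b4, chain_b5, chain_b6] at this
    linear_combination this
  -- the remaining entries, row by row
  have ha32 : Controlled D fun a => (M a).a 3 2 :=
    .of_mul_eq hs3 hu hp (hu0 D.pt hp) fun a ha => (hA a ha).c''_three.symm
  have ha42 : Controlled D fun a => (M a).a 4 2 := by
    refine .of_mul_eq (k := fun a => (M a).c'' 4 - (M a).a 4 3 * (M a).c' 3) (by fun_prop) hu hp
      (hu0 D.pt hp) fun a ha => ?_
    linear_combination -(hA a ha).c''_four
  have ha52 : Controlled D fun a => (M a).a 5 2 := by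
    refine .of_mul_eq (k := fun a => (M a).c'' 5 - (M a).a 5 3 * (M a).c' 3
      - (M a).a 5 4 * (M a).c' 4) (by fun_prop) hu hp (hu0 D.pt hp) fun a ha => ?_
    linear_combination -(hA a ha).c''_five
  have ha21 : Controlled D fun a => (M a).a 2 1 :=
    .of_mul_eq hu hx hp (hx0 D.pt hp) fun a ha => (hA a ha).c'_two.symm
  have ha31 : Controlled D fun a => (M a).a 3 1 := by
    refine .of_mul_eq (k := fun a => (M a).c' 3 - (M a).a 3 2 * (M a).c 2) (by fun_prop) hx hp
      (hx0 D.pt hp) fun a ha => ?_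
    rw [c', (hA a ha).mulVec_three, (hA a ha).c_zero]; ring
  have ha41 : Controlled D fun a => (M a).a 4 1 := by
    refine .of_mul_eq (k := fun a => (M a).c' 4 - (M a).a 4 2 * (M a).c 2
      - (M a).a 4 3 * (M a).c 3) (by fun_prop) hx hp (hx0 D.pt hp) fun a ha => ?_
    rw [c', (hA a ha).mulVec_four, (hA a ha).c_zero]; ring
  have ha51 : Controlled D fun a => (M a).a 5 1 := by
    refine .of_mul_eq (k := fun a => (M a).c' 5 - (M a).a 5 2 * (M a).c 2
      - (M a).a 5 3 * (M a).c 3 - (M a).a 5 4 * (M a).c 4) (by fun_prop) hx hp (hx0 D.pt hp)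
      fun a ha => ?_
    rw [c', (hA a ha).mulVec_five, (hA a ha).c_zero]; ring
  have ha10 : Controlled D fun a => (M a).a 1 0 := by
    refine .congr hx hp fun a ha => ?_
    rw [(hA a ha).c_eq, (hA a ha).mulVec_one, Pi.one_apply, mul_one]
  have ha20 : Controlled D fun a => (M a).a 2 0 := by
    refine .congr (hy.sub ha21) hp fun a ha => ?_
    rw [(hA a ha).c_eq, (hA a ha).mulVec_two, Pi.one_apply, Pi.one_apply]; ring
  have ha30 : Controlled D fun a => (M a).a 3 0 := by
    refine .congr ((h3.sub ha31).sub ha32) hp fun a ha => ?_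
    rw [(hA a ha).c_eq, (hA a ha).mulVec_three]; simp only [Pi.one_apply]; ring
  have ha40 : Controlled D fun a => (M a).a 4 0 := by
    refine .congr (((h4.sub ha41).sub ha42).sub ha43) hp fun a ha => ?_
    rw [(hA a ha).c_eq, (hA a ha).mulVec_four]; simp only [Pi.one_apply]; ring
  have ha50 : Controlled D fun a => (M a).a 5 0 := by
    refine .congr ((((h5.sub ha51).sub ha52).sub ha53).sub ha54) hp fun a ha => ?_
    rw [(hA a ha).c_eq, (hA a ha).mulVec_five]; simp only [Pi.one_apply]; ring
  have hrow : ∀ j, Controlled D (fun a => (M a).b j) → Controlled D fun a => (M a).a 6 j :=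
    fun j hj => hj.congr hp fun a ha => (hA a ha).fsal.2 j
  refine Controlled.congr (f := fun a => (M a).a i j) ?_ hp fun a ha => by rw [hM a ha]; rfl
  rcases le_or_gt i j with hij | hij
  · exact (Controlled.const 0).congr hp fun a ha => (hA a ha).explicit i j hij
  · fin_cases i <;> fin_cases j <;> first
      | exact absurd hij (by decide)
      | assumption
      | exact hrow _ (by assumption)

end Tableau

/-! ### The families have dimension at most `4` -/

open Filter Topology Asymptotics in
/-- A coordinate of `π` that is continuous is controlled. -/
theorem Controlled.of_apply {X ι : Type*} [NormedAddCommGroup X] [Fintype ι]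
    {D : Projection X (ι → ℝ)} {g g₀ : X → ℝ} (hp : D.pt ∈ D.set) (i : ι)
    (h : ∀ a, g a = D.π a i) (h₀ : Continuous g₀) (e : ∀ a ∈ D.set, g a = g₀ a) :
    Controlled D g := by
  constructor
  · rw [e _ hp]
    refine (h₀.continuousWithinAt (s := D.set) (x := D.pt)).congr' ?_
    filter_upwards [self_mem_nhdsWithin] with a ha
    exact (e a ha).symm
  · refine IsBigO.of_bound 1 (Eventually.of_forall fun w => ?_)
    rw [h, h, one_mul, ← Pi.sub_apply]
    exact norm_le_pi_norm _ i

namespace Tableau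

variable {S : Set (Fin 7 → Fin 7 → ℝ)} {M : (Fin 7 → Fin 7 → ℝ) → Tableau}

/-- A node that is a coordinate of `π` is controlled. -/
theorem controlled_c {π : (Fin 7 → Fin 7 → ℝ) → Fin 5 → ℝ} {p : Fin 7 → Fin 7 → ℝ} (hp : p ∈ S)
    (hM : ∀ a ∈ S, (M a).a = Matrix.of a) (hA : ∀ a ∈ S, (M a).IsPairExceptLast) (i : Fin 7)
    (j : Fin 5) (h : ∀ a, (M a).c i = π a j) : Controlled ⟨π, S, p⟩ fun a => (M a).c i := by
  refine .of_apply (D := ⟨π, S, p⟩) (g₀ := fun a => (Matrix.of a *ᵥ 1) i) hp j h ?_ fun a ha => ?_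
  · exact (continuous_apply i).comp (Continuous.matrix_mulVec continuous_id continuous_const)
  · rw [← (hA a ha).rowSum, hM a ha]

/-- A value of `c'` that is a coordinate of `π` is controlled. -/
theorem controlled_c' {π : (Fin 7 → Fin 7 → ℝ) → Fin 5 → ℝ} {p : Fin 7 → Fin 7 → ℝ} (hp : p ∈ S)
    (hM : ∀ a ∈ S, (M a).a = Matrix.of a) (hA : ∀ a ∈ S, (M a).IsPairExceptLast) (i : Fin 7)
    (j : Fin 5) (h : ∀ a, (M a).c' i = π a j) : Controlled ⟨π, S, p⟩ fun a => (M a).c' i := by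
  refine .of_apply (D := ⟨π, S, p⟩) (g₀ := fun a => (Matrix.of a *ᵥ (Matrix.of a *ᵥ 1)) i) hp j h
    ?_ fun a ha => ?_
  · exact (continuous_apply i).comp (Continuous.matrix_mulVec continuous_id
      (Continuous.matrix_mulVec continuous_id continuous_const))
  · rw [c', ← (hA a ha).rowSum, hM a ha]

open Asymptotics in
/-- A set of matrices whose entries are locally Lipschitz functions of five parameters that satisfy
a polynomial equation has dimension at most `4`. -/
theorem dimH_le_four_of_controlled {π : (Fin 7 → Fin 7 → ℝ) → Fin 5 → ℝ}
    {f : MvPolynomial (Fin 5) ℝ} (hf : f ≠ 0) (h0 : ∀ a ∈ S, MvPolynomial.eval (π a) f = 0)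
    (h : ∀ p ∈ S, ∀ i j, Controlled ⟨π, S, p⟩ fun a => a i j) : dimH S ≤ 4 := by
  refine (dimH_le_of_isBigO (π := π) fun p hp => ?_).trans
    ((dimH_mono ?_).trans (MvPolynomial.dimH_zeroSet_le hf))
  · rw [isBigO_pi]
    intro i
    rw [isBigO_pi]
    intro j
    exact (h p hp i j).2
  · rintro _ ⟨a, ha, rfl⟩
    exact h0 a ha

/-- The almost-pairs that satisfy the equation for `c₄` and a further equation between `c₂, c₃, c₅,
c₆, c'₃` form a set of dimension at most `4`. -/
theorem dimH_le_four_of_c4Equation {f : MvPolynomial (Fin 5) ℝ} (hf : f ≠ 0)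
    (h : ∀ a ∈ S, ∃ M : Tableau, M.a = Matrix.of a ∧ M.IsPairExceptLast ∧ M.NonExceptional ∧
      M.C4Equation ∧ MvPolynomial.eval ![M.c 1, M.c 2, M.c 4, M.c 5, M.c' 2] f = 0) :
    dimH S ≤ 4 := by
  have : Nonempty Tableau := ⟨⟨0, 0, 0, 0⟩⟩
  choose! M hM hA hN hs hf0 using h
  refine dimH_le_four_of_controlled hf hf0 fun p hp => ?_
  set π := fun a => ![(M a).c 1, (M a).c 2, (M a).c 4, (M a).c 5, (M a).c' 2] with hπ
  have hx := controlled_c (π := π) hp hM hA 1 0 fun a => rfl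
  have hy := controlled_c (π := π) hp hM hA 2 1 fun a => rfl
  have h4 := controlled_c (π := π) hp hM hA 4 2 fun a => rfl
  have h5 := controlled_c (π := π) hp hM hA 5 3 fun a => rfl
  have hu := controlled_c' (π := π) hp hM hA 2 4 fun a => rfl
  have hz : Controlled ⟨π, S, p⟩ fun a => (M a).z := by
    unfold z
    fun_prop
  have hT : Controlled ⟨π, S, p⟩ fun a => (M a).T := by
    unfold T Y
    fun_prop
  have hst : ∀ a ∈ S, Chain.star (M a).T (M a).z ((M a).c 3) = 0 := fun a ha =>
    ((hA a ha).c4Equation_iff (hN a ha)).1 (hs a ha)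
  have h3 : Controlled ⟨π, S, p⟩ fun a => (M a).c 3 := by
    refine .of_mul_eq (k := fun a => -((M a).T * (M a).z))
      (h := fun a => Chain.Δ (M a).T (M a).z) (by fun_prop) ?_ hp
      (Chain.Δ_pos ((hA p hp).z_ne (hN p hp))).ne' fun a ha => ?_
    · unfold Chain.Δ
      fun_prop
    · have := hst a ha
      rw [Chain.star] at this
      rw [Chain.Δ]
      linear_combination this
  have hk5 : Controlled ⟨π, S, p⟩ fun a => (M a).c' 5 := by
    refine .of_stageForm hp hx hy hu hT hz h5 (V := fun a => -Chain.W (M a).T (M a).z)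
      (W := fun a => (M a).z * (20 * (M a).z * (M a).c 5 + 3 * (M a).T))
      (by unfold Chain.W; fun_prop) (by fun_prop)
      (fun a ha => (hA a ha).c'_two_ne (hN a ha))
      (fun a ha => by rw [← p_apply]; exact (hN a ha).p_ne (Or.inr (Or.inr rfl))) fun a ha => ?_
    obtain ⟨-, -, τ, -, -, s6, -⟩ := ((hA a ha).values (hN a ha)).forms_of_star (hst a ha)
    exact ⟨τ, s6⟩
  exact controlled_entries hp hM hA hN hx hy hu h3 h4 h5 hk5

/-- The almost-pairs that satisfy `c₆ = 1` and a further equation between `c₂, c₃, c₄, c₅, c'₃`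
form a set of dimension at most `4`. -/
theorem dimH_le_four_of_c6 {f : MvPolynomial (Fin 5) ℝ} (hf : f ≠ 0)
    (h : ∀ a ∈ S, ∃ M : Tableau, M.a = Matrix.of a ∧ M.IsPairExceptLast ∧ M.NonExceptional ∧
      M.c 5 = 1 ∧ MvPolynomial.eval ![M.c 1, M.c 2, M.c 3, M.c 4, M.c' 2] f = 0) :
    dimH S ≤ 4 := by
  have : Nonempty Tableau := ⟨⟨0, 0, 0, 0⟩⟩
  choose! M hM hA hN hs hf0 using h
  refine dimH_le_four_of_controlled hf hf0 fun p hp => ?_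
  set π := fun a => ![(M a).c 1, (M a).c 2, (M a).c 3, (M a).c 4, (M a).c' 2] with hπ
  have hx := controlled_c (π := π) hp hM hA 1 0 fun a => rfl
  have hy := controlled_c (π := π) hp hM hA 2 1 fun a => rfl
  have h3 := controlled_c (π := π) hp hM hA 3 2 fun a => rfl
  have h4 := controlled_c (π := π) hp hM hA 4 3 fun a => rfl
  have hu := controlled_c' (π := π) hp hM hA 2 4 fun a => rfl
  have hz : Controlled ⟨π, S, p⟩ fun a => (M a).z := by
    unfold z
    fun_prop
  have hT : Controlled ⟨π, S, p⟩ fun a => (M a).T := by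
    unfold T Y
    fun_prop
  have h5 : Controlled ⟨π, S, p⟩ fun a => (M a).c 5 := (Controlled.const 1).congr hp hs
  have hk5 : Controlled ⟨π, S, p⟩ fun a => (M a).c' 5 := by
    refine .of_stageForm hp hx hy hu hT hz h5
      (V := fun a => Chain.V6 (M a).T (M a).z ((M a).c 3) ((M a).c 4))
      (W := fun a => Chain.E6 (M a).T (M a).z ((M a).c 3) ((M a).c 4))
      (by unfold Chain.V6; fun_prop) (by unfold Chain.E6; fun_prop)
      (fun a ha => (hA a ha).c'_two_ne (hN a ha))
      (fun a ha => by rw [← p_apply]; exact (hN a ha).p_ne (Or.inr (Or.inr rfl))) fun a ha => ?_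
    obtain ⟨-, -, τ, -, -, s6, -⟩ := ((hA a ha).values (hN a ha)).forms_of_c6 (hs a ha)
    exact ⟨τ, s6⟩
  exact controlled_entries hp hM hA hN hx hy hu h3 h4 h5 hk5

end Tableau

section UpperBound

open MvPolynomial

theorem dimH_family_le (k : PairType) : dimH (family PolyTerm.exprF.toMvPolynomial k) ≤ 4 := by
  -- the polynomials of types A, B, C do not vanish at `c₃ = 1` if the other variables are `0`
  have hsq : (2 * X 4 - X 1 ^ 2 : MvPolynomial (Fin 5) ℝ) ≠ 0 := fun h => by
    have := congrArg (eval fun i : Fin 5 => if i = 1 then 1 else 0) h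
    norm_num [Fin.ext_iff] at this
  have hA : ∀ M : Tableau, M.EqA → 2 * M.c' 2 - M.c 2 ^ 2 = 0 := fun M h => by
    rw [Tableau.EqA] at h
    rw [h]; ring
  cases k with
  | A =>
    refine Tableau.dimH_le_four_of_c4Equation hsq ?_
    rintro a ⟨M, hM, hP, hN, h4, h⟩
    exact ⟨M, hM, hP.1, hN, h4, by simpa using hA M h⟩
  | B =>
    refine Tableau.dimH_le_four_of_c4Equation (f := 3 * (X 1 - X 0) * (X 0 + X 1 - 4 * X 0 * X 1)
      - X 4 * (2 * (3 - 12 * X 0 + 10 * X 0 ^ 2))) (fun h => ?_) ?_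
    · have := congrArg (eval fun i : Fin 5 => if i = 1 then 1 else 0) h
      norm_num [Fin.ext_iff] at this
    · rintro a ⟨M, hM, hP, hN, h4, h⟩
      refine ⟨M, hM, hP.1, hN, h4, ?_⟩
      simp only [Tableau.EqB] at h
      simp [h]
  | C =>
    obtain ⟨f, hf⟩ : ∃ f : MvPolynomial (Fin 5) ℝ, ∀ x y b c u : ℝ,
        eval ![x, y, b, c, u] f = Chain.polyC x y u b c := by
      let Z : MvPolynomial (Fin 5) ℝ → MvPolynomial (Fin 5) ℝ → MvPolynomial (Fin 5) ℝ →
          MvPolynomial (Fin 5) ℝ := fun α₀ α₁ α₂ => α₀ - α₁ * (X 2 + X 3) + α₂ * (X 2 * X 3)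
      refine ⟨(3 * Z 12 15 20 - 3 * (X 0 + X 1) * Z 33 40 50 + 2 * X 0 * X 1 * Z 138 165 200) *
          (X 1 ^ 2 * (X 1 - X 0) ^ 2)
        - ((12 + 50 * X 0 ^ 2) * (Z 12 15 20 - X 1 * Z 33 40 50) - 3 * X 0 * Z 207 260 350
          + 2 * X 0 * X 1 * Z 852 1035 1300) * (X 4 * X 1 * (X 1 - X 0))
        + ((2 + 10 * X 0 * X 1) * Z 12 15 20 - 15 * X 0 * Z 3 4 6 - 2 * X 1 * Z 33 40 50) *
          (2 * (3 - 12 * X 0 + 10 * X 0 ^ 2) * X 4 ^ 2), fun x y b c u => ?_⟩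
      simp [Z, Chain.polyC]
    refine Tableau.dimH_le_four_of_c4Equation (f := f) (fun h => ?_) ?_
    · have := hf 0 1 0 0 0
      rw [h] at this
      norm_num [Chain.polyC] at this
    · rintro a ⟨M, hM, hP, hN, h4, h⟩
      exact ⟨M, hM, hP.1, hN, h4, (hf _ _ _ _ _).trans h⟩
  | A' =>
    refine Tableau.dimH_le_four_of_c6 hsq ?_
    rintro a ⟨M, hM, hP, hN, h4, h⟩
    exact ⟨M, hM, hP.1, hN, h4, by simpa using hA M h⟩
  | B' =>
    refine Tableau.dimH_le_four_of_c6 (f := map (algebraMap ℚ ℝ) PolyTerm.exprF.toMvPolynomial)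
      (fun h => ?_) ?_
    · have h0 : PolyTerm.exprF.toMvPolynomial = 0 :=
        map_injective _ (algebraMap ℚ ℝ).injective (h.trans (map_zero _).symm)
      have := PolyTerm.degreeOf_exprF.1
      rw [h0, degreeOf_zero] at this
      exact absurd this (by norm_num)
    · rintro a ⟨M, hM, hP, hN, h4, h⟩
      refine ⟨M, hM, hP.1, hN, h4, ?_⟩
      rw [eval_map]
      exact h

end UpperBound

/-! ### Tableaux from chains -/

namespace Tableau

/-- Converse of `IsPairExceptLast.moment`. -/
theorem vmoment_of_moment {M : Tableau} (he : M.IsExplicit) (hb : M.b 6 = 0) {w : Fin 7 → ℝ}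
    {w4 w5 w6 w7 mf mb : ℝ} (h : M.chain.Moment w4 w5 w6 w7 mf mb) (h0 : w 0 = 0) (h1 : w 1 = 0)
    (h2 : w 2 = 0) (h3 : w 3 = w4) (h4 : w 4 = w5) (h5 : w 5 = w6) (h6 : w 6 = w7) :
    M.VMoment w mf mb where
  f := by
    rw [← h.f, dotProduct, Fin.sum_univ_seven, he.mulVec_zero, he.mulVec_one, he.mulVec_two,
      he.mulVec_three, he.mulVec_four, he.mulVec_five, hb, h0, h1, h2, h3, h4]
    simp only [Chain.f4, Chain.f5, chain]
    ring
  b := by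
    rw [← h.b, dotProduct, Fin.sum_univ_seven, hb, h0, h1, h2, h3, h4, h5]
    simp only [chain]
    ring
  bc := by
    rw [← h.bc, dotProduct, Fin.sum_univ_seven, hb]
    simp only [chain, Pi.mul_apply, h0, h1, h2, h3, h4, h5]
    ring
  d := by
    rw [← h.d, dotProduct, Fin.sum_univ_seven, h0, h1, h2, h3, h4, h5, h6]
    simp only [chain]
    ring

/-- The order conditions follow from those of `1`, `c`, `c'` and from the moments of `v`, `v * c`,
`A v`, `q` and `c''`, which span the other vectors together with `c` and `c'`. -/
theorem isPairExceptLast_of_vmoment {M : Tableau} (he : M.IsExplicit) (hr : M.RowSum)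
    (hs : M.IsFSAL) (hu : M.c' 2 ≠ 0) (hd : M.d ≠ 0) (b1 : M.b ⬝ᵥ 1 = 1) (b2 : M.b ⬝ᵥ M.c = 1 / 2)
    (b3 : M.b ⬝ᵥ M.c' = 1 / 6) (d1 : M.d ⬝ᵥ 1 = 0) (d2 : M.d ⬝ᵥ M.c = 0) (d3 : M.d ⬝ᵥ M.c' = 0)
    (hv : M.VMoment M.v ((M.T + 4 * M.z) / 24) ((M.T + 3 * M.z) / 6))
    (hvc : M.VMoment (M.v * M.c) ((3 * M.T + 10 * M.z) / 120) ((3 * M.T + 8 * M.z) / 24))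
    (hAv : M.VMoment (M.a *ᵥ M.v) ((M.T + 5 * M.z) / 120) ((M.T + 4 * M.z) / 24))
    (hq : M.VMoment M.q (1 / 40 - M.c 2 / 24) (1 / 8 - M.c 2 / 6))
    (hs' : M.VMoment M.c'' (1 / 120) (1 / 24)) : M.IsPairExceptLast := by
  have esq : M.c * M.c = (M.c' 2)⁻¹ • (M.Y • M.c' + M.z • M.c + (-1 : ℝ) • M.v) := by
    rw [eq_inv_smul_iff₀ hu, v]
    module
  have hc'c : M.b ⬝ᵥ (M.c' * M.c) = 1 / 8 := by
    have := hq.b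
    rw [q, dotProduct_add, dotProduct_smul, b3, smul_eq_mul] at this
    linear_combination this
  have hcc : M.b ⬝ᵥ (M.c * M.c) = 1 / 3 := by
    have := congrArg (M.b ⬝ᵥ ·) esq
    simp only [dotProduct_smul, dotProduct_add, b2, b3, hv.b, smul_eq_mul] at this
    rw [this, T]
    field_simp
    ring
  have mc' : M.VMoment M.c' (1 / 24) (1 / 6) := ⟨hs'.b, b3, by rw [hc'c]; norm_num, d3⟩
  have mc : M.VMoment M.c (1 / 6) (1 / 2) := ⟨b3, b2, by rw [hcc]; norm_num, d2⟩
  have msq : M.VMoment (M.c * M.c) (1 / 12) (1 / 3) :=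
    ((((mc'.smul M.Y).add (mc.smul M.z)).add (hv.smul (-1))).smul (M.c' 2)⁻¹).congr esq
      (by rw [T]; field_simp; ring) (by rw [T]; field_simp; ring)
  have mc'c : M.VMoment (M.c' * M.c) (1 / 40) (1 / 8) :=
    (hq.add (mc'.smul (M.c 2))).congr (by rw [q]; module) (by ring) (by ring)
  have mcube : M.VMoment (M.c * M.c * M.c) (1 / 20) (1 / 4) :=
    ((((mc'c.smul M.Y).add (msq.smul M.z)).add (hvc.smul (-1))).smul (M.c' 2)⁻¹).congr
      (by nth_rewrite 1 [esq]; simp only [smul_mul_assoc, add_mul])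
      (by rw [T]; field_simp; ring) (by rw [T]; field_simp; ring)
  have mAsq : M.VMoment (M.a *ᵥ (M.c * M.c)) (1 / 60) (1 / 12) :=
    ((((hs'.smul M.Y).add (mc'.smul M.z)).add (hAv.smul (-1))).smul (M.c' 2)⁻¹).congr
      (by
        rw [esq]
        simp only [Matrix.mulVec_smul, Matrix.mulVec_add]
        rfl)
      (by rw [T]; field_simp; ring) (by rw [T]; field_simp; ring)
  refine ⟨he, hr, hs, ?_, ?_, hd⟩
  · simp only [treesUpToFour, treesFive, List.cons_append, List.nil_append, List.forall_mem_cons,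
      List.not_mem_nil, false_imp_iff, implies_true, and_true]
    refine ⟨by rw [b1]; norm_num, b2, hcc, b3, msq.bc.trans (by norm_num), hc'c, msq.f, mc'.f,
      mcube.bc.trans (by norm_num), mc'c.bc.trans (by norm_num), mAsq.bc.trans (by norm_num),
      hs'.bc.trans (by norm_num), mcube.f, mc'c.f, mAsq.f, hs'.f⟩
  · simp only [treesUpToFour, List.forall_mem_cons, List.not_mem_nil, false_imp_iff, implies_true,
      and_true]
    exact ⟨d1, d2, msq.d, d3, mcube.d, mc'c.d, mAsq.d, hs'.d⟩

/-- The tableau with given coefficients at the stages `4, 5, 6` and given values `k` of `c'` and `s`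
of `c''` at these stages, where `x = c₂`, `y = c₃`, `u = c'₃`. The other coefficients are determined
by the order conditions of `1`, `c`, `c'`. -/
noncomputable def ofChain (C : Chain) (x y u k4 k5 k6 s4 s5 s6 : ℝ) : Tableau :=
  let row (c k s p q r e : ℝ) : Fin 7 → ℝ :=
    let l3 := (s - p * k4 - q * k5 - r * k6) / u
    let l2 := (k - l3 * y - p * C.c4 - q * C.c5 - r * C.c6) / x
    ![c - l2 - l3 - p - q - r, l2, l3, p, q, r, e]
  { a := Matrix.of ![0, ![x, 0, 0, 0, 0, 0, 0], ![y - u / x, u / x, 0, 0, 0, 0, 0],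
      row C.c4 k4 s4 0 0 0 0, row C.c5 k5 s5 C.a54 0 0 0, row C.c6 k6 s6 C.a64 C.a65 0 0,
      row 1 (1 / 2) (1 / 6) C.b4 C.b5 C.b6 0]
    b := row 1 (1 / 2) (1 / 6) C.b4 C.b5 C.b6 0
    c := ![0, x, y, C.c4, C.c5, C.c6, 1]
    d := row (-C.d7) (-C.d7) (-(C.d7 / 2)) C.d4 C.d5 C.d6 C.d7 }

section ofChain

variable {C : Chain} {x y u T z k4 k5 k6 s4 s5 s6 : ℝ}

theorem isExplicit_ofChain : (ofChain C x y u k4 k5 k6 s4 s5 s6).IsExplicit := by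
  intro i j hij
  fin_cases i <;> fin_cases j <;> first
    | exact absurd hij (by decide)
    | rfl

theorem chain_ofChain : (ofChain C x y u k4 k5 k6 s4 s5 s6).chain = C := by
  simp [ofChain, chain]

theorem c'_ofChain (hx : x ≠ 0) : (ofChain C x y u k4 k5 k6 s4 s5 s6).c' =
    ![0, 0, u, k4, k5, k6, 1 / 2] := by
  rw [c']
  funext i
  rw [Matrix.mulVec, dotProduct, Fin.sum_univ_seven]
  fin_cases i <;> simp [ofChain] <;> field_simp <;> ring

theorem c''_ofChain (hx : x ≠ 0) (hu : u ≠ 0) : (ofChain C x y u k4 k5 k6 s4 s5 s6).c'' =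
    ![0, 0, 0, s4, s5, s6, 1 / 6] := by
  rw [c'', c'_ofChain hx]
  funext i
  rw [Matrix.mulVec, dotProduct, Fin.sum_univ_seven]
  fin_cases i <;> simp [ofChain] <;> field_simp <;> ring

theorem rowSum_ofChain : (ofChain C x y u k4 k5 k6 s4 s5 s6).RowSum := by
  funext i
  rw [Matrix.mulVec, dotProduct, Fin.sum_univ_seven]
  fin_cases i <;> simp [ofChain] <;> ring

theorem dotProduct_ofChain (hx : x ≠ 0) :
    (ofChain C x y u k4 k5 k6 s4 s5 s6).d ⬝ᵥ 1 = 0 ∧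
    (ofChain C x y u k4 k5 k6 s4 s5 s6).d ⬝ᵥ (ofChain C x y u k4 k5 k6 s4 s5 s6).c = 0 ∧
    (ofChain C x y u k4 k5 k6 s4 s5 s6).b ⬝ᵥ 1 = 1 ∧
    (ofChain C x y u k4 k5 k6 s4 s5 s6).b ⬝ᵥ (ofChain C x y u k4 k5 k6 s4 s5 s6).c = 1 / 2 := by
  simp only [dotProduct, Fin.sum_univ_seven]
  refine ⟨?_, ?_, ?_, ?_⟩ <;> simp [ofChain] <;> field_simp <;> ring

theorem dotProduct_c'_ofChain (hx : x ≠ 0) (hu : u ≠ 0) :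
    (ofChain C x y u k4 k5 k6 s4 s5 s6).d ⬝ᵥ (ofChain C x y u k4 k5 k6 s4 s5 s6).c' = 0 ∧
    (ofChain C x y u k4 k5 k6 s4 s5 s6).b ⬝ᵥ (ofChain C x y u k4 k5 k6 s4 s5 s6).c' = 1 / 6 := by
  rw [c'_ofChain hx]
  simp only [dotProduct, Fin.sum_univ_seven]
  refine ⟨?_, ?_⟩ <;> simp [ofChain] <;> field_simp <;> ring

theorem Y_ofChain : (ofChain C x y u k4 k5 k6 s4 s5 s6).Y = y * (y - x) := rfl

theorem z_ofChain (hx : x ≠ 0) : (ofChain C x y u k4 k5 k6 s4 s5 s6).z = x * u := by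
  rw [Tableau.z, c'_ofChain hx]; rfl

theorem T_ofChain (hx : x ≠ 0) : (ofChain C x y u k4 k5 k6 s4 s5 s6).T =
    y * (y - x) - 2 * u := by
  rw [Tableau.T, Y_ofChain, c'_ofChain hx]; rfl

/-- The construction yields an almost-pair if the chain has the right moments. -/
theorem isPairExceptLast_ofChain (hx : x ≠ 0) (hu : u ≠ 0) (hT : T = y * (y - x) - 2 * u)
    (hz : z = x * u) {v4 v5 v6 : ℝ} (hB : C.Backbone T z v4 v5 v6)
    (h4 : v4 = y * (y - x) * k4 - u * (C.c4 * (C.c4 - x)))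
    (h5 : v5 = y * (y - x) * k5 - u * (C.c5 * (C.c5 - x)))
    (h6 : v6 = y * (y - x) * k6 - u * (C.c6 * (C.c6 - x)))
    (hq : C.Moment (k4 * (C.c4 - y)) (k5 * (C.c5 - y)) (k6 * (C.c6 - y)) (1 / 2 - y / 2)
      (1 / 40 - y / 24) (1 / 8 - y / 6)) (hs : C.Moment s4 s5 s6 (1 / 6) (1 / 120) (1 / 24))
    (hd : ¬ (C.d4 = 0 ∧ C.d5 = 0 ∧ C.d6 = 0 ∧ C.d7 = 0)) :
    (ofChain C x y u k4 k5 k6 s4 s5 s6).IsPairExceptLast := by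
  obtain ⟨M, hM⟩ : ∃ M, M = ofChain C x y u k4 k5 k6 s4 s5 s6 := ⟨_, rfl⟩
  have hch : M.chain = C := hM ▸ chain_ofChain
  have hc : M.c = ![0, x, y, C.c4, C.c5, C.c6, 1] := by rw [hM]; rfl
  have hc' : M.c' = ![0, 0, u, k4, k5, k6, 1 / 2] := hM ▸ c'_ofChain hx
  have hc'' : M.c'' = ![0, 0, 0, s4, s5, s6, 1 / 6] := hM ▸ c''_ofChain hx hu
  have he : M.IsExplicit := hM ▸ isExplicit_ofChain
  have hb : M.b 6 = 0 := by rw [hM]; rfl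
  have hTM : M.T = T := by rw [hT, ← T_ofChain hx, hM]
  have hzM : M.z = z := by rw [hz, ← z_ofChain hx, hM]
  have hv : M.v = ![0, 0, 0, v4, v5, v6, (T + 2 * z) / 2] := by
    funext i
    rw [v_apply, show M.Y = y * (y - x) by rw [hM, Y_ofChain], hc, hc', h4, h5, h6, hT, hz]
    fin_cases i <;> simp <;> ring
  have hq' : M.q =
      ![0, 0, 0, k4 * (C.c4 - y), k5 * (C.c5 - y), k6 * (C.c6 - y), 1 / 2 - y / 2] := by
    funext i
    rw [q_apply, hc, hc']
    fin_cases i <;> simp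
    ring
  have mv : M.VMoment M.v ((M.T + 4 * M.z) / 24) ((M.T + 3 * M.z) / 6) := by
    rw [hv, hTM, hzM]
    exact vmoment_of_moment he hb (hch ▸ hB.v) rfl rfl rfl rfl rfl rfl rfl
  have hAv : M.a *ᵥ M.v = ![0, 0, 0, 0, C.a54 * v4, C.a65 * v5 + C.a64 * v4, (T + 3 * z) / 6] := by
    have e54 : M.a 4 3 = C.a54 := by rw [← hch]; rfl
    have e64 : M.a 5 3 = C.a64 := by rw [← hch]; rfl
    have e65 : M.a 5 4 = C.a65 := by rw [← hch]; rfl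
    have e7 : (M.a *ᵥ M.v) 6 = M.b ⬝ᵥ M.v := by
      rw [hM]; rfl
    rw [mv.b, hTM, hzM] at e7
    funext i
    fin_cases i
    · exact he.mulVec_zero _
    · refine (he.mulVec_one _).trans ?_
      simp [hv]
    · refine (he.mulVec_two _).trans ?_
      simp [hv]
    · refine (he.mulVec_three _).trans ?_
      simp [hv]
    · refine (he.mulVec_four _).trans ?_
      simp [hv, e54]
    · refine (he.mulVec_five _).trans ?_
      simp [hv, e64, e65]
      ring
    · exact e7
  obtain ⟨d1, d2, b1, b2⟩ := dotProduct_ofChain (C := C) (y := y) (u := u) (k4 := k4) (k5 := k5)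
    (k6 := k6) (s4 := s4) (s5 := s5) (s6 := s6) hx
  obtain ⟨d3, b3⟩ := dotProduct_c'_ofChain (C := C) (y := y) (u := u) (k4 := k4) (k5 := k5)
    (k6 := k6) (s4 := s4) (s5 := s5) (s6 := s6) hx hu
  rw [← hM] at d1 d2 d3 b1 b2 b3 ⊢
  refine isPairExceptLast_of_vmoment he (hM ▸ rowSum_ofChain) ?_ ?_ ?_ b1 b2 b3 d1 d2 d3 mv ?_ ?_
    ?_ ?_
  · rw [hM]
    exact ⟨rfl, fun j => rfl⟩
  · rw [hc']
    exact hu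
  · rintro h0
    refine hd ?_
    rw [← hch]
    simp [h0]
  · rw [hTM, hzM]
    refine vmoment_of_moment he hb (hch ▸ hB.cv) ?_ ?_ ?_ ?_ ?_ ?_ ?_ <;> simp [hv, hc, mul_comm]
  · rw [hTM, hzM]
    have hr : M.chain.Moment 0 (C.a54 * v4) (C.a65 * v5 + C.a64 * v4) ((T + 3 * z) / 6)
        ((T + 5 * z) / 120) ((T + 4 * z) / 24) := by rw [hch]; exact hB.r
    exact vmoment_of_moment he hb hr (by rw [hAv]; rfl) (by rw [hAv]; rfl)
      (by rw [hAv]; rfl) (by rw [hAv]; rfl) (by rw [hAv]; rfl) (by rw [hAv]; rfl)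
      (by rw [hAv]; rfl)
  · rw [hq', show M.c 2 = y by rw [hc]; rfl]
    exact vmoment_of_moment he hb (hch ▸ hq) rfl rfl rfl rfl rfl rfl rfl
  · rw [hc'']
    exact vmoment_of_moment he hb (hch ▸ hs) rfl rfl rfl rfl rfl rfl rfl

theorem nonExceptional_ofChain (hx : x ≠ 0) (hu : u ≠ 0) (hs : s4 ≠ 0) {v4 v5 v6 : ℝ}
    (hB : C.Backbone T z v4 v5 v6) (p4 : C.c4 * (C.c4 - x) * (C.c4 - y) ≠ 0)
    (p5 : C.c5 * (C.c5 - x) * (C.c5 - y) ≠ 0) (p6 : C.c6 * (C.c6 - x) * (C.c6 - y) ≠ 0) :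
    (ofChain C x y u k4 k5 k6 s4 s5 s6).NonExceptional := by
  have e32 : (ofChain C x y u k4 k5 k6 s4 s5 s6).a 3 2 = s4 / u := by
    simp [ofChain]
  refine ⟨⟨div_ne_zero hu hx, e32 ▸ div_ne_zero hs hu, hB.a54_ne, hB.a65_ne⟩, ?_, hB.ne45, hB.ne46,
    hB.ne56⟩
  have key : ∀ c : ℝ, c * (c - x) * (c - y) ≠ 0 → c ≠ 0 ∧ c ≠ x ∧ c ≠ y := fun c h =>
    ⟨left_ne_zero_of_mul (left_ne_zero_of_mul h),
      sub_ne_zero.1 (right_ne_zero_of_mul (left_ne_zero_of_mul h)),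
      sub_ne_zero.1 (right_ne_zero_of_mul h)⟩
  rintro i (rfl | rfl | rfl)
  exacts [key _ p4, key _ p5, key _ p6]

end ofChain

end Tableau

/-! ### Almost-pairs that satisfy the equation for `c₄` -/

namespace Chain

variable {C : Chain} {x y u T z : ℝ}

/-- Moments of a vector that is a linear function of `c` times `v`, in a chain with
`d = b (1 - c) - b A`. -/
theorem Moment.of_linear {v4 v5 v6 : ℝ} (d4 : C.d4 = C.b4 * (1 - C.c4) - C.f4)
    (d5 : C.d5 = C.b5 * (1 - C.c5) - C.f5) (d6 : C.d6 = C.b6 * (1 - C.c6)) (d7 : C.d7 = 0)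
    (f0 : C.f4 * v4 + C.f5 * v5 = (T + 4 * z) / 24)
    (f1 : C.f4 * (C.c4 * v4) + C.f5 * (C.c5 * v5) = (3 * T + 10 * z) / 120)
    (b0 : C.b4 * v4 + C.b5 * v5 + C.b6 * v6 = (T + 3 * z) / 6)
    (b1 : C.b4 * C.c4 * v4 + C.b5 * C.c5 * v5 + C.b6 * C.c6 * v6 = (3 * T + 8 * z) / 24)
    (b2 : C.b4 * C.c4 ^ 2 * v4 + C.b5 * C.c5 ^ 2 * v5 + C.b6 * C.c6 ^ 2 * v6
      = (2 * T + 5 * z) / 20) (α β w7 : ℝ) {w4 w5 w6 mf mb : ℝ}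
    (e4 : w4 = (α + β * C.c4) * v4) (e5 : w5 = (α + β * C.c5) * v5)
    (e6 : w6 = (α + β * C.c6) * v6)
    (hf : mf = α * ((T + 4 * z) / 24) + β * ((3 * T + 10 * z) / 120))
    (hb : mb = α * ((T + 3 * z) / 6) + β * ((3 * T + 8 * z) / 24)) :
    C.Moment w4 w5 w6 w7 mf mb := by
  subst e4 e5 e6 hf hb
  refine ⟨by linear_combination α * f0 + β * f1, by linear_combination α * b0 + β * b1,
    by linear_combination α * b1 + β * b2, ?_⟩
  rw [d4, d5, d6, d7]
  linear_combination α * b0 + β * b1 - α * b1 - β * b2 - α * f0 - β * f1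

/-- The weights given by `lagrange` have the prescribed moments. -/
theorem lagrange_sum {X4 X5 X6 a b c : ℝ} (hab : a ≠ b) (hac : a ≠ c) (hbc : b ≠ c)
    (h4 : X4 * ((a - b) * (a - c)) = lagrange T z b c)
    (h5 : X5 * ((b - a) * (b - c)) = lagrange T z a c)
    (h6 : X6 * ((c - a) * (c - b)) = lagrange T z a b) :
    X4 + X5 + X6 = (T + 3 * z) / 6 ∧ a * X4 + b * X5 + c * X6 = (3 * T + 8 * z) / 24 ∧
      a ^ 2 * X4 + b ^ 2 * X5 + c ^ 2 * X6 = (2 * T + 5 * z) / 20 := by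
  have h1 : a - b ≠ 0 := sub_ne_zero.2 hab
  have h2 : a - c ≠ 0 := sub_ne_zero.2 hac
  have h3 : b - c ≠ 0 := sub_ne_zero.2 hbc
  have hp : (a - b) * (a - c) * (b - c) ≠ 0 := mul_ne_zero (mul_ne_zero h1 h2) h3
  refine ⟨?_, ?_, ?_⟩ <;> refine mul_left_cancel₀ hp ?_
  · rw [lagrange] at h4 h5 h6
    linear_combination (b - c) * h4 - (a - c) * h5 + (a - b) * h6
  · rw [lagrange] at h4 h5 h6
    linear_combination (b - c) * a * h4 - (a - c) * b * h5 + (a - b) * c * h6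
  · rw [lagrange] at h4 h5 h6
    linear_combination (b - c) * a ^ 2 * h4 - (a - c) * b ^ 2 * h5 + (a - b) * c ^ 2 * h6

/-- The quotient of the vectors `q` and `v` at a stage with node `t`, if the equation for `c₄`
holds. -/
noncomputable def starRatio (T z y t : ℝ) : ℝ :=
  -(3 * (y * T + 2 * z)) / W T z + (W T z - 20 * z * (y * T + 2 * z)) / (T * W T z) * t

/-- Outside the zero sets of finitely many expressions, `c₂, c₃, c'₃, c₅, c₆` can be prescribed. All
vectors involved are linear functions of `c` times `v`, and `d` is `b (1 - c) - b A`. -/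
theorem exists_of_star {a b c : ℝ} (hT : T = y * (y - x) - 2 * u) (hz : z = x * u) (hx : x ≠ 0)
    (hu : u ≠ 0) (hT0 : T ≠ 0) (hW : W T z ≠ 0) (hG : T + 5 * z ≠ 0) (ha : star T z a = 0)
    (pa : a * (a - x) * (a - y) ≠ 0) (pb : b * (b - x) * (b - y) ≠ 0)
    (pc : c * (c - x) * (c - y) ≠ 0) (hab : a ≠ b) (hac : a ≠ c) (hbc : b ≠ c) (hc1 : c ≠ 1)
    (hl : lagrange T z a b ≠ 0)
    (Da : y * (y - x) * starRatio T z y a - (a - y) ≠ 0)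
    (Db : y * (y - x) * starRatio T z y b - (b - y) ≠ 0)
    (Dc : y * (y - x) * starRatio T z y c - (c - y) ≠ 0) :
    ∃ M : Tableau, M.IsPairExceptLast ∧ M.NonExceptional ∧ M.c 1 = x ∧ M.c 2 = y ∧ M.c 3 = a ∧
      M.c 4 = b ∧ M.c 5 = c ∧ M.c' 2 = u := by
  have hz0 : z ≠ 0 := hz ▸ mul_ne_zero hx hu
  have hΔ := (Δ_pos (T := T) hz0).ne'
  have ha' := eq_of_star hz0 ha
  have h1 : a - b ≠ 0 := sub_ne_zero.2 hab
  have h2 : a - c ≠ 0 := sub_ne_zero.2 hac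
  have h3 : b - c ≠ 0 := sub_ne_zero.2 hbc
  have stage : ∀ t, t * (t - x) * (t - y) ≠ 0 →
      y * (y - x) * starRatio T z y t - (t - y) ≠ 0 → ∃ v k, v ≠ 0 ∧
        v = y * (y - x) * k - u * (t * (t - x)) ∧ k * (t - y) = starRatio T z y t * v := by
    intro t ht hD
    refine ⟨u * (t * (t - x) * (t - y)) / (y * (y - x) * starRatio T z y t - (t - y)),
      u * (t * (t - x)) * starRatio T z y t / (y * (y - x) * starRatio T z y t - (t - y)),
      div_ne_zero (mul_ne_zero hu ht) hD, ?_, ?_⟩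
    · field_simp
      ring
    · field_simp
  obtain ⟨v4, k4, hv4, e4, q4⟩ := stage a pa Da
  obtain ⟨v5, k5, hv5, e5, q5⟩ := stage b pb Db
  obtain ⟨v6, k6, hv6, e6, q6⟩ := stage c pc Dc
  obtain ⟨b4, hb4⟩ : ∃ r, r * v4 * ((a - b) * (a - c)) = lagrange T z b c :=
    ⟨lagrange T z b c / (v4 * ((a - b) * (a - c))), by field_simp⟩
  obtain ⟨b5, hb5⟩ : ∃ r, r * v5 * ((b - a) * (b - c)) = lagrange T z a c :=
    ⟨lagrange T z a c / (v5 * ((b - a) * (b - c))), by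
      have : b - a ≠ 0 := sub_ne_zero.2 hab.symm
      field_simp⟩
  obtain ⟨b6, hb6⟩ : ∃ r, r * v6 * ((c - a) * (c - b)) = lagrange T z a b :=
    ⟨lagrange T z a b / (v6 * ((c - a) * (c - b))), by
      have : c - a ≠ 0 := sub_ne_zero.2 hac.symm
      have : c - b ≠ 0 := sub_ne_zero.2 hbc.symm
      field_simp⟩
  have hb60 : b6 ≠ 0 := left_ne_zero_of_mul (left_ne_zero_of_mul (hb6 ▸ hl))
  obtain ⟨B0, B1, B2⟩ := lagrange_sum hab hac hbc hb4 hb5 hb6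
  -- the second row of moments of `v`, that of `b A`
  have hμ : (3 * T + 10 * z) / 120 - a * ((T + 4 * z) / 24) =
      W T z / Δ T z * ((T + 5 * z) / 120) := by
    rw [ha']
    field_simp
    rw [Δ, W]
    ring
  obtain ⟨f5, hf5⟩ : ∃ r, r * v5 * (b - a) = (3 * T + 10 * z) / 120 - a * ((T + 4 * z) / 24) :=
    ⟨((3 * T + 10 * z) / 120 - a * ((T + 4 * z) / 24)) / (v5 * (b - a)), by
      have : b - a ≠ 0 := sub_ne_zero.2 hab.symm
      field_simp⟩
  have hf50 : f5 ≠ 0 := by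
    have : f5 * v5 * (b - a) ≠ 0 := by
      rw [hf5, hμ]
      exact mul_ne_zero (div_ne_zero hW hΔ) (div_ne_zero hG (by norm_num))
    exact left_ne_zero_of_mul (left_ne_zero_of_mul this)
  -- the entries of `A v`: a linear function of `c` that vanishes at `c₄`, times `v`
  set r5 := Δ T z / W T z * (b - a) * v5 with hr5
  set r6 := Δ T z / W T z * (c - a) * v6 with hr6
  have hr : b5 * r5 + b6 * r6 = (T + 4 * z) / 24 := by
    have : (3 * T + 8 * z) / 24 - a * ((T + 3 * z) / 6) = W T z / Δ T z * ((T + 4 * z) / 24) := by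
      rw [ha']
      field_simp
      rw [Δ, W]
      ring
    have h4 : Δ T z / W T z * (W T z / Δ T z * ((T + 4 * z) / 24)) = (T + 4 * z) / 24 := by
      field_simp
    rw [hr5, hr6]
    linear_combination Δ T z / W T z * (B1 - a * B0) + Δ T z / W T z * this + h4
  let f4 := b6 * ((r6 - f5 / b6 * v5) / v4) + b5 * (r5 / v4)
  let C : Chain :=
    { c4 := a, c5 := b, c6 := c, b4 := b4, b5 := b5, b6 := b6, a54 := r5 / v4,
      a64 := (r6 - f5 / b6 * v5) / v4, a65 := f5 / b6, d4 := b4 * (1 - a) - f4,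
      d5 := b5 * (1 - b) - f5, d6 := b6 * (1 - c), d7 := 0 }
  have Cf5 : C.f5 = f5 := by
    simp only [Chain.f5, C]
    field_simp
  have Cf4 : C.f4 * v4 + f5 * v5 = (T + 4 * z) / 24 := by
    rw [← hr]
    simp only [Chain.f4, C]
    field_simp
    ring
  have d5 : C.d5 = C.b5 * (1 - C.c5) - C.f5 := by rw [Cf5]
  have lin := Moment.of_linear (C := C) (T := T) (z := z) (v4 := v4) (v5 := v5) (v6 := v6)
    rfl d5 rfl rfl (by rw [Cf5]; exact Cf4)
    (by
      rw [Cf5]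
      show C.f4 * (a * v4) + f5 * (b * v5) = _
      linear_combination a * Cf4 + hf5)
    B0 (by linear_combination B1) (by linear_combination B2)
  have hB : C.Backbone T z v4 v5 v6 := by
    refine ⟨lin 1 0 _ (by ring) (by ring) (by ring) (by ring) (by ring),
      lin 0 1 _ (by ring) (by ring) (by ring) (by ring) (by ring), ?_, hab, hac, hbc,
      left_ne_zero_of_mul (left_ne_zero_of_mul pa), ?_, div_ne_zero hf50 hb60⟩
    · refine lin (-(Δ T z / W T z * a)) (Δ T z / W T z) _ ?_ ?_ ?_ ?_ ?_
      · show 0 = (-(Δ T z / W T z * a) + Δ T z / W T z * a) * v4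
        ring
      · show r5 / v4 * v4 = (-(Δ T z / W T z * a) + Δ T z / W T z * b) * v5
        rw [div_mul_cancel₀ _ hv4, hr5]
        ring
      · show f5 / b6 * v5 + (r6 - f5 / b6 * v5) / v4 * v4 =
          (-(Δ T z / W T z * a) + Δ T z / W T z * c) * v6
        rw [div_mul_cancel₀ _ hv4, hr6]
        ring
      · rw [ha']
        field_simp
        rw [Δ, W]
        ring
      · rw [ha']
        field_simp
        rw [Δ, W]
        ring
    · refine div_ne_zero ?_ hv4
      rw [hr5]
      exact mul_ne_zero (mul_ne_zero (div_ne_zero hΔ hW) (sub_ne_zero.2 hab.symm)) hv5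
  -- the vector `c''`
  set μ := (T + 8 * z) / W T z with hμs
  have hs : C.Moment (a / T * v4) ((a / T - μ * a + μ * b) * v5) ((a / T - μ * a + μ * c) * v6)
      (1 / 6) (1 / 120) (1 / 24) := by
    refine lin (a / T - μ * a) μ _ ?_ rfl rfl ?_ ?_
    · show a / T * v4 = (a / T - μ * a + μ * a) * v4
      ring
    · rw [hμs, ha']
      field_simp
      rw [Δ, W]
      ring
    · rw [hμs, ha']
      field_simp
      rw [Δ, W]
      ring
  have hq : C.Moment (k4 * (C.c4 - y)) (k5 * (C.c5 - y)) (k6 * (C.c6 - y)) (1 / 2 - y / 2)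
      (1 / 40 - y / 24) (1 / 8 - y / 6) := by
    refine lin _ _ _ q4 q5 q6 ?_ ?_
    · field_simp
      rw [W]
      ring
    · field_simp
      rw [W]
      ring
  refine ⟨Tableau.ofChain C x y u k4 k5 k6 (a / T * v4) ((a / T - μ * a + μ * b) * v5)
    ((a / T - μ * a + μ * c) * v6),
    Tableau.isPairExceptLast_ofChain hx hu hT hz hB e4 e5 e6 hq hs ?_,
    Tableau.nonExceptional_ofChain hx hu ?_ hB pa pb pc, rfl, rfl, rfl, rfl, rfl, ?_⟩
  · rintro ⟨-, -, h, -⟩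
    exact mul_ne_zero hb60 (sub_ne_zero.2 hc1.symm) h
  · exact mul_ne_zero (div_ne_zero (left_ne_zero_of_mul (left_ne_zero_of_mul pa)) hT0) hv4
  · rw [Tableau.c'_ofChain hx]
    rfl

end Chain

/-! ### Almost-pairs with `c₆ = 1` -/

namespace Chain

variable {C : Chain} {x y u T z : ℝ}

/-- Moments in a chain with `c₆ = 1` and `b (1 - c) = b A`; the row `d` is a combination of the rows
`b A`, `b` and of the two unit rows at the stages `4` and `7`. -/
theorem Moment.of_c6 {D δ ε κ : ℝ} (h6 : C.c6 = 1) (f4 : C.f4 = C.b4 * (1 - C.c4))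
    (f5 : C.f5 = C.b5 * (1 - C.c5)) (d4 : C.d4 = D * C.f4 + δ * C.b4 - κ)
    (d5 : C.d5 = D * C.f5 + δ * C.b5) (d6 : C.d6 = δ * C.b6) (d7 : C.d7 = ε)
    {w4 w5 w6 w7 mf mb : ℝ} (hf : C.f4 * w4 + C.f5 * w5 = mf)
    (hb : C.b4 * w4 + C.b5 * w5 + C.b6 * w6 = mb) (hd : D * mf + δ * mb + ε * w7 = κ * w4) :
    C.Moment w4 w5 w6 w7 mf mb := by
  refine ⟨hf, hb, ?_, ?_⟩
  · rw [h6]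
    rw [f4, f5] at hf
    linear_combination hb - hf
  · rw [d4, d5, d6, d7]
    linear_combination hd + D * hf + δ * hb

/-- Outside the zero sets of finitely many expressions, `c₂, c₃, c'₃, c₄, c₅` can be prescribed. The
stages are given by their closed forms, and `d` by the cross product of `Backbone.proportional`. -/
theorem exists_of_c6 {a b : ℝ} (hT : T = y * (y - x) - 2 * u) (hz : z = x * u) (hx : x ≠ 0)
    (hu : u ≠ 0) (hT0 : T ≠ 0) (hG : T + 5 * z ≠ 0) (ha : star T z a ≠ 0)
    (pa : a * (a - x) * (a - y) ≠ 0) (pb : b * (b - x) * (b - y) ≠ 0)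
    (pc : 1 * (1 - x) * (1 - y) ≠ 0) (hab : a ≠ b) (ha1 : a ≠ 1) (hb1 : b ≠ 1)
    (Da : stageD T z (y * (y - x)) y a 1 a ≠ 0)
    (Db : stageD T z (y * (y - x)) y b (V5 T z a) (E5 T z a b) ≠ 0)
    (Dc : stageD T z (y * (y - x)) y 1 (V6 T z a b) (E6 T z a b) ≠ 0) :
    ∃ M : Tableau, M.IsPairExceptLast ∧ M.NonExceptional ∧ M.c 1 = x ∧ M.c 2 = y ∧ M.c 3 = a ∧
      M.c 4 = b ∧ M.c 5 = 1 ∧ M.c' 2 = u := by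
  have hz0 : z ≠ 0 := hz ▸ mul_ne_zero hx hu
  have h1 : a - b ≠ 0 := sub_ne_zero.2 hab
  have h2 : 1 - a ≠ 0 := sub_ne_zero.2 ha1.symm
  have h3 : 1 - b ≠ 0 := sub_ne_zero.2 hb1.symm
  have stage : ∀ t V E, t * (t - x) * (t - y) ≠ 0 → stageD T z (y * (y - x)) y t V E ≠ 0 →
      ∃ τ k, τ ≠ 0 ∧ StageForm x y u T z t V E k τ := by
    intro t V E ht hD
    refine ⟨u * (t * (t - x) * (t - y)) / stageD T z (y * (y - x)) y t V E,
      u * (t * (t - x)) * stageN T z y t V E / stageD T z (y * (y - x)) y t V E,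
      div_ne_zero (mul_ne_zero hu ht) hD, ?_, ?_⟩
    · field_simp
      rw [stageD]
      ring
    · field_simp
  obtain ⟨τ4, k4, hτ4, s4⟩ := stage a _ _ pa Da
  obtain ⟨τ5, k5, hτ5, s5⟩ := stage b _ _ pb Db
  obtain ⟨τ6, k6, hτ6, s6⟩ := stage 1 _ _ pc Dc
  obtain ⟨b4, w4⟩ : ∃ r, r * τ4 = (3 * T + 10 * z - b * (5 * T + 20 * z)) /
      (120 * (a - b) * (1 - a) * (z * T)) := ⟨_, div_mul_cancel₀ _ hτ4⟩
  obtain ⟨b5, w5⟩ : ∃ r, r * τ5 = 1 / (120 * (a - b) * (1 - b) * (z * T)) :=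
    ⟨_, div_mul_cancel₀ _ hτ5⟩
  obtain ⟨b6, w6⟩ : ∃ r, r * τ6 = 1 / (120 * (1 - a) * (1 - b) * (z * T)) :=
    ⟨_, div_mul_cancel₀ _ hτ6⟩
  have hb5 : b5 ≠ 0 := by
    refine left_ne_zero_of_mul (b := τ5) ?_
    rw [w5]
    positivity
  have hb6 : b6 ≠ 0 := by
    refine left_ne_zero_of_mul (b := τ6) ?_
    rw [w6]
    positivity
  have hf5 : b5 * (1 - b) ≠ 0 := mul_ne_zero hb5 h3
  set v4 := τ4 * (z * T * 1) with hv4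
  set v5 := τ5 * (z * T * V5 T z a) with hv5
  set v6 := τ6 * (z * T * V6 T z a b) with hv6
  have hv40 : v4 ≠ 0 := by positivity
  set a54 := (T + 5 * z) / 120 / (b5 * (1 - b) * v4) with ha54
  let D := 20 * (a * (T ^ 2 + 6 * T * z + 12 * z ^ 2) + T * z)
  let δ := -8 * (a * (T ^ 2 + 7 * T * z + 15 * z ^ 2) + T * z)
  let κ := z / (3 * τ4)
  let C : Chain :=
    { c4 := a, c5 := b, c6 := 1, b4 := b4, b5 := b5, b6 := b6, a54 := a54,
      a64 := (b4 * (1 - a) - b5 * a54) / b6, a65 := b5 * (1 - b) / b6,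
      d4 := D * (b4 * (1 - a)) + δ * b4 - κ, d5 := D * (b5 * (1 - b)) + δ * b5, d6 := δ * b6,
      d7 := star T z a }
  have Cf4 : C.f4 = b4 * (1 - a) := by
    simp only [Chain.f4, C]
    field_simp
    ring
  have Cf5 : C.f5 = b5 * (1 - b) := by
    simp only [Chain.f5, C]
    field_simp
  have mom := @Moment.of_c6 C D δ (star T z a) κ rfl Cf4 Cf5 (by rw [Cf4]) (by rw [Cf5]) rfl rfl
  have hκ : κ * τ4 = z / 3 := by
    simp only [κ]
    field_simp
  have f0 : C.f4 * v4 + C.f5 * v5 = (T + 4 * z) / 24 := by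
    rw [Cf4, Cf5, hv4, hv5]
    have e : b4 * (1 - a) * (τ4 * (z * T * 1)) + b5 * (1 - b) * (τ5 * (z * T * V5 T z a)) =
      b4 * τ4 * ((1 - a) * (z * T)) + b5 * τ5 * ((1 - b) * (z * T) * V5 T z a) := by ring
    rw [e, w4, w5, V5]
    field_simp
    ring
  have b0 : b4 * v4 + b5 * v5 + b6 * v6 = (T + 3 * z) / 6 := by
    have e : b4 * v4 + b5 * v5 + b6 * v6 = b4 * τ4 * (z * T) + b5 * τ5 * (z * T * V5 T z a) +
      b6 * τ6 * (z * T * V6 T z a b) := by rw [hv4, hv5, hv6]; ring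
    rw [e, w4, w5, w6, V5, V6]
    field_simp
    ring
  have f1 : C.f4 * (a * v4) + C.f5 * (b * v5) = (3 * T + 10 * z) / 120 := by
    rw [Cf4, Cf5, hv4, hv5]
    have e : b4 * (1 - a) * (a * (τ4 * (z * T * 1))) +
      b5 * (1 - b) * (b * (τ5 * (z * T * V5 T z a))) =
      b4 * τ4 * (a * (1 - a) * (z * T)) + b5 * τ5 * (b * (1 - b) * (z * T) * V5 T z a) := by ring
    rw [e, w4, w5, V5]
    field_simp
    ring
  have b1 : b4 * (a * v4) + b5 * (b * v5) + b6 * (1 * v6) = (3 * T + 8 * z) / 24 := by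
    rw [Cf4, Cf5] at f0
    linear_combination b0 - f0
  have fq : C.f4 * (k4 * (a - y)) + C.f5 * (k5 * (b - y)) = 1 / 40 - y / 24 := by
    rw [Cf4, Cf5, s4.q, s5.q]
    have e : b4 * (1 - a) * (τ4 * stageN T z y a 1 a) +
      b5 * (1 - b) * (τ5 * stageN T z y b (V5 T z a) (E5 T z a b)) =
      b4 * τ4 * ((1 - a) * stageN T z y a 1 a) +
      b5 * τ5 * ((1 - b) * stageN T z y b (V5 T z a) (E5 T z a b)) := by ring
    rw [e, w4, w5, stageN, stageN, V5, E5]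
    field_simp
    ring
  have bq : b4 * (k4 * (a - y)) + b5 * (k5 * (b - y)) + b6 * (k6 * (1 - y)) = 1 / 8 - y / 6 := by
    rw [s4.q, s5.q, s6.q]
    have e : b4 * (τ4 * stageN T z y a 1 a) +
      b5 * (τ5 * stageN T z y b (V5 T z a) (E5 T z a b)) +
      b6 * (τ6 * stageN T z y 1 (V6 T z a b) (E6 T z a b)) =
      b4 * τ4 * stageN T z y a 1 a + b5 * τ5 * stageN T z y b (V5 T z a) (E5 T z a b) +
      b6 * τ6 * stageN T z y 1 (V6 T z a b) (E6 T z a b) := by ring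
    rw [e, w4, w5, w6, stageN, stageN, stageN, V5, E5, V6, E6]
    field_simp
    ring
  have hB : C.Backbone T z v4 v5 v6 := by
    refine ⟨mom f0 b0 ?_, mom f1 b1 ?_, mom (mf := (T + 5 * z) / 120) ?_ ?_ ?_, hab, ha1, hb1,
      left_ne_zero_of_mul (left_ne_zero_of_mul pa), ?_, div_ne_zero hf5 hb6⟩
    · rw [hv4, star]
      linear_combination -(z * T) * hκ
    · rw [hv4, star]
      show _ = κ * (a * _)
      linear_combination -(a * z * T) * hκ
    · rw [Cf5, mul_zero, zero_add]
      show b5 * (1 - b) * (a54 * v4) = _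
      rw [ha54]
      field_simp
    · rw [← f0, Cf4, Cf5]
      show b4 * 0 + b5 * (a54 * v4) + b6 * (b5 * (1 - b) / b6 * v5 +
        (b4 * (1 - a) - b5 * a54) / b6 * v4) = _
      field_simp
      ring
    · rw [star]
      ring
    · exact div_ne_zero (div_ne_zero hG (by norm_num)) (mul_ne_zero hf5 hv40)
  have hs : C.Moment (τ4 * (z * a)) ((1 / 120 - b4 * (1 - a) * (τ4 * (z * a))) / (b5 * (1 - b)))
      ((1 / 24 - b4 * (τ4 * (z * a)) - b5 * ((1 / 120 - b4 * (1 - a) * (τ4 * (z * a))) /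
        (b5 * (1 - b)))) / b6) (1 / 6) (1 / 120) (1 / 24) := by
    refine mom ?_ ?_ ?_
    · rw [Cf4, Cf5]
      field_simp
      ring
    · show b4 * _ + b5 * _ + b6 * _ = _
      field_simp
      ring
    · rw [star]
      linear_combination -(a * z) * hκ
  have hq : C.Moment (k4 * (C.c4 - y)) (k5 * (C.c5 - y)) (k6 * (C.c6 - y)) (1 / 2 - y / 2)
      (1 / 40 - y / 24) (1 / 8 - y / 6) := by
    refine mom fq bq ?_
    show _ = κ * (k4 * (a - y))
    rw [s4.q, stageN, star]
    linear_combination -(a * z * 1 + (y * T + 2 * z) * a) * hκ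
  refine ⟨Tableau.ofChain C x y u k4 k5 k6 _ _ _,
    Tableau.isPairExceptLast_ofChain hx hu hT hz hB s4.v.symm s5.v.symm s6.v.symm hq hs ?_,
    Tableau.nonExceptional_ofChain hx hu ?_ hB pa pb pc, rfl, rfl, rfl, rfl, rfl, ?_⟩
  · rintro ⟨-, -, -, h⟩
    exact ha h
  · exact mul_ne_zero hτ4 (mul_ne_zero hz0 (left_ne_zero_of_mul (left_ne_zero_of_mul pa)))
  · rw [Tableau.c'_ofChain hx]
    rfl

end Chain

/-! ### Almost-pairs near a given one -/

open Topology in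
/-- A set of matrices of which four smooth parameters fill a neighbourhood has dimension at least
`4`. -/
theorem four_le_dimH_of_eventually {S : Set (Fin 7 → Fin 7 → ℝ)}
    {π : (Fin 7 → Fin 7 → ℝ) → Fin 4 → ℝ} (hπ : ContDiff ℝ 1 π) {w₀ : Fin 4 → ℝ}
    (h : ∀ᶠ w in 𝓝 w₀, ∃ a ∈ S, π a = w) : 4 ≤ dimH S := by
  have h1 : π '' S ∈ 𝓝 w₀ := h
  have h2 := Real.dimH_of_mem_nhds h1
  rw [Module.finrank_fin_fun] at h2
  calc (4 : ENNReal) = dimH (π '' S) := by rw [h2]; norm_num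
    _ ≤ dimH S := (hπ.contDiffOn (s := Set.univ)).dimH_image_le convex_univ (Set.subset_univ _)

namespace Tableau

/-- The values of `c` and `c'` depend on the matrix only, so a pair lies in exactly those families
whose equations it satisfies. -/
theorem mem_family_diff {F : MvPolynomial (Fin 5) ℚ} {M : Tableau} (h : M.IsPair)
    (hn : M.NonExceptional) {k : PairType} (hk : M.HasType F k)
    (hj : ∀ j ≠ k, ¬ M.HasType F j) :
    (fun i j => M.a i j) ∈ family F k \ ⋃ j ≠ k, family F j := by
  refine ⟨⟨M, rfl, h, hn, hk⟩, fun hmem => ?_⟩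
  simp only [Set.mem_iUnion] at hmem
  obtain ⟨j, hjk, N, hN, hP, -, ht⟩ := hmem
  have ha : N.a = M.a := hN
  have hc : N.c = M.c := by rw [hP.1.c_eq, h.1.c_eq, ha]
  have hc' : N.c' = M.c' := by rw [c', c', ha, hc]
  refine hj j hjk ?_
  cases j <;>
    simpa only [HasType, C4Equation, EqA, EqB, EqC, EqB', hc, hc'] using ht

theorem c_eq_sum {M : Tableau} (h : M.IsPairExceptLast) (i : Fin 7) : M.c i = ∑ j, M.a i j := by
  rw [h.c_eq, Matrix.mulVec, dotProduct]
  simp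

theorem c'_eq_sum (M : Tableau) (i : Fin 7) : M.c' i = ∑ j, M.a i j * M.c j := rfl

end Tableau

namespace Chain

open Filter Topology

/-- The product of the expressions that must not vanish in the construction of an almost-pair that
satisfies the equation for `c₄`, as a function of `c₂, c₃, c'₃, c₄, c₅, c₆`. -/
noncomputable def starGood (x y u a b c : ℝ) : ℝ :=
  let T := y * (y - x) - 2 * u
  let z := x * u
  let q : ℝ → ℝ := fun t => y * (y - x) * (t * W T z - (y * T + 2 * z) * (20 * z * t + 3 * T))
    - (t - y) * (T * W T z)
  x * u * T * W T z * (T + 5 * z) * (a * (a - x) * (a - y)) * (b * (b - x) * (b - y)) *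
    (c * (c - x) * (c - y)) * (a - b) * (a - c) * (b - c) * (c - 1) * lagrange T z a b *
    q a * q b * q c

/-- The node `c₄` as a function of `c₂, c₃, c'₃`. -/
noncomputable def starNode (x y u : ℝ) : ℝ :=
  -((y * (y - x) - 2 * u) * (x * u)) / Δ (y * (y - x) - 2 * u) (x * u)

theorem star_starNode {x y u : ℝ} (hz : x * u ≠ 0) :
    star (y * (y - x) - 2 * u) (x * u) (starNode x y u) = 0 := by
  have := (Δ_pos (T := y * (y - x) - 2 * u) hz).ne'
  rw [star, starNode]
  field_simp
  rw [Δ]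
  ring

/-- An almost-pair with prescribed `c₂, c₃, c'₃, c₅, c₆` that satisfies the equation for `c₄`. -/
theorem exists_of_starGood {x y u b c : ℝ} (h : starGood x y u (starNode x y u) b c ≠ 0) :
    ∃ M : Tableau, M.IsPairExceptLast ∧ M.NonExceptional ∧ M.C4Equation ∧ M.c 5 ≠ 1 ∧
      M.c 1 = x ∧ M.c 2 = y ∧ M.c 4 = b ∧ M.c 5 = c ∧ M.c' 2 = u := by
  set a := starNode x y u with ha
  simp only [starGood] at h
  set T := y * (y - x) - 2 * u with hT
  set z := x * u with hz
  simp only [mul_ne_zero_iff (M₀ := ℝ)] at h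
  obtain ⟨⟨⟨⟨⟨⟨⟨⟨⟨⟨⟨⟨⟨⟨hz0, hT0⟩, hW⟩, hG⟩, pa⟩, pb⟩, pc⟩, hab⟩, hac⟩, hbc⟩, hc⟩, hl⟩, qa⟩,
    qb⟩, qc⟩ := h
  have hx : x ≠ 0 := left_ne_zero_of_mul hz0
  have hu : u ≠ 0 := right_ne_zero_of_mul hz0
  have hs := star_starNode (y := y) (mul_ne_zero hx hu)
  have hq : ∀ t, y * (y - x) * (t * W T z - (y * T + 2 * z) * (20 * z * t + 3 * T))
      - (t - y) * (T * W T z) ≠ 0 → y * (y - x) * starRatio T z y t - (t - y) ≠ 0 := by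
    intro t ht h0
    refine ht ?_
    rw [← mul_zero (T * W T z), ← h0, starRatio]
    field_simp
    ring
  obtain ⟨M, hM, hN, e1, e2, e3, e4, e5, e6⟩ := exists_of_star hT hz hx hu hT0 hW hG hs
    (by simpa [mul_ne_zero_iff] using pa) (by simpa [mul_ne_zero_iff] using pb)
    (by simpa [mul_ne_zero_iff] using pc) (sub_ne_zero.1 hab) (sub_ne_zero.1 hac)
    (sub_ne_zero.1 hbc) (sub_ne_zero.1 hc) hl (hq a qa) (hq b qb) (hq c qc)
  refine ⟨M, hM, hN, ?_, ?_, e1, e2, e4, e5, e6⟩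
  · rw [hM.c4Equation_iff hN, Tableau.T, Tableau.Y, Tableau.z, e1, e2, e3, e6]
    exact hs
  · rw [e5]
    exact sub_ne_zero.1 hc

theorem eventually_starGood {w₀ : Fin 4 → ℝ} {x y u b c : (Fin 4 → ℝ) → ℝ}
    (hx : ContinuousAt x w₀) (hy : ContinuousAt y w₀) (hu : ContinuousAt u w₀)
    (hb : ContinuousAt b w₀) (hc : ContinuousAt c w₀) (hz : x w₀ * u w₀ ≠ 0)
    (h : starGood (x w₀) (y w₀) (u w₀) (starNode (x w₀) (y w₀) (u w₀)) (b w₀) (c w₀) ≠ 0) :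
    ∀ᶠ w in 𝓝 w₀, starGood (x w) (y w) (u w) (starNode (x w) (y w) (u w)) (b w) (c w) ≠ 0 := by
  have ha : ContinuousAt (fun w => starNode (x w) (y w) (u w)) w₀ := by
    have := (Δ_pos (T := y w₀ * (y w₀ - x w₀) - 2 * u w₀) hz).ne'
    unfold starNode
    refine ContinuousAt.div (by fun_prop) ?_ this
    unfold Δ
    fun_prop
  refine ContinuousAt.eventually_ne
    (g := fun w => starGood (x w) (y w) (u w) (starNode (x w) (y w) (u w)) (b w) (c w)) ?_ h
  simp only [starGood, W, lagrange]
  fun_prop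

end Chain

/-! ### Each family has a part of dimension `4` of its own -/

namespace Chain

open Filter Topology

/-- The product of the expressions that must not vanish in the construction of an almost-pair with
`c₆ = 1`, as a function of `c₂, c₃, c'₃, c₄, c₅`. -/
noncomputable def c6Good (x y u a b : ℝ) : ℝ :=
  let T := y * (y - x) - 2 * u
  let z := x * u
  z * T * (T + 5 * z) * star T z a * (a * (a - x) * (a - y)) * (b * (b - x) * (b - y)) *
    (1 * (1 - x) * (1 - y)) * (a - b) * (a - 1) * (b - 1) * stageD T z (y * (y - x)) y a 1 a *
    stageD T z (y * (y - x)) y b (V5 T z a) (E5 T z a b) *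
    stageD T z (y * (y - x)) y 1 (V6 T z a b) (E6 T z a b)

/-- An almost-pair with `c₆ = 1` and prescribed `c₂, c₃, c'₃, c₄, c₅`. -/
theorem exists_of_c6Good {x y u a b : ℝ} (h : c6Good x y u a b ≠ 0) :
    ∃ M : Tableau, M.IsPairExceptLast ∧ M.NonExceptional ∧ ¬ M.C4Equation ∧ M.c 5 = 1 ∧
      M.c 1 = x ∧ M.c 2 = y ∧ M.c 3 = a ∧ M.c 4 = b ∧ M.c' 2 = u := by
  simp only [c6Good] at h
  set T := y * (y - x) - 2 * u with hT
  set z := x * u with hz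
  simp only [mul_ne_zero_iff (M₀ := ℝ)] at h
  obtain ⟨⟨⟨⟨⟨⟨⟨⟨⟨⟨⟨⟨hz0, hT0⟩, hG⟩, hs⟩, pa⟩, pb⟩, pc⟩, hab⟩, ha1⟩, hb1⟩, Da⟩, Db⟩, Dc⟩ := h
  have hx : x ≠ 0 := left_ne_zero_of_mul hz0
  have hu : u ≠ 0 := right_ne_zero_of_mul hz0
  obtain ⟨M, hM, hN, e1, e2, e3, e4, e5, e6⟩ := exists_of_c6 hT hz hx hu hT0 hG hs
    (by simpa [mul_ne_zero_iff] using pa) (by simpa [mul_ne_zero_iff] using pb)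
    (by simpa [mul_ne_zero_iff] using pc) (sub_ne_zero.1 hab) (sub_ne_zero.1 ha1)
    (sub_ne_zero.1 hb1) Da Db Dc
  refine ⟨M, hM, hN, ?_, e5, e1, e2, e3, e4, e6⟩
  rw [hM.c4Equation_iff hN, Tableau.T, Tableau.Y, Tableau.z, e1, e2, e3, e6]
  exact hs

theorem eventually_c6Good {w₀ : Fin 4 → ℝ} {x y u a b : (Fin 4 → ℝ) → ℝ}
    (hx : ContinuousAt x w₀) (hy : ContinuousAt y w₀) (hu : ContinuousAt u w₀)
    (ha : ContinuousAt a w₀) (hb : ContinuousAt b w₀)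
    (h : c6Good (x w₀) (y w₀) (u w₀) (a w₀) (b w₀) ≠ 0) :
    ∀ᶠ w in 𝓝 w₀, c6Good (x w) (y w) (u w) (a w) (b w) ≠ 0 := by
  refine ContinuousAt.eventually_ne (g := fun w => c6Good (x w) (y w) (u w) (a w) (b w)) ?_ h
  simp only [c6Good, Chain.star, stageD, stageN, V5, E5, V6, E6]
  fun_prop

end Chain

section LowerBound

open Chain Filter Topology Tableau

theorem continuousAt_polyC {w₀ : Fin 4 → ℝ} {x y u b c : (Fin 4 → ℝ) → ℝ}
    (hx : ContinuousAt x w₀) (hy : ContinuousAt y w₀) (hu : ContinuousAt u w₀)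
    (hb : ContinuousAt b w₀) (hc : ContinuousAt c w₀) :
    ContinuousAt (fun w => polyC (x w) (y w) (u w) (b w) (c w)) w₀ := by
  simp only [polyC]
  fun_prop

/-- The parameters are `c₂, c₃, c₅, c₆`. -/
theorem four_le_dimH_A :
    4 ≤ dimH (family PolyTerm.exprF.toMvPolynomial .A \
      ⋃ j ≠ PairType.A, family PolyTerm.exprF.toMvPolynomial j) := by
  -- a point at which the expressions in the inequalities do not vanish
  obtain ⟨w₀, h0, h1, h2, h3⟩ : ∃ w₀ : Fin 4 → ℝ, w₀ 0 = 1 ∧ w₀ 1 = 1 ∧ w₀ 2 = 2 ∧ w₀ 3 = -1 :=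
    ⟨![1, 1, 2, -1], rfl, rfl, rfl, rfl⟩
  have hw : ∀ i, ContinuousAt (fun w : Fin 4 → ℝ => w i) w₀ := fun i =>
    (continuous_apply i).continuousAt
  refine four_le_dimH_of_eventually
    (π := fun a => ![∑ j, a 1 j, ∑ j, a 2 j, ∑ j, a 4 j, ∑ j, a 5 j]) ?_ (w₀ := w₀) ?_
  · rw [contDiff_pi]
    intro i
    fin_cases i <;> simp <;> fun_prop
  have hg := eventually_starGood (w₀ := w₀) (x := fun w => w 0) (y := fun w => w 1)
    (u := fun w => w 1 ^ 2 / 2) (b := fun w => w 2) (c := fun w => w 3) (hw 0) (hw 1)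
    (((hw 1).pow 2).div_const 2) (hw 2) (hw 3) (by norm_num [h0, h1, h2, h3])
    (by norm_num [starGood, starNode, Δ, W, lagrange, h0, h1, h2, h3])
  have hB : ∀ᶠ w in 𝓝 w₀, polyB (w 0) (w 1) (w 1 ^ 2 / 2) ≠ 0 := by
    refine ContinuousAt.eventually_ne (g := fun w : Fin 4 → ℝ => polyB (w 0) (w 1) (w 1 ^ 2 / 2))
      ?_ ?_
    · simp only [polyB]
      fun_prop (disch := norm_num)
    · norm_num [polyB, h0, h1, h2, h3]
  have hC : ∀ᶠ w in 𝓝 w₀,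
      polyC (w 0) (w 1) (w 1 ^ 2 / 2) (w 2) (w 3) ≠ 0 := by
    refine (continuousAt_polyC (hw 0) (hw 1) (((hw 1).pow 2).div_const 2) (hw 2)
      (hw 3)).eventually_ne ?_
    norm_num [polyC, h0, h1, h2, h3]
  filter_upwards [hg, hB, hC] with w h hB hC
  obtain ⟨M, hM, hN, h4, h6, e1, e2, e4, e5, e6⟩ := exists_of_starGood h
  have hA : M.EqA := by rw [EqA, e6, e2]
  refine ⟨_, mem_family_diff ⟨hM, ((hM.classification hN).2.1 h4).2.2 (Or.inl hA)⟩ hN (k := .A)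
    ⟨h4, hA⟩ ?_, ?_⟩
  · rintro (_ | _ | _ | _ | _) hj ⟨h1, h2⟩
    · exact hj rfl
    · rw [IsPairExceptLast.eqB_iff, e1, e2, e6] at h2
      exact hB h2
    · rw [IsPairExceptLast.eqC_iff, e1, e2, e4, e5, e6] at h2
      exact hC h2
    · exact h6 h1
    · exact h6 h1
  · simp only [← c_eq_sum hM, e1, e2, e4, e5]
    funext i
    fin_cases i <;> rfl

/-- The parameters are `c₂, c₃, c₅, c₆`; the equation of type B is linear in `c'₃`. -/
theorem four_le_dimH_B :
    4 ≤ dimH (family PolyTerm.exprF.toMvPolynomial .B \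
      ⋃ j ≠ PairType.B, family PolyTerm.exprF.toMvPolynomial j) := by
  -- a point at which the expressions in the inequalities do not vanish
  obtain ⟨w₀, h0, h1, h2, h3⟩ : ∃ w₀ : Fin 4 → ℝ, w₀ 0 = 1 ∧ w₀ 1 = 0 ∧ w₀ 2 = 2 ∧ w₀ 3 = -1 :=
    ⟨![1, 0, 2, -1], rfl, rfl, rfl, rfl⟩
  have hw : ∀ i, ContinuousAt (fun w : Fin 4 → ℝ => w i) w₀ := fun i =>
    (continuous_apply i).continuousAt
  refine four_le_dimH_of_eventually
    (π := fun a => ![∑ j, a 1 j, ∑ j, a 2 j, ∑ j, a 4 j, ∑ j, a 5 j]) ?_ (w₀ := w₀) ?_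
  · rw [contDiff_pi]
    intro i
    fin_cases i <;> simp <;> fun_prop
  -- the solution of the equation of type B
  obtain ⟨u, hu⟩ : ∃ u : (Fin 4 → ℝ) → ℝ, u = fun w => 3 * (w 1 - w 0) *
    (w 0 + w 1 - 4 * w 0 * w 1) / (2 * (3 - 12 * w 0 + 10 * w 0 ^ 2)) := ⟨_, rfl⟩
  have hu0 : u w₀ = -3 / 2 := by
    norm_num [hu, h0, h1, h2, h3]
  have hd : (2 * (3 - 12 * w₀ 0 + 10 * w₀ 0 ^ 2)) ≠ 0 := by
    norm_num [h0, h1, h2, h3]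
  have hcu : ContinuousAt u w₀ := hu ▸
    ContinuousAt.div (by fun_prop (disch := norm_num)) (by fun_prop (disch := norm_num)) hd
  have hd' : ∀ᶠ w in 𝓝 w₀, 2 * (3 - 12 * w 0 + 10 * w 0 ^ 2) ≠ 0 :=
    ContinuousAt.eventually_ne
      (g := fun w : Fin 4 → ℝ => 2 * (3 - 12 * w 0 + 10 * w 0 ^ 2))
      (by fun_prop (disch := norm_num)) hd
  have hg := eventually_starGood (w₀ := w₀) (x := fun w => w 0) (y := fun w => w 1)
    (u := u) (b := fun w => w 2) (c := fun w => w 3) (hw 0) (hw 1)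
    hcu (hw 2) (hw 3) (by rw [hu0]; norm_num [h0, h1, h2, h3])
    (by rw [hu0]; norm_num [starGood, starNode, Δ, W, lagrange, h0, h1, h2, h3])
  have hA : ∀ᶠ w in 𝓝 w₀, u w - w 1 ^ 2 / 2 ≠ 0 :=
    (hcu.sub (((hw 1).pow 2).div_const 2)).eventually_ne
      (show u w₀ - w₀ 1 ^ 2 / 2 ≠ 0 by rw [hu0]; norm_num [h1])
  have hC : ∀ᶠ w in 𝓝 w₀,
      polyC (w 0) (w 1) (u w) (w 2) (w 3) ≠ 0 := by
    refine (continuousAt_polyC (hw 0) (hw 1) hcu (hw 2) (hw 3)).eventually_ne ?_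
    rw [hu0]
    norm_num [polyC, h0, h1, h2, h3]
  filter_upwards [hg, hd', hA, hC] with w h hd hA hC
  obtain ⟨M, hM, hN, h4, h6, e1, e2, e4, e5, e6⟩ := exists_of_starGood h
  have hB : M.EqB := by
    rw [IsPairExceptLast.eqB_iff, e1, e2, e6, polyB]
    have := div_mul_cancel₀ (3 * (w 1 - w 0) * (w 0 + w 1 - 4 * w 0 * w 1)) hd
    simp only [hu]
    linear_combination -this
  refine ⟨_, mem_family_diff ⟨hM, ((hM.classification hN).2.1 h4).2.2 (Or.inr (Or.inl hB))⟩ hN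
    (k := .B) ⟨h4, hB⟩ ?_, ?_⟩
  · rintro (_ | _ | _ | _ | _) hj ⟨h1, h2⟩
    · rw [EqA, e2, e6] at h2
      exact hA (sub_eq_zero.2 h2)
    · exact hj rfl
    · rw [IsPairExceptLast.eqC_iff, e1, e2, e4, e5, e6] at h2
      exact hC h2
    · exact h6 h1
    · exact h6 h1
  · simp only [← c_eq_sum hM, e1, e2, e4, e5]
    funext i
    fin_cases i <;> rfl

/-- The parameters are `c₂, c₃, c'₃, c₅`; the equation of type C is linear in `c₆`. -/
theorem four_le_dimH_C :
    4 ≤ dimH (family PolyTerm.exprF.toMvPolynomial .C \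
      ⋃ j ≠ PairType.C, family PolyTerm.exprF.toMvPolynomial j) := by
  -- a point at which the expressions in the inequalities do not vanish
  obtain ⟨w₀, h0, h1, h2, h3⟩ : ∃ w₀ : Fin 4 → ℝ, w₀ 0 = 1 ∧ w₀ 1 = -1 ∧ w₀ 2 = -2 ∧ w₀ 3 = 2 :=
    ⟨![1, -1, -2, 2], rfl, rfl, rfl, rfl⟩
  have hw : ∀ i, ContinuousAt (fun w : Fin 4 → ℝ => w i) w₀ := fun i =>
    (continuous_apply i).continuousAt
  refine four_le_dimH_of_eventually
    (π := fun a => ![∑ j, a 1 j, ∑ j, a 2 j, ∑ j, a 2 j * ∑ k, a j k, ∑ j, a 4 j]) ?_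
    (w₀ := w₀) ?_
  · rw [contDiff_pi]
    intro i
    fin_cases i <;> simp <;> fun_prop
  -- the equation of type C is linear in `c₆`
  let m : ℝ → (Fin 4 → ℝ) → ℝ := fun c w => polyC (w 0) (w 1) (w 2) (w 3) c
  let c : (Fin 4 → ℝ) → ℝ := fun w => -m 0 w / (m 1 w - m 0 w)
  have hlin : ∀ c w, m c w = m 0 w + (m 1 w - m 0 w) * c := fun c w => by
    simp only [m, polyC]
    ring
  have hm : ∀ c w, ContinuousAt (m c) w := fun c w => by
    simp only [m, polyC]
    fun_prop
  have hd : m 1 w₀ - m 0 w₀ ≠ 0 := by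
    norm_num [m, polyC, h0, h1, h2, h3]
  have hc0 : c w₀ = 3 := by
    norm_num [c, m, polyC, h0, h1, h2, h3]
  have hc : ContinuousAt c w₀ := ContinuousAt.div (hm _ _).neg ((hm _ _).sub (hm _ _)) hd
  have hd' : ∀ᶠ w in 𝓝 w₀, m 1 w - m 0 w ≠ 0 :=
    ContinuousAt.eventually_ne ((hm _ _).sub (hm _ _)) hd
  have hg := eventually_starGood (w₀ := w₀) (x := fun w => w 0) (y := fun w => w 1)
    (u := fun w => w 2) (b := fun w => w 3) (c := c) (hw 0) (hw 1)
    (hw 2) (hw 3) hc (by norm_num [h0, h1, h2, h3])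
    (by rw [hc0]; norm_num [starGood, starNode, Δ, W, lagrange, h0, h1, h2, h3])
  have hA : ∀ᶠ w in 𝓝 w₀, w 2 - w 1 ^ 2 / 2 ≠ 0 :=
    ((hw 2).sub (((hw 1).pow 2).div_const 2)).eventually_ne
      (by norm_num [h0, h1, h2, h3])
  have hB : ∀ᶠ w in 𝓝 w₀, polyB (w 0) (w 1) (w 2) ≠ 0 := by
    refine ContinuousAt.eventually_ne (g := fun w : Fin 4 → ℝ => polyB (w 0) (w 1) (w 2)) ?_ ?_
    · simp only [polyB]
      fun_prop (disch := norm_num)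
    · norm_num [polyB, h0, h1, h2, h3]
  filter_upwards [hg, hd', hA, hB] with w h hd hA hB
  obtain ⟨M, hM, hN, h4, h6, e1, e2, e4, e5, e6⟩ := exists_of_starGood h
  have hC : M.EqC := by
    rw [IsPairExceptLast.eqC_iff, e1, e2, e4, e5, e6]
    refine (hlin (c w) w).trans ?_
    simp only [c]
    field_simp
    ring
  refine ⟨_, mem_family_diff ⟨hM, ((hM.classification hN).2.1 h4).2.2 (Or.inr (Or.inr hC))⟩ hN
    (k := .C) ⟨h4, hC⟩ ?_, ?_⟩
  · rintro (_ | _ | _ | _ | _) hj ⟨h1, h2⟩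
    · rw [EqA, e2, e6] at h2
      exact hA (sub_eq_zero.2 h2)
    · rw [IsPairExceptLast.eqB_iff, e1, e2, e6] at h2
      exact hB h2
    · exact hj rfl
    · exact h6 h1
    · exact h6 h1
  · simp only [← c_eq_sum hM, ← c'_eq_sum, e1, e2, e4, e6]
    funext i
    fin_cases i <;> rfl

theorem continuous_eval_exprF : Continuous fun v : Fin 5 → ℝ => PolyTerm.exprF.eval v := by
  simp only [← PolyTerm.aeval_toMvPolynomial, MvPolynomial.aeval_def, ← MvPolynomial.eval_map]
  exact MvPolynomial.continuous_eval _

/-- The parameters are `c₂, c₃, c₄, c₅`. -/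
theorem four_le_dimH_A' :
    4 ≤ dimH (family PolyTerm.exprF.toMvPolynomial .A' \
      ⋃ j ≠ PairType.A', family PolyTerm.exprF.toMvPolynomial j) := by
  -- a point at which the expressions in the inequalities do not vanish
  obtain ⟨w₀, h0, h1, h2, h3⟩ : ∃ w₀ : Fin 4 → ℝ, w₀ 0 = -1 ∧ w₀ 1 = -1 ∧ w₀ 2 = 2 ∧ w₀ 3 = -2 :=
    ⟨![-1, -1, 2, -2], rfl, rfl, rfl, rfl⟩
  have hw : ∀ i, ContinuousAt (fun w : Fin 4 → ℝ => w i) w₀ := fun i =>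
    (continuous_apply i).continuousAt
  refine four_le_dimH_of_eventually
    (π := fun a => ![∑ j, a 1 j, ∑ j, a 2 j, ∑ j, a 3 j, ∑ j, a 4 j]) ?_ (w₀ := w₀) ?_
  · rw [contDiff_pi]
    intro i
    fin_cases i <;> simp <;> fun_prop
  have hg := eventually_c6Good (w₀ := w₀) (x := fun w => w 0) (y := fun w => w 1)
    (u := fun w => w 1 ^ 2 / 2) (a := fun w => w 2) (b := fun w => w 3) (hw 0) (hw 1)
    (((hw 1).pow 2).div_const 2) (hw 2) (hw 3)
    (by norm_num [c6Good, Chain.star, stageD, stageN, V5, E5, V6, E6, h0, h1, h2, h3])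
  have hF : ∀ᶠ w in 𝓝 w₀,
      PolyTerm.exprF.eval ![w 0, w 1, w 2, w 3, w 1 ^ 2 / 2] ≠ 0 := by
    refine ContinuousAt.eventually_ne
      (g := fun w : Fin 4 → ℝ => PolyTerm.exprF.eval ![w 0, w 1, w 2, w 3, w 1 ^ 2 / 2]) ?_ ?_
    · refine (continuous_eval_exprF.comp (continuous_pi fun i => ?_)).continuousAt
      fin_cases i <;> simp <;> fun_prop
    · rw [eval_exprF]
      norm_num [coef0, coef1, coef2, h0, h1, h2, h3]
  filter_upwards [hg, hF] with w h hF
  obtain ⟨M, hM, hN, h4, h6, e1, e2, e3, e4, e6⟩ := exists_of_c6Good h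
  have hA : M.EqA := by rw [EqA, e6, e2]
  refine ⟨_, mem_family_diff ⟨hM, ((hM.classification hN).2.2.1 h6).2 (Or.inl hA)⟩ hN (k := .A')
    ⟨h6, hA⟩ ?_, ?_⟩
  · rintro (_ | _ | _ | _ | _) hj ⟨h1, h2⟩
    · exact h4 h1
    · exact h4 h1
    · exact h4 h1
    · exact hj rfl
    · rw [IsPairExceptLast.eqB'_iff, e1, e2, e3, e4, e6] at h2
      exact hF h2
  · simp only [← c_eq_sum hM, e1, e2, e3, e4]
    funext i
    fin_cases i <;> rfl

/-- The polynomial of type B′ is quadratic in `c₅`. -/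
theorem eval_exprF_quadratic (x y a b u : ℝ) :
    PolyTerm.exprF.eval ![x, y, a, b, u] = PolyTerm.exprF.eval ![x, y, a, 0, u]
      + (PolyTerm.exprF.eval ![x, y, a, 1, u] - PolyTerm.exprF.eval ![x, y, a, -1, u]) / 2 * b
      + ((PolyTerm.exprF.eval ![x, y, a, 1, u] + PolyTerm.exprF.eval ![x, y, a, -1, u]) / 2
        - PolyTerm.exprF.eval ![x, y, a, 0, u]) * b ^ 2 := by
  have h0 : ∀ T z : ℝ, coef0 T z y a b = coef0 T z y a 0
      + (coef0 T z y a 1 - coef0 T z y a (-1)) / 2 * b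
      + ((coef0 T z y a 1 + coef0 T z y a (-1)) / 2 - coef0 T z y a 0) * b ^ 2 := fun T z => by
    unfold coef0
    ring
  have h1 : ∀ T z : ℝ, coef1 T z y a b = coef1 T z y a 0
      + (coef1 T z y a 1 - coef1 T z y a (-1)) / 2 * b
      + ((coef1 T z y a 1 + coef1 T z y a (-1)) / 2 - coef1 T z y a 0) * b ^ 2 := fun T z => by
    unfold coef1
    ring
  have h2 : ∀ T z : ℝ, coef2 T z y a b = coef2 T z y a 0
      + (coef2 T z y a 1 - coef2 T z y a (-1)) / 2 * b
      + ((coef2 T z y a 1 + coef2 T z y a (-1)) / 2 - coef2 T z y a 0) * b ^ 2 := fun T z => by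
    unfold coef2
    ring
  simp only [eval_exprF]
  rw [h0, h1, h2]
  ring

/-- The parameters are `c₂, c₃, c₄, c'₃`; the equation of type B′ is quadratic in `c₅`, with
positive discriminant near the base point. -/
theorem four_le_dimH_B' :
    4 ≤ dimH (family PolyTerm.exprF.toMvPolynomial .B' \
      ⋃ j ≠ PairType.B', family PolyTerm.exprF.toMvPolynomial j) := by
  -- a point at which the expressions in the inequalities do not vanish and `c₅` is rational
  obtain ⟨w₀, h0, h1, h2, h3⟩ : ∃ w₀ : Fin 4 → ℝ,
      w₀ 0 = -1 ∧ w₀ 1 = 0 ∧ w₀ 2 = -(3 / 2) ∧ w₀ 3 = 1 :=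
    ⟨![-1, 0, -(3 / 2), 1], rfl, rfl, rfl, rfl⟩
  have hw : ∀ i, ContinuousAt (fun w : Fin 4 → ℝ => w i) w₀ := fun i =>
    (continuous_apply i).continuousAt
  refine four_le_dimH_of_eventually
    (π := fun a => ![∑ j, a 1 j, ∑ j, a 2 j, ∑ j, a 3 j, ∑ j, a 2 j * ∑ k, a j k]) ?_
    (w₀ := w₀) ?_
  · rw [contDiff_pi]
    intro i
    fin_cases i <;> simp <;> fun_prop
  -- a root `c₅` of the polynomial of type B′, rational at the base point
  let m : ℝ → (Fin 4 → ℝ) → ℝ := fun b w => PolyTerm.exprF.eval ![w 0, w 1, w 2, b, w 3]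
  let p : (Fin 4 → ℝ) → ℝ := fun w => (m 1 w + m (-1) w) / 2 - m 0 w
  let q : (Fin 4 → ℝ) → ℝ := fun w => (m 1 w - m (-1) w) / 2
  let b : (Fin 4 → ℝ) → ℝ := fun w => (-q w + √(q w ^ 2 - 4 * p w * m 0 w)) / (2 * p w)
  have hm : ∀ b w, ContinuousAt (m b) w := fun b w => by
    refine (continuous_eval_exprF.comp (continuous_pi fun i => ?_)).continuousAt
    fin_cases i <;> simp <;> fun_prop
  have hp : ∀ w, ContinuousAt p w := fun w => (((hm _ _).add (hm _ _)).div_const 2).sub (hm _ _)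
  have hq : ∀ w, ContinuousAt q w := fun w => ((hm _ _).sub (hm _ _)).div_const 2
  have m0 : m 0 w₀ = -3706290 := by
    simp only [m, eval_exprF]
    norm_num [coef0, coef1, coef2, h0, h1, h2, h3]
  have m1 : m 1 w₀ = -1782390 := by
    simp only [m, eval_exprF]
    norm_num [coef0, coef1, coef2, h0, h1, h2, h3]
  have m2 : m (-1) w₀ = -27254190 := by
    simp only [m, eval_exprF]
    norm_num [coef0, coef1, coef2, h0, h1, h2, h3]
  have p0 : p w₀ = -10812000 := by
    simp only [p, m0, m1, m2]
    norm_num [h0, h1, h2, h3]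
  have q0 : q w₀ = 12735900 := by
    simp only [q, m1, m2]
    norm_num [h0, h1, h2, h3]
  have disc : q w₀ ^ 2 - 4 * p w₀ * m 0 w₀ =
      1383300 ^ 2 := by
    rw [p0, q0, m0]
    norm_num [h0, h1, h2, h3]
  have hb0 : b w₀ = 21 / 40 := by
    simp only [b, disc]
    rw [Real.sqrt_sq (by norm_num [h0, h1, h2, h3]), p0, q0]
    norm_num [h0, h1, h2, h3]
  have hdc : ContinuousAt (fun w => q w ^ 2 - 4 * p w * m 0 w) w₀ :=
    ((hq _).pow 2).sub ((continuousAt_const.mul (hp _)).mul (hm _ _))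
  have hb : ContinuousAt b w₀ :=
    ContinuousAt.div ((hq _).neg.add hdc.sqrt) (continuousAt_const.mul (hp _))
      (by rw [p0]; norm_num [h0, h1, h2, h3])
  have hp' : ∀ᶠ w in 𝓝 w₀, p w ≠ 0 :=
    (hp _).eventually_ne (by rw [p0]; norm_num [h0, h1, h2, h3])
  have hd' : ∀ᶠ w in 𝓝 w₀, 0 < q w ^ 2 - 4 * p w * m 0 w :=
    hdc.eventually_const_lt (show 0 < q w₀ ^ 2 - 4 * p w₀ * m 0 w₀ by rw [disc]; norm_num)
  have hg := eventually_c6Good (w₀ := w₀) (x := fun w => w 0) (y := fun w => w 1)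
    (u := fun w => w 3) (a := fun w => w 2) (b := b) (hw 0) (hw 1)
    (hw 3) (hw 2) hb
    (by rw [hb0]; norm_num [c6Good, Chain.star, stageD, stageN, V5, E5, V6, E6, h0, h1, h2, h3])
  have hA : ∀ᶠ w in 𝓝 w₀, w 3 - w 1 ^ 2 / 2 ≠ 0 :=
    ((hw 3).sub (((hw 1).pow 2).div_const 2)).eventually_ne
      (by norm_num [h0, h1, h2, h3])
  filter_upwards [hg, hp', hd', hA] with w h hp hd hA
  obtain ⟨M, hM, hN, h4, h6, e1, e2, e3, e4, e6⟩ := exists_of_c6Good h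
  have hF : M.EqB' PolyTerm.exprF.toMvPolynomial := by
    rw [IsPairExceptLast.eqB'_iff, e1, e2, e3, e4, e6]
    have hr := Real.sq_sqrt hd.le
    have e : m 0 w + q w * b w + p w * b w ^ 2 = 0 := by
      have hb' : b w = (-q w + √(q w ^ 2 - 4 * p w * m 0 w)) / (2 * p w) := rfl
      generalize √(q w ^ 2 - 4 * p w * m 0 w) = r at hr hb'
      rw [hb']
      field_simp
      linear_combination hr
    rw [eval_exprF_quadratic]
    exact e
  refine ⟨_, mem_family_diff ⟨hM, ((hM.classification hN).2.2.1 h6).2 (Or.inr hF)⟩ hN (k := .B')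
    ⟨h6, hF⟩ ?_, ?_⟩
  · rintro (_ | _ | _ | _ | _) hj ⟨h1, h2⟩
    · exact h4 h1
    · exact h4 h1
    · exact h4 h1
    · rw [EqA, e2, e6] at h2
      exact hA (sub_eq_zero.2 h2)
    · exact hj rfl
  · simp only [← c_eq_sum hM, ← c'_eq_sum, e1, e2, e3, e6]
    funext i
    fin_cases i <;> rfl

theorem dimH_family (k : PairType) :
    dimH (family PolyTerm.exprF.toMvPolynomial k) = 4 ∧
      dimH (family PolyTerm.exprF.toMvPolynomial k \
        ⋃ j ≠ k, family PolyTerm.exprF.toMvPolynomial j) = 4 := by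
  have hle := dimH_family_le k
  have hsub : dimH (family PolyTerm.exprF.toMvPolynomial k \
      ⋃ j ≠ k, family PolyTerm.exprF.toMvPolynomial j) ≤
      dimH (family PolyTerm.exprF.toMvPolynomial k) := dimH_mono Set.sdiff_subset
  have hge : 4 ≤ dimH (family PolyTerm.exprF.toMvPolynomial k \
      ⋃ j ≠ k, family PolyTerm.exprF.toMvPolynomial j) := by
    cases k
    exacts [four_le_dimH_A, four_le_dimH_B, four_le_dimH_C, four_le_dimH_A', four_le_dimH_B']
  exact ⟨hle.antisymm (hge.trans hsub), (hsub.trans hle).antisymm hge⟩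

end LowerBound

theorem mainTheorem1 :
    ∃ F : MvPolynomial (Fin 5) ℚ,
      (F.degreeOf 0 = 8 ∧ F.degreeOf 1 = 17 ∧ F.degreeOf 2 = 3 ∧ F.degreeOf 3 = 2 ∧
        F.degreeOf 4 = 8) ∧
      (∀ M : Tableau, M.IsPairExceptLast → M.NonExceptional →
        (M.C4Equation ∨ M.c 5 = 1) ∧
        (M.C4Equation → M.d 6 = 0 ∧ (M.LastCondition ↔ M.EqA ∨ M.EqB ∨ M.EqC)) ∧
        (M.c 5 = 1 → (M.LastCondition ↔ M.EqA ∨ M.EqB' F)) ∧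
        (M.Simplifying ↔ M.EqA)) ∧
      (∀ M N : Tableau, M.IsPair → N.IsPair → M.NonExceptional → M.a = N.a →
        ∃ r : ℝ, r ≠ 0 ∧ N.d = r • M.d) ∧
      allPairs = ⋃ k, family F k ∧
      ∀ k, dimH (family F k) = 4 ∧ dimH (family F k \ ⋃ j ≠ k, family F j) = 4 := by
  
  refine ⟨PolyTerm.exprF.toMvPolynomial, PolyTerm.degreeOf_exprF,
    fun M h hn => h.classification hn, fun M N h h' hn ha => h.1.d_unique h'.1 hn ha,
    allPairs_eq_iUnion_family, dimH_family⟩
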